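/- Let $M$ be a simply connected smooth (Hausdorff, $\sigma$-compact) $4$-manifold without boundary, $V\to M$ a smooth real vector bundle of rank $4$, and $\mathfrak H$ a conformal Lorentzian inner product on $V$, i.e. a smooth section of the bundle of rays $(\mathrm{Sym}^2V^*\setminus\{0\})/\mathbb R_+$ of signature $(-,+,+,+)$. Let $\mathcal T(V)$ be the algebraic direct sum of all tensor products of $V$ and $V^*$. For $k\ge 0$ let $\mathcal P^k$ be the set of $\mathbb R$-linear maps $\Diamond:\Gamma(\mathcal T(V))\to\Gamma(\wedge^kV^*\otimes\mathcal T(V))$ such that, writing $\Diamond_Yu=i_Y(\Diamond u)$ for the interior multiplication by $Y\in\Gamma(V^{\otimes k})$ on the first $k$ factors: $\Diamond_Y$ maps $C^\infty(M)$, $\Gamma(V)$, $\Gamma(V^*)$ into themselves; $\Diamond_Y(u\otimes v)=(\Diamond_Yu)\otimes v+u\otimes\Diamond_Yv$; $\Diamond I=0$ for the identity $I\in\Gamma(\mathrm{End}\,V)$, $\mathrm{End}\,V=V^*\otimes V$; and for every representative $\mathfrak h\in\Gamma(\mathrm{Sym}^2V^*)$ of $\mathfrak H$ one has $\Diamond\mathfrak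 h=\mu\otimes\mathfrak h$ for some $\mu\in\Gamma(\wedge^kV^*)$. Let $\mathcal P^k_\perp$ be the set of $\Diamond\in\mathcal P^k$ with $\Diamond f=0$ for all $f\in C^\infty(M)$. For $\Diamond,\Diamond'\in\mathcal P^1$ set $[[\Diamond,\Diamond']]=\wedge_{1,1}\Diamond\Diamond'+\wedge_{1,1}\Diamond'\Diamond$, where $\wedge_{1,1}(\xi\otimes\eta\otimes u)=(\xi\wedge\eta)\otimes u$ for $\xi,\eta\in\Gamma(V^*)$ and $\xi\wedge\eta=\xi\otimes\eta-\eta\otimes\xi$. Let $\mathcal R^2=\Gamma(\wedge^2V^*\otimes\mathrm{Lie}(V,\mathfrak H))$, where $\mathrm{Lie}(V,\mathfrak H)_p$ consists of the $A\in\mathrm{End}(V_p)$ for which there is $\lambda\in\mathbb R$ with $\mathfrak h_p(Ay,z)+\mathfrak h_p(y,Az)=\lambda\,\mathfrak h_p(y,z)$ for all $y,z\in V_p$. For $\Diamond'\in\mathcal P^2_\perp$ let $\beta(\Diamond')\in\mathcal R^2$ be given by $\beta(\Diamond')_YZ=\Diamond'_YZ$, $Z\in\Gamma(V)$. For $\Diamond\in\mathcal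 P^1$ let $\mathcal E^\Diamond:V\to TM$ be the vector bundle homomorphism with $(\mathcal E^\Diamond(Y))(f)=\Diamond_Yf$ for $Y\in\Gamma(V)$, $f\in C^\infty(M)$. Let $\mathcal E':V\to TM$ be a vector bundle isomorphism and let $\mathfrak h'$ be a representative of $\mathfrak H$. Then there is a unique $\Diamond\in\mathcal P^1$ such that (a) $\mathcal E^\Diamond$ is a vector bundle isomorphism; (b) $\tfrac12[[\Diamond,\Diamond]]\in\mathcal P^2_\perp$; (c) $\Upsilon=\beta(\tfrac12[[\Diamond,\Diamond]])\in\mathcal R^2$ satisfies $\mathrm{tr}(\Upsilon_{Y_1\otimes Y_2})=0$ for all $Y_1,Y_2\in\Gamma(V)$; (d) $\mathcal E^\Diamond=\mathcal E'$; (e) $\Diamond\mathfrak h'=\mu\otimes\mathfrak h'$ with $\mu=0$. This $\Diamond$ is the pullback under $\mathcal E'$ of the Levi-Civita connection $\nabla$ of the Lorentzian metric $\mathcal E'(\mathfrak h')$ on $M$: $\Diamond_Yf=(\mathcal E'(Y))(f)$ and $\Diamond_YZ=\mathcal E'^{-1}\big(\nabla_{\mathcal E'(Y)}\mathcal E'(Z)\big)$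 for all $f\in C^\infty(M)$ and $Y,Z\in\Gamma(V)$. -/

import Mathlib

open Bundle Manifold ContDiff Topology
open scoped BigOperators

set_option linter.unusedSectionVars false

noncomputable section

namespace Diamond

/-! ### Linear algebra of one fibre -/

section Fibre

variable {W : Type*} [AddCommGroup W] [Module ℝ W]

/-- The algebraic direct sum of all tensor products of `W` and `W*`. Multiplication is `⊗`. -/
abbrev Tens (W : Type*) [AddCommGroup W] [Module ℝ W] : Type _ :=
  TensorAlgebra ℝ (W × Module.Dual ℝ W)

/-- The inclusion of `W`. -/
def vec : W →ₗ[ℝ] Tens W :=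
  (TensorAlgebra.ι ℝ).comp (LinearMap.inl ℝ W (Module.Dual ℝ W))

/-- The inclusion of `W*`. -/
def cov : Module.Dual ℝ W →ₗ[ℝ] Tens W :=
  (TensorAlgebra.ι ℝ).comp (LinearMap.inr ℝ W (Module.Dual ℝ W))

/-- Auxiliary: `w` acts on pairs by `(a, b) ↦ (w ⊗ a, ⟨w, y⟩ a)`. -/
def contrAux (y : W) : (W × Module.Dual ℝ W) →ₗ[ℝ] Module.End ℝ (Tens W × Tens W) where
  toFun w := LinearMap.prod
    ((LinearMap.mulLeft ℝ (TensorAlgebra.ι ℝ w)).comp (LinearMap.fst ℝ _ _))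
    (w.2 y • LinearMap.fst ℝ _ _)
  map_add' w w' := by
    ext <;> simp [add_mul, add_smul]
  map_smul' c w := by
    ext <;> simp [mul_smul]

/-- Interior multiplication by `y` acting on the first tensor factor:
`ξ ⊗ t ↦ ξ(y) t` for `ξ ∈ W*`, while `v ⊗ t ↦ 0` for `v ∈ W` and `1 ↦ 0`
(see `contr_one`, `contr_vec_mul`, `contr_cov_mul`). -/
def contr (y : W) : Tens W →ₗ[ℝ] Tens W :=
  (LinearMap.snd ℝ (Tens W) (Tens W)).comp
    ((LinearMap.applyₗ ((1 : Tens W), (0 : Tens W))).comp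
      (TensorAlgebra.lift ℝ (contrAux y)).toLinearMap)

theorem lift_contrAux_fst (y : W) (t : Tens W) (x : Tens W × Tens W) :
    (TensorAlgebra.lift ℝ (contrAux y) t x).1 = t * x.1 := by
  induction t using TensorAlgebra.induction generalizing x with
  | algebraMap r => simp [Module.algebraMap_end_apply, Algebra.smul_def]
  | ι w => simp [contrAux]
  | mul a b ha hb => simp [ha, hb, mul_assoc]
  | add a b ha hb => simp [ha, hb, add_mul]

theorem contr_ι_mul (y : W) (w : W × Module.Dual ℝ W) (t : Tens W) :
    contr y (TensorAlgebra.ι ℝ w * t) = w.2 y • t := by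
  have h := lift_contrAux_fst y t ((1 : Tens W), (0 : Tens W))
  rw [mul_one] at h
  simp only [contr, LinearMap.comp_apply, AlgHom.toLinearMap_apply, map_mul,
    LinearMap.applyₗ_apply_apply, Module.End.mul_apply, TensorAlgebra.lift_ι_apply]
  simp only [contrAux, LinearMap.coe_mk, AddHom.coe_mk, LinearMap.prod_apply, LinearMap.snd_apply]
  exact congrArg _ h

theorem contr_one (y : W) : contr y (1 : Tens W) = 0 := by
  simp [contr]

theorem contr_vec_mul (y v : W) (t : Tens W) : contr y (vec v * t) = 0 := by
  simp [vec, contr_ι_mul]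

theorem contr_cov_mul (y : W) (ξ : Module.Dual ℝ W) (t : Tens W) :
    contr y (cov ξ * t) = ξ y • t := by
  simp [cov, contr_ι_mul]

/-- Interior multiplication by `y₀ ⊗ ⋯ ⊗ y₍ₖ₋₁₎` on the first `k` factors. -/
def contrMany : (k : ℕ) → (Fin k → W) → Tens W →ₗ[ℝ] Tens W
  | 0, _ => LinearMap.id
  | k + 1, y => (contrMany k (Fin.tail y)).comp (contr (y 0))

/-- The value `t(y, z)` of a tensor `t ∈ W* ⊗ W*`. -/
def pairing (t : Tens W) (y z : W) : ℝ :=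
  TensorAlgebra.algebraMapInv (contr z (contr y t))

theorem pairing_cov_mul_cov (ξ η : Module.Dual ℝ W) (y z : W) :
    pairing (cov ξ * cov η) y z = ξ y * η z := by
  have h : contr z (cov η) = algebraMap ℝ (Tens W) (η z) := by
    rw [← mul_one (cov η), contr_cov_mul, Algebra.algebraMap_eq_smul_one]
  simp [pairing, contr_cov_mul, h]

/-- `ξ₁ ∧ ⋯ ∧ ξₖ = ∑_σ sgn(σ) ξ_{σ(1)} ⊗ ⋯ ⊗ ξ_{σ(k)}`. -/
def wedge {k : ℕ} (ξ : Fin k → Module.Dual ℝ W) : Tens W :=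
  ∑ σ : Equiv.Perm (Fin k),
    ((Equiv.Perm.sign σ : ℤ) : ℝ) • (List.ofFn fun i => cov (ξ (σ i))).prod

/-- `∧ᵏ W*`. -/
def formFibre (W : Type*) [AddCommGroup W] [Module ℝ W] (k : ℕ) : Submodule ℝ (Tens W) :=
  Submodule.span ℝ {t | ∃ ξ : Fin k → Module.Dual ℝ W, t = wedge ξ}

/-- `∧ᵏ W* ⊗ 𝒯(W)`. -/
def formTensFibre (W : Type*) [AddCommGroup W] [Module ℝ W] (k : ℕ) : Submodule ℝ (Tens W) :=
  Submodule.span ℝ {t | ∃ (ξ : Fin k → Module.Dual ℝ W) (u : Tens W), t = wedge ξ * u}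

/-- The Lorentzian inner products, as elements of `Sym² W* ⊆ W* ⊗ W*`: in some basis with
dual basis `λ` the tensor is `-λ⁰⊗λ⁰ + λ¹⊗λ¹ + λ²⊗λ² + λ³⊗λ³`. -/
def IsLorentz (t : Tens W) : Prop :=
  ∃ b : Module.Basis (Fin 4) ℝ W,
    t = -(cov (b.coord 0) * cov (b.coord 0)) + cov (b.coord 1) * cov (b.coord 1)
      + cov (b.coord 2) * cov (b.coord 2) + cov (b.coord 3) * cov (b.coord 3)

/-- The identity of `W`, as the element `∑ λᵃ ⊗ Fₐ` of `W* ⊗ W = End W`. -/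
def idTens {ι : Type*} [Fintype ι] (b : Module.Basis ι ℝ W) : Tens W :=
  ∑ a, cov (b.coord a) * vec (b a)

/-- `∧ : W* ⊗ 𝒯(W) → ∧² W* ⊗ 𝒯(W)`, `η ⊗ t ↦ (ξ ∧ η) ⊗ t`, for fixed `ξ ∈ W*`. -/
def wedgeLeft {ι : Type*} [Fintype ι] (b : Module.Basis ι ℝ W) (ξ : Module.Dual ℝ W) :
    Tens W →ₗ[ℝ] Tens W :=
  ∑ c, (LinearMap.mulLeft ℝ (wedge ![ξ, b.coord c])).comp (contr (b c))

/-- The wedge product operator `W* ⊗ W* ⊗ 𝒯(W) → ∧² W* ⊗ 𝒯(W)`, `ξ ⊗ η ⊗ t ↦ (ξ ∧ η) ⊗ t`,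
extended by `0` to the other summands of `𝒯(W)` (see `wedgeOp_cov_mul_cov_mul`). -/
def wedgeOp {ι : Type*} [Fintype ι] (b : Module.Basis ι ℝ W) : Tens W →ₗ[ℝ] Tens W :=
  ∑ a, (wedgeLeft b (b.coord a)).comp (contr (b a))

theorem wedge_pair (ξ η : Module.Dual ℝ W) :
    wedge ![ξ, η] = cov ξ * cov η - cov η * cov ξ := by
  have h : (Finset.univ : Finset (Equiv.Perm (Fin 2))) = {1, Equiv.swap 0 1} := by decide
  have h' : (1 : Equiv.Perm (Fin 2)) ≠ Equiv.swap 0 1 := by decide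
  simp [wedge, h, Finset.sum_pair h', sub_eq_add_neg]

theorem wedgeLeft_ι_mul {ι : Type*} [Fintype ι] (b : Module.Basis ι ℝ W)
    (ξ : Module.Dual ℝ W) (w : W × Module.Dual ℝ W) (t : Tens W) :
    wedgeLeft b ξ (TensorAlgebra.ι ℝ w * t) = (cov ξ * cov w.2 - cov w.2 * cov ξ) * t := by
  classical
  have h : ∑ c, w.2 (b c) • cov (b.coord c) = cov w.2 := by
    conv_rhs => rw [← b.sum_dual_apply_smul_coord w.2]
    simp only [map_sum, map_smul]
  simp only [wedgeLeft, LinearMap.sum_apply, LinearMap.comp_apply, contr_ι_mul,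
    LinearMap.mulLeft_apply, wedge_pair, mul_smul_comm, ← h]
  simp [Finset.mul_sum, Finset.sum_mul, sub_mul, smul_sub, Finset.sum_sub_distrib]

theorem wedgeOp_ι_mul {ι : Type*} [Fintype ι] (b : Module.Basis ι ℝ W)
    (w : W × Module.Dual ℝ W) (t : Tens W) :
    wedgeOp b (TensorAlgebra.ι ℝ w * t) = wedgeLeft b w.2 t := by
  classical
  have h : ∑ c, w.2 (b c) • cov (b.coord c) = cov w.2 := by
    conv_rhs => rw [← b.sum_dual_apply_smul_coord w.2]
    simp only [map_sum, map_smul]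
  simp only [wedgeOp, wedgeLeft, LinearMap.sum_apply, LinearMap.comp_apply, contr_ι_mul,
    LinearMap.mulLeft_apply, wedge_pair, map_smul]
  rw [Finset.sum_congr rfl fun a _ => Finset.smul_sum, Finset.sum_comm]
  refine Finset.sum_congr rfl fun c _ => ?_
  rw [← h]
  simp [Finset.mul_sum, Finset.sum_mul, sub_mul, smul_sub, Finset.sum_sub_distrib]

theorem wedgeOp_cov_mul_cov_mul {ι : Type*} [Fintype ι] (b : Module.Basis ι ℝ W)
    (ξ η : Module.Dual ℝ W) (t : Tens W) :
    wedgeOp b (cov ξ * (cov η * t)) = wedge ![ξ, η] * t := by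
  have h1 := wedgeOp_ι_mul b ((0 : W), ξ) (cov η * t)
  have h2 := wedgeLeft_ι_mul b ξ ((0 : W), η) t
  rw [wedge_pair]
  exact h1.trans h2

theorem idTens_eq {ι κ : Type*} [Fintype ι] [Fintype κ] (b : Module.Basis ι ℝ W)
    (b' : Module.Basis κ ℝ W) : idTens b = idTens b' := by
  classical
  have h1 : ∀ a, vec (b a) = ∑ c, b'.coord c (b a) • vec (b' c) := by
    intro a
    conv_lhs => rw [← b'.sum_repr (b a)]
    simp only [map_sum, map_smul, Module.Basis.coord_apply]
  have h2 : ∀ c, cov (b'.coord c) = ∑ a, b'.coord c (b a) • cov (b.coord a) := by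
    intro c
    conv_lhs => rw [← b.sum_dual_apply_smul_coord (b'.coord c)]
    simp only [map_sum, map_smul]
  simp only [idTens, h1, h2, Finset.mul_sum, Finset.sum_mul, mul_smul_comm, smul_mul_assoc]
  rw [Finset.sum_comm]

end Fibre

/-! ### Tensor fields of a rank four vector bundle over a four-manifold -/

/-- The model space `ℝ⁴`. -/
abbrev R4 : Type := EuclideanSpace ℝ (Fin 4)

section Bundle

variable {M : Type*} [TopologicalSpace M] [ChartedSpace R4 M]
variable (V : M → Type*) [TopologicalSpace (TotalSpace R4 V)]
  [∀ p, TopologicalSpace (V p)] [∀ p, AddCommGroup (V p)] [∀ p, Module ℝ (V p)]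
  [FiberBundle R4 V] [VectorBundle ℝ R4 V]

/-- `C^∞(M)`. -/
abbrev Fun (M : Type*) [TopologicalSpace M] [ChartedSpace R4 M] : Type _ :=
  C^∞⟮𝓡 4, M; ℝ⟯

/-- `Γ(V)`. -/
abbrev VecSec : Type _ := ContMDiffSection (𝓡 4) R4 ∞ V

/-- `Γ(V*)`. -/
abbrev CovSec : Type _ :=
  ContMDiffSection (𝓡 4) (R4 →L[ℝ] ℝ) ∞ (fun p => V p →L[ℝ] ℝ)

/-- The elementary tensor fields that are smooth on `U`: functions, sections of `V` and
sections of `V*`. -/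
def smoothGen (U : Set M) : Set (∀ p, Tens (V p)) :=
  {u | ∃ f : M → ℝ, ContMDiffOn (𝓡 4) 𝓘(ℝ, ℝ) ∞ f U ∧
      u = fun p => algebraMap ℝ (Tens (V p)) (f p)} ∪
  {u | ∃ Y : ∀ p, V p,
      ContMDiffOn (𝓡 4) ((𝓡 4).prod 𝓘(ℝ, R4)) ∞ (fun p => TotalSpace.mk' R4 p (Y p)) U ∧
      u = fun p => vec (Y p)} ∪
  {u | ∃ ξ : ∀ p, V p →L[ℝ] ℝ,
      ContMDiffOn (𝓡 4) ((𝓡 4).prod 𝓘(ℝ, R4 →L[ℝ] ℝ)) ∞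
        (fun p => TotalSpace.mk' (R4 →L[ℝ] ℝ) p (ξ p)) U ∧
      u = fun p => cov (ξ p : V p →ₗ[ℝ] ℝ)}

/-- Finite sums of tensor products of elementary tensor fields that are smooth on `U`. -/
def smoothAlg (U : Set M) : Subalgebra ℝ (∀ p, Tens (V p)) :=
  Algebra.adjoin ℝ (smoothGen V U)

theorem smoothGen_mono {U U' : Set M} (h : U ⊆ U') : smoothGen V U' ⊆ smoothGen V U := by
  rintro u ((⟨f, hf, rfl⟩ | ⟨Y, hY, rfl⟩) | ⟨ξ, hξ, rfl⟩)
  · exact Or.inl (Or.inl ⟨f, hf.mono h, rfl⟩)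
  · exact Or.inl (Or.inr ⟨Y, hY.mono h, rfl⟩)
  · exact Or.inr ⟨ξ, hξ.mono h, rfl⟩

theorem smoothAlg_mono {U U' : Set M} (h : U ⊆ U') : smoothAlg V U' ≤ smoothAlg V U :=
  Algebra.adjoin_mono (smoothGen_mono V h)

/-- A tensor field is smooth at `p` if, on a neighbourhood of `p`, it is a finite sum of tensor
products of smooth functions, smooth sections of `V` and smooth sections of `V*`. -/
def IsSmoothNear (u : ∀ p, Tens (V p)) (p : M) : Prop :=
  ∃ U : Set M, IsOpen U ∧ p ∈ U ∧ ∃ u' ∈ smoothAlg V U, ∀ q ∈ U, u q = u' q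

/-- The algebra `Γ(𝒯(V))` of smooth sections of the tensor bundle; multiplication is `⊗`. -/
def tensorFields : Subalgebra ℝ (∀ p, Tens (V p)) where
  carrier := {u | ∀ p, IsSmoothNear V u p}
  mul_mem' := by
    intro u v hu hv p
    obtain ⟨U, hU, hpU, u', hu', huu'⟩ := hu p
    obtain ⟨U₂, hU₂, hpU₂, v', hv', hvv'⟩ := hv p
    refine ⟨U ∩ U₂, hU.inter hU₂, ⟨hpU, hpU₂⟩, u' * v',
      mul_mem (smoothAlg_mono V Set.inter_subset_left hu')
        (smoothAlg_mono V Set.inter_subset_right hv'), fun q hq => ?_⟩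
    simp [huu' q hq.1, hvv' q hq.2]
  add_mem' := by
    intro u v hu hv p
    obtain ⟨U, hU, hpU, u', hu', huu'⟩ := hu p
    obtain ⟨U₂, hU₂, hpU₂, v', hv', hvv'⟩ := hv p
    refine ⟨U ∩ U₂, hU.inter hU₂, ⟨hpU, hpU₂⟩, u' + v',
      add_mem (smoothAlg_mono V Set.inter_subset_left hu')
        (smoothAlg_mono V Set.inter_subset_right hv'), fun q hq => ?_⟩
    simp [huu' q hq.1, hvv' q hq.2]
  algebraMap_mem' := by
    intro r p
    exact ⟨Set.univ, isOpen_univ, trivial, _, (smoothAlg V Set.univ).algebraMap_mem r,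
      fun q _ => rfl⟩

/-- `Γ(𝒯(V))` as a type. -/
abbrev TF : Type _ := tensorFields V

variable {V}

theorem smoothAlg_univ_le : smoothAlg V Set.univ ≤ tensorFields V :=
  fun u hu _ => ⟨Set.univ, isOpen_univ, trivial, u, hu, fun _ _ => rfl⟩

variable (V) in
/-- `C^∞(M) ⊆ Γ(𝒯(V))`. -/
def ofFun (f : Fun M) : TF V :=
  ⟨fun p => algebraMap ℝ (Tens (V p)) (f p), smoothAlg_univ_le <| Algebra.subset_adjoin <|
    Or.inl (Or.inl ⟨f, f.contMDiff.contMDiffOn, rfl⟩)⟩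

/-- `Γ(V) ⊆ Γ(𝒯(V))`. -/
def ofVec (Y : VecSec V) : TF V :=
  ⟨fun p => vec (Y p), smoothAlg_univ_le <| Algebra.subset_adjoin <|
    Or.inl (Or.inr ⟨fun p => Y p, Y.contMDiff.contMDiffOn, rfl⟩)⟩

/-- `Γ(V*) ⊆ Γ(𝒯(V))`. -/
def ofCov (ξ : CovSec V) : TF V :=
  ⟨fun p => cov (ξ p : V p →ₗ[ℝ] ℝ), smoothAlg_univ_le <| Algebra.subset_adjoin <|
    Or.inr ⟨fun p => ξ p, ξ.contMDiff.contMDiffOn, rfl⟩⟩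

variable (V) in
/-- A basis of the fibre `V_p`, given by a trivialization at `p`. The objects below that are
written with it do not depend on its choice. -/
def fibreBasis (p : M) : Module.Basis (Fin 4) ℝ (V p) :=
  (trivializationAt R4 V p).basisAt (EuclideanSpace.basisFun (Fin 4) ℝ).toBasis
    (mem_baseSet_trivializationAt R4 V p)

variable [ContMDiffVectorBundle ∞ R4 V (𝓡 4)]

variable (V) in
/-- The dual of a local frame given by a trivialization consists of smooth sections of `V*`. -/
theorem exists_dualFrame (p₀ : M) (a : Fin 4) : ∃ ξ : ∀ p, V p →L[ℝ] ℝ,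
    ContMDiffOn (𝓡 4) ((𝓡 4).prod 𝓘(ℝ, R4 →L[ℝ] ℝ)) ∞
        (fun p => TotalSpace.mk' (R4 →L[ℝ] ℝ) p (ξ p)) (trivializationAt R4 V p₀).baseSet ∧
    ∀ p (hp : p ∈ (trivializationAt R4 V p₀).baseSet), (ξ p : V p →ₗ[ℝ] ℝ) =
      ((trivializationAt R4 V p₀).basisAt
        (EuclideanSpace.basisFun (Fin 4) ℝ).toBasis hp).coord a := by
  let L : R4 →L[ℝ] ℝ :=
    LinearMap.toContinuousLinearMap ((EuclideanSpace.basisFun (Fin 4) ℝ).toBasis.coord a)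
  let e := trivializationAt R4 V p₀
  refine ⟨fun p => L.comp (e.continuousLinearMapAt ℝ p), ?_, ?_⟩
  · let e' := trivializationAt (R4 →L[ℝ] ℝ) (fun p => V p →L[ℝ] ℝ) p₀
    have key := e'.contMDiffOn_section_iff (IB := 𝓡 4) (n := ∞)
      (s := fun p => L.comp (e.continuousLinearMapAt ℝ p)) (a := e.baseSet) e.open_baseSet
      (fun x hx => ⟨hx, trivial⟩)
    refine key.2 ((contMDiffOn_const (c := L)).congr fun p hp => ?_)
    rw [hom_trivializationAt_apply]
    ext v
    simpa [ContinuousLinearMap.inCoordinates, e] using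
      congrArg L (e.continuousLinearMapAt_symmL (R := ℝ) hp v)
  · intro p hp
    ext v
    simp [L, e, Bundle.Trivialization.basisAt,
      (trivializationAt R4 V p₀).coe_linearMapAt_of_mem hp]

variable (V) in
/-- The identity `I ∈ Γ(V* ⊗ V) = Γ(End V)`. -/
def idField : TF V :=
  ⟨fun p => idTens (fibreBasis V p), fun p₀ => by
    choose ξ hξ hξ' using exists_dualFrame V p₀
    refine ⟨_, (trivializationAt R4 V p₀).open_baseSet, mem_baseSet_trivializationAt R4 V p₀,
      ∑ a, (fun p => cov (ξ a p : V p →ₗ[ℝ] ℝ)) * (fun p => vec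
        ((trivializationAt R4 V p₀).localFrame (EuclideanSpace.basisFun (Fin 4) ℝ).toBasis a p)),
      sum_mem fun a _ => mul_mem (Algebra.subset_adjoin <| Or.inr ⟨ξ a, hξ a, rfl⟩)
        (Algebra.subset_adjoin <| Or.inl <| Or.inr ⟨_,
          (trivializationAt R4 V p₀).contMDiffOn_localFrame_baseSet _ _ a, rfl⟩), fun q hq => ?_⟩
    refine (idTens_eq _ ((trivializationAt R4 V p₀).basisAt
        (EuclideanSpace.basisFun (Fin 4) ℝ).toBasis hq)).trans ?_
    simp [idTens, hξ' _ q hq, hq]⟩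

/-- Every section in `smoothGen` is a function or has the form `ι (v, η)` with `η` smooth. -/
theorem smoothGen_cases {U : Set M} {u : ∀ p, Tens (V p)} (hu : u ∈ smoothGen V U) :
    (∃ f : M → ℝ, u = fun p => algebraMap ℝ (Tens (V p)) (f p)) ∨
    ∃ w : ∀ p, V p × Module.Dual ℝ (V p), (u = fun p => TensorAlgebra.ι ℝ (w p)) ∧
      (fun p => cov (w p).2) ∈ smoothAlg V U := by
  rcases hu with (⟨f, hf, rfl⟩ | ⟨Y, hY, rfl⟩) | ⟨ξ, hξ, rfl⟩
  · exact Or.inl ⟨f, rfl⟩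
  · refine Or.inr ⟨fun p => (Y p, 0), rfl, ?_⟩
    have : (fun p => cov ((0 : Module.Dual ℝ (V p)))) = (0 : ∀ p, Tens (V p)) := by
      funext p; simp
    exact this ▸ zero_mem _
  · exact Or.inr ⟨fun p => (0, (ξ p : V p →ₗ[ℝ] ℝ)), rfl,
      Algebra.subset_adjoin (Or.inr ⟨ξ, hξ, rfl⟩)⟩

theorem smoothAlg_induction {U : Set M} {P : (∀ p, Tens (V p)) → Prop} (h0 : P 0) (h1 : P 1)
    (hadd : ∀ u v, P u → P v → P (u + v)) (hsmul : ∀ (r : ℝ) u, P u → P (r • u))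
    (hmul : ∀ g ∈ smoothGen V U, ∀ m ∈ smoothAlg V U, P m → P (g * m))
    {u : ∀ p, Tens (V p)} (hu : u ∈ smoothAlg V U) : P u := by
  have hu' : u ∈ Submodule.span ℝ (Submonoid.closure (smoothGen V U) : Set (∀ p, Tens (V p))) := by
    rw [← Algebra.adjoin_eq_span]; exact hu
  have hcl : ∀ m ∈ Submonoid.closure (smoothGen V U), m ∈ smoothAlg V U := by
    intro m hm
    have : m ∈ Subalgebra.toSubmodule (Algebra.adjoin ℝ (smoothGen V U)) := by
      rw [Algebra.adjoin_eq_span]; exact Submodule.subset_span hm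
    exact this
  refine Submodule.span_induction (p := fun x _ => P x) ?_ h0 (fun u v _ _ => hadd u v)
    (fun r u _ => hsmul r u) hu'
  intro m hm
  refine Submonoid.closure_induction_left (motive := fun x _ => P x) h1 ?_ hm
  intro g hg m hm ih
  exact hmul g hg m (hcl m hm) ih

theorem wedgeLeft_mem {U : Set M} {η : ∀ p, Module.Dual ℝ (V p)}
    (hη : (fun p => cov (η p)) ∈ smoothAlg V U) {u : ∀ p, Tens (V p)} (hu : u ∈ smoothAlg V U) :
    (fun p => wedgeLeft (fibreBasis V p) (η p) (u p)) ∈ smoothAlg V U := by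
  refine smoothAlg_induction (P := fun u : ∀ p, Tens (V p) =>
    (fun p => wedgeLeft (fibreBasis V p) (η p) (u p)) ∈ smoothAlg V U) ?_ ?_ ?_ ?_ ?_ hu
  · convert zero_mem (smoothAlg V U) using 1
    funext p; simp
  · convert zero_mem (smoothAlg V U) using 1
    funext p; simp [wedgeLeft, contr_one]
  · intro u v hu hv
    convert add_mem hu hv using 1
    funext p; simp
  · intro r u hu
    convert Subalgebra.smul_mem _ hu r using 1
    funext p; simp
  · intro g hg m hm ih
    rcases smoothGen_cases hg with ⟨f, rfl⟩ | ⟨w, rfl, hw⟩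
    · have hg' : _ ∈ smoothAlg V U := Algebra.subset_adjoin hg
      convert mul_mem hg' ih using 1
      funext p; simp [← Algebra.smul_def]
    · convert mul_mem (sub_mem (mul_mem hη hw) (mul_mem hw hη)) hm using 1
      funext p; simp [wedgeLeft_ι_mul]

theorem wedgeOp_mem {U : Set M} {u : ∀ p, Tens (V p)} (hu : u ∈ smoothAlg V U) :
    (fun p => wedgeOp (fibreBasis V p) (u p)) ∈ smoothAlg V U := by
  refine smoothAlg_induction (P := fun u : ∀ p, Tens (V p) =>
    (fun p => wedgeOp (fibreBasis V p) (u p)) ∈ smoothAlg V U) ?_ ?_ ?_ ?_ ?_ hu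
  · convert zero_mem (smoothAlg V U) using 1
    funext p; simp
  · convert zero_mem (smoothAlg V U) using 1
    funext p; simp [wedgeOp, contr_one]
  · intro u v hu hv
    convert add_mem hu hv using 1
    funext p; simp
  · intro r u hu
    convert Subalgebra.smul_mem _ hu r using 1
    funext p; simp
  · intro g hg m hm ih
    rcases smoothGen_cases hg with ⟨f, rfl⟩ | ⟨w, rfl, hw⟩
    · have hg' : _ ∈ smoothAlg V U := Algebra.subset_adjoin hg
      convert mul_mem hg' ih using 1
      funext p; simp [← Algebra.smul_def]
    · convert wedgeLeft_mem hw hm using 1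
      funext p; simp [wedgeOp_ι_mul]

/-- The wedge product operator `∧_{1,1}`, which maps `Γ(V* ⊗ V* ⊗ 𝒯(V))` to
`Γ(∧² V* ⊗ 𝒯(V))` by `ξ ⊗ η ⊗ u ↦ (ξ ∧ η) ⊗ u`. -/
def wedgeField : TF V →ₗ[ℝ] TF V where
  toFun u := ⟨fun p => wedgeOp (fibreBasis V p) (u.1 p), fun p => by
    obtain ⟨U, hU, hpU, u', hu', huu'⟩ := u.2 p
    exact ⟨U, hU, hpU, _, wedgeOp_mem hu', fun q hq => by simp [huu' q hq]⟩⟩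
  map_add' u v := by
    ext p; simp
  map_smul' r u := by
    ext p; simp

/-! ### Diamonds -/

variable (V) in
/-- A section of the bundle of rays of `Sym² V*`, of signature `(-,+,+,+)`: a conformal
Lorentzian inner product on `V`. Smoothness means that it locally has smooth representatives. -/
structure ConformalStructure where
  /-- The ray at each point. -/
  ray : ∀ p, Module.Ray ℝ (Tens (V p))
  smooth : ∀ p, ∃ U : Set M, IsOpen U ∧ p ∈ U ∧ ∃ t ∈ smoothAlg V U, ∀ q ∈ U,
    IsLorentz (t q) ∧ ∃ hne : t q ≠ 0, rayOfNeZero ℝ (t q) hne = ray q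

/-- `h ∈ Γ(Sym² V*)` is a representative of the conformal structure. -/
def ConformalStructure.IsRep (H : ConformalStructure V) (h : TF V) : Prop :=
  ∀ p, ∃ hne : h.1 p ≠ 0, rayOfNeZero ℝ (h.1 p) hne = H.ray p

/-- `(◇_Y u)_p` for `Y = Y₀ ⊗ ⋯ ⊗ Y₍ₖ₋₁₎`. -/
def along {k : ℕ} (D : TF V →ₗ[ℝ] TF V) (Y : Fin k → VecSec V) (u : TF V) (p : M) : Tens (V p) :=
  contrMany k (fun i => Y i p) ((D u).1 p)

/-- `◇ h = μ ⊗ h` with `μ ∈ Γ(∧ᵏ V*)`. -/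
def HasFactor (k : ℕ) (D : TF V →ₗ[ℝ] TF V) (h μ : TF V) : Prop :=
  (∀ p, μ.1 p ∈ formFibre (V p) k) ∧ D h = μ * h

/-- `◇ ∈ 𝒫ᵏ`: the map `◇ : Γ(𝒯(V)) → Γ(∧ᵏ V* ⊗ 𝒯(V)) ⊆ Γ(𝒯(V))` is `ℝ`-linear, `◇_Y` preserves
`C^∞(M)`, `Γ(V)` and `Γ(V*)` and satisfies the Leibniz rule, `◇ I = 0`, and `◇ h = μ ⊗ h` for
every representative `h`. Since `◇_Y` is `C^∞(M)`-linear in `Y ∈ Γ(V^{⊗k})`, it suffices to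
require the conditions for `Y = Y₀ ⊗ ⋯ ⊗ Y₍ₖ₋₁₎`. -/
structure IsDiamond (H : ConformalStructure V) (k : ℕ) (D : TF V →ₗ[ℝ] TF V) : Prop where
  form_valued : ∀ u p, (D u).1 p ∈ formTensFibre (V p) k
  map_fun : ∀ (Y : Fin k → VecSec V) (f : Fun M), ∃ g : Fun M, ∀ p,
    along D Y (ofFun V f) p = (ofFun V g).1 p
  map_vec : ∀ (Y : Fin k → VecSec V) (Z : VecSec V), ∃ Z' : VecSec V, ∀ p,
    along D Y (ofVec Z) p = (ofVec Z').1 p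
  map_cov : ∀ (Y : Fin k → VecSec V) (ξ : CovSec V), ∃ ξ' : CovSec V, ∀ p,
    along D Y (ofCov ξ) p = (ofCov ξ').1 p
  leibniz : ∀ (Y : Fin k → VecSec V) (u v : TF V) (p : M),
    along D Y (u * v) p = along D Y u p * v.1 p + u.1 p * along D Y v p
  map_id : D (idField V) = 0
  conformal : ∀ h, H.IsRep h → ∃ μ : TF V, HasFactor k D h μ

/-- `◇ ∈ 𝒫ᵏ_⊥`: moreover `◇ f = 0` for all `f ∈ C^∞(M)`. -/
structure IsVertical (H : ConformalStructure V) (k : ℕ) (D : TF V →ₗ[ℝ] TF V) : Prop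
    extends IsDiamond H k D where
  vertical : ∀ f : Fun M, D (ofFun V f) = 0

/-- The Lie superbracket of two diamonds of degree one,
`[[◇, ◇']] = ∧_{1,1} ◇ ◇' - (-1)^{1·1} ∧_{1,1} ◇' ◇`. -/
def bracket (D D' : TF V →ₗ[ℝ] TF V) : TF V →ₗ[ℝ] TF V :=
  wedgeField ∘ₗ D ∘ₗ D' - (-1 : ℝ) ^ (1 * 1) • (wedgeField ∘ₗ D' ∘ₗ D)

/-- `A ∈ End(V_p)` lies in the fibre of `Lie(V, H)`. -/
def IsLie (H : ConformalStructure V) (p : M) (A : Module.End ℝ (V p)) : Prop :=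
  ∃ c : ℝ, ∀ h, H.IsRep h → ∀ y z : V p,
    pairing (h.1 p) (A y) z + pairing (h.1 p) y (A z) = c * pairing (h.1 p) y z

/-- `ℛᵏ = Γ(∧ᵏ V* ⊗ Lie(V, H))`. -/
structure IsLieForm (H : ConformalStructure V) (k : ℕ)
    (Υ : ∀ p, (V p) [⋀^Fin k]→ₗ[ℝ] Module.End ℝ (V p)) : Prop where
  smooth : ∀ (Y : Fin k → VecSec V) (Z : VecSec V),
    ContMDiff (𝓡 4) ((𝓡 4).prod 𝓘(ℝ, R4)) ∞
      (fun p => TotalSpace.mk' R4 p (Υ p (fun i => Y i p) (Z p)))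
  lie : ∀ p y, IsLie H p (Υ p y)

/-- `Υ = β(◇)`, that is `Υ_Y Z = ◇_Y Z`. -/
def IsBeta {k : ℕ} (D : TF V →ₗ[ℝ] TF V)
    (Υ : ∀ p, (V p) [⋀^Fin k]→ₗ[ℝ] Module.End ℝ (V p)) : Prop :=
  ∀ (Y : Fin k → VecSec V) (Z : VecSec V) (p : M),
    along D Y (ofVec Z) p = vec (Υ p (fun i => Y i p) (Z p))

end Bundle

/-! ### Diamonds of degree one and Lorentzian geometry -/

section Geometry

variable {M : Type*} [TopologicalSpace M] [ChartedSpace R4 M] [IsManifold (𝓡 4) ∞ M]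
variable {V : M → Type*} [TopologicalSpace (TotalSpace R4 V)]
  [∀ p, TopologicalSpace (V p)] [∀ p, AddCommGroup (V p)] [∀ p, Module ℝ (V p)]
  [FiberBundle R4 V] [VectorBundle ℝ R4 V] [ContMDiffVectorBundle ∞ R4 V (𝓡 4)]

variable (V) in
/-- A vector bundle isomorphism `V → TM` over the identity. -/
structure BundleIso where
  /-- The isomorphism of the fibres. -/
  toEquiv : ∀ p, V p ≃L[ℝ] TangentSpace (𝓡 4) p
  smooth : ContMDiff (𝓡 4) ((𝓡 4).prod 𝓘(ℝ, R4 →L[ℝ] R4)) ∞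
    (fun p => (TotalSpace.mk' (R4 →L[ℝ] R4) p (toEquiv p : V p →L[ℝ] TangentSpace (𝓡 4) p) :
      TotalSpace (R4 →L[ℝ] R4) fun p => V p →L[ℝ] TangentSpace (𝓡 4) p))

/-- `E = ℰ^◇`, that is `(E(Y))(f) = ◇_Y f` for all `Y ∈ Γ(V)` and `f ∈ C^∞(M)`. -/
def IsAnchor (D : TF V →ₗ[ℝ] TF V) (E : BundleIso V) : Prop :=
  ∀ (Y : VecSec V) (f : Fun M) (p : M),
    along D ![Y] (ofFun V f) p =
      algebraMap ℝ (Tens (V p)) (mvfderiv (𝓡 4) f p (E.toEquiv p (Y p)))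

/-- A diamond `◇` of degree one such that `◇` is non-degenerate, `½[[◇, ◇]] ∈ 𝒫²_⊥`, and
`Υ = β(½[[◇, ◇]]) ∈ ℛ²` has vanishing trace. -/
structure IsGeometric (H : ConformalStructure V) (D : TF V →ₗ[ℝ] TF V) : Prop where
  diamond : IsDiamond H 1 D
  nondegenerate : ∃ E : BundleIso V, IsAnchor D E
  vertical : IsVertical H 2 ((1 / 2 : ℝ) • bracket D D)
  trace_free : ∃ Υ : ∀ p, (V p) [⋀^Fin 2]→ₗ[ℝ] Module.End ℝ (V p),
    IsLieForm H 2 Υ ∧ IsBeta ((1 / 2 : ℝ) • bracket D D) Υ ∧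
    ∀ (Y₁ Y₂ : VecSec V) (p : M), LinearMap.trace ℝ (V p) (Υ p ![Y₁ p, Y₂ p]) = 0

/-- `∇` is a Levi-Civita connection of the pseudo-Riemannian metric `g`:
it is torsion-free and `X(g(A, B)) = g(∇_X A, B) + g(A, ∇_X B)`. -/
structure IsLeviCivita (g : ∀ p : M, TangentSpace (𝓡 4) p → TangentSpace (𝓡 4) p → ℝ)
    (cd : CovariantDerivative (𝓡 4) R4 (TangentSpace (𝓡 4) : M → Type)) : Prop where
  torsion_free : cd.torsion = 0
  metric : ∀ (p : M) (x : TangentSpace (𝓡 4) p) (A B : ∀ q : M, TangentSpace (𝓡 4) q),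
    MDifferentiableAt (𝓡 4) ((𝓡 4).prod 𝓘(ℝ, R4)) (fun q => TotalSpace.mk' R4 q (A q)) p →
    MDifferentiableAt (𝓡 4) ((𝓡 4).prod 𝓘(ℝ, R4)) (fun q => TotalSpace.mk' R4 q (B q)) p →
    mvfderiv (𝓡 4) (fun q => g q (A q) (B q)) p x = g p (cd A p x) (B p) + g p (A p) (cd B p x)

/-- The Lorentzian metric `E(h)` on `M`. -/
def BundleIso.pushMetric (E : BundleIso V) (h : TF V) (p : M)
    (x y : TangentSpace (𝓡 4) p) : ℝ :=
  pairing (h.1 p) ((E.toEquiv p).symm x) ((E.toEquiv p).symm y)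

/-- `◇` is the pullback of the connection `∇` along `E`:
`◇_Y f = (E(Y))(f)` and `◇_Y Z = E⁻¹(∇_{E(Y)} E(Z))`. -/
def IsPullback (E : BundleIso V)
    (cd : CovariantDerivative (𝓡 4) R4 (TangentSpace (𝓡 4) : M → Type))
    (D : TF V →ₗ[ℝ] TF V) : Prop :=
  IsAnchor D E ∧ ∀ (Y Z : VecSec V) (p : M),
    along D ![Y] (ofVec Z) p =
      vec ((E.toEquiv p).symm (cd (fun q => E.toEquiv q (Z q)) p (E.toEquiv p (Y p))))

end Geometry

end Diamond

end

/-! Once the anchor is fixed, this is the fundamental theorem of Riemannian geometry. A diamond of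
degree one is a family of derivations `◇_Y` of the algebra of tensor fields. As it kills the
identity of `V`, its action on `V*` is dual to its action on `V` (`compat_of_derivation`). So `◇_Y`
is determined by its action on functions, which is `E'(Y)`, and on sections of `V`
(`derivation_ext`): `◇` is a connection on `TM` transported along `E'`.

Contracting the half bracket with `X` and `Y` gives `◇_X ◇_Y - ◇_Y ◇_X - ◇_Z` with `Z = ◇_X Y - ◇_Y
X` (`IsConn.contrF_contrF`). On functions this is minus the torsion, so verticality means
torsion-freeness, while `◇h' = 0` means compatibility with the metric. Uniqueness is then classical:
the difference of two such connections, lowered with the metric, is symmetric in its first two slots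
and skew in its last two, hence zero (`nV_eq_of_torsion`).

For existence, the Koszul formula gives the Levi-Civita connection `DiffMetric.lc` on `M`, which is
transported to `V` as `BundleIso.lcV`. Its curvature is a derivation that kills functions and `h'`;
hence it is vertical, and its endomorphisms are skew and so traceless (`IsConn.isGeometric`). Any
other representative is `F h'` with `F` a nowhere zero smooth function, and `◇(F h') = F⁻¹ ◇F ⊗ F
h'`.

The technical core is the extension of a connection from `V` and `V*` to all tensor fields. A tensor
is determined by the scalar parts of its iterated contractions (`eq_zero_of_coef`), so the
derivative of a tensor field can be characterized by the Leibniz rule for contractions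
(`ConnData.IsDeriv`). Uniqueness and locality are then immediate, and local derivatives glue
(`ConnData.exists_isDeriv`). The derivations `◇_Y` are assembled into one operator with local frames
(`exists_isConn`). -/

noncomputable section

namespace Diamond

/-! ### Contractions and separation of tensors in one fibre. -/

section Fibre

variable {W : Type*} [AddCommGroup W] [Module ℝ W]

/-- Auxiliary: `w` acts on pairs by `(a, b) ↦ (w ⊗ a, ⟨w, ξ⟩ a)`. -/
def contrCovAux (ξ : Module.Dual ℝ W) :
    (W × Module.Dual ℝ W) →ₗ[ℝ] Module.End ℝ (Tens W × Tens W) where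
  toFun w := LinearMap.prod
    ((LinearMap.mulLeft ℝ (TensorAlgebra.ι ℝ w)).comp (LinearMap.fst ℝ _ _))
    (ξ w.1 • LinearMap.fst ℝ _ _)
  map_add' w w' := by
    ext <;> simp [add_mul, add_smul]
  map_smul' c w := by
    ext <;> simp [mul_smul]

/-- Interior multiplication by a covector `ξ` acting on the first tensor factor:
`v ⊗ t ↦ ξ(v) t` for `v ∈ W`, while `η ⊗ t ↦ 0` for `η ∈ W*` and `1 ↦ 0`. -/
def contrCov (ξ : Module.Dual ℝ W) : Tens W →ₗ[ℝ] Tens W :=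
  (LinearMap.snd ℝ (Tens W) (Tens W)).comp
    ((LinearMap.applyₗ ((1 : Tens W), (0 : Tens W))).comp
      (TensorAlgebra.lift ℝ (contrCovAux ξ)).toLinearMap)

/-- An algebra homomorphism cannot strip off the leftmost factor by itself, so it acts on pairs: the
first entry keeps the whole tensor read so far, and the second is overwritten by each new leftmost
factor. -/
theorem lift_contrCovAux_fst (ξ : Module.Dual ℝ W) (t : Tens W) (x : Tens W × Tens W) :
    (TensorAlgebra.lift ℝ (contrCovAux ξ) t x).1 = t * x.1 := by
  induction t using TensorAlgebra.induction generalizing x with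
  | algebraMap r => simp [Module.algebraMap_end_apply, Algebra.smul_def]
  | ι w => simp [contrCovAux]
  | mul a b ha hb => simp [ha, hb, mul_assoc]
  | add a b ha hb => simp [ha, hb, add_mul]

theorem contrCov_ι_mul (ξ : Module.Dual ℝ W) (w : W × Module.Dual ℝ W) (t : Tens W) :
    contrCov ξ (TensorAlgebra.ι ℝ w * t) = ξ w.1 • t := by
  have h := lift_contrCovAux_fst ξ t ((1 : Tens W), (0 : Tens W))
  rw [mul_one] at h
  simp only [contrCov, LinearMap.comp_apply, AlgHom.toLinearMap_apply, map_mul,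
    LinearMap.applyₗ_apply_apply, Module.End.mul_apply, TensorAlgebra.lift_ι_apply]
  simp only [contrCovAux, LinearMap.coe_mk, AddHom.coe_mk, LinearMap.prod_apply,
    LinearMap.snd_apply]
  exact congrArg _ h

theorem contrCov_one (ξ : Module.Dual ℝ W) : contrCov ξ (1 : Tens W) = 0 := by
  simp [contrCov]

theorem contrCov_vec_mul (ξ : Module.Dual ℝ W) (v : W) (t : Tens W) :
    contrCov ξ (vec v * t) = ξ v • t := by
  simp [vec, contrCov_ι_mul]

theorem contrCov_cov_mul (ξ η : Module.Dual ℝ W) (t : Tens W) :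
    contrCov ξ (cov η * t) = 0 := by
  simp [cov, contrCov_ι_mul]

theorem contr_algebraMap_mul (y : W) (r : ℝ) (t : Tens W) :
    contr y (algebraMap ℝ (Tens W) r * t) = algebraMap ℝ (Tens W) r * contr y t := by
  simp [← Algebra.smul_def]

theorem contrCov_algebraMap_mul (ξ : Module.Dual ℝ W) (r : ℝ) (t : Tens W) :
    contrCov ξ (algebraMap ℝ (Tens W) r * t) = algebraMap ℝ (Tens W) r * contrCov ξ t := by
  simp [← Algebra.smul_def]

@[simp]
theorem contr_cov (y : W) (ξ : Module.Dual ℝ W) :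
    contr y (cov ξ) = algebraMap ℝ (Tens W) (ξ y) := by
  simpa [Algebra.algebraMap_eq_smul_one] using contr_cov_mul y ξ 1

@[simp]
theorem contrCov_vec (ξ : Module.Dual ℝ W) (v : W) :
    contrCov ξ (vec v) = algebraMap ℝ (Tens W) (ξ v) := by
  simpa [Algebra.algebraMap_eq_smul_one] using contrCov_vec_mul ξ v 1

@[simp]
theorem contrCov_cov (ξ η : Module.Dual ℝ W) : contrCov ξ (cov η) = 0 := by
  simpa using contrCov_cov_mul ξ η 1

theorem ι_eq_vec_add_cov (w : W × Module.Dual ℝ W) :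
    TensorAlgebra.ι ℝ w = vec w.1 + cov w.2 := by
  simp only [vec, cov, LinearMap.comp_apply, ← map_add]
  simp

/-- The scalar part of a tensor. -/
abbrev eps : Tens W →ₐ[ℝ] ℝ := TensorAlgebra.algebraMapInv

theorem eps_ι_mul (w : W × Module.Dual ℝ W) (t : Tens W) :
    eps (TensorAlgebra.ι ℝ w * t) = 0 := by
  simp [eps, TensorAlgebra.algebraMapInv]

@[simp]
theorem eps_vec (v : W) : eps (vec v) = 0 := by
  simp [eps, TensorAlgebra.algebraMapInv, vec]

@[simp]
theorem eps_cov (ξ : Module.Dual ℝ W) : eps (cov ξ) = 0 := by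
  simp [eps, TensorAlgebra.algebraMapInv, cov]

@[simp]
theorem eps_algebraMap (r : ℝ) : eps (algebraMap ℝ (Tens W) r) = r :=
  TensorAlgebra.algebraMap_leftInverse _ r

/-- Contractions see only the leftmost factor, so the induction has to peel off generators from the
left instead of splitting arbitrary products. -/
theorem Tens.induction_left {P : Tens W → Prop} (h1 : P 1)
    (hadd : ∀ s t, P s → P t → P (s + t)) (hsmul : ∀ (r : ℝ) t, P t → P (r • t))
    (hmul : ∀ w t, P t → P (TensorAlgebra.ι ℝ w * t)) (t : Tens W) : P t := by
  suffices h : ∀ a t : Tens W, P t → P (a * t) by simpa using h t 1 h1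
  intro a
  induction a using TensorAlgebra.induction with
  | algebraMap r => intro t ht; rw [← Algebra.smul_def]; exact hsmul r t ht
  | ι w => exact hmul w
  | mul a b ha hb => intro t ht; rw [mul_assoc]; exact ha _ (hb _ ht)
  | add a b ha hb => intro t ht; rw [add_mul]; exact hadd _ _ (ha t ht) (hb t ht)

theorem sum_coord_smul_vec {ι : Type*} [Fintype ι] (b : Module.Basis ι ℝ W) (v : W) :
    ∑ i, b.coord i v • vec (b i) = vec v := by
  conv_rhs => rw [← b.sum_repr v]
  simp only [map_sum, map_smul, Module.Basis.coord_apply]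

theorem sum_apply_smul_cov {ι : Type*} [Fintype ι] (b : Module.Basis ι ℝ W)
    (ξ : Module.Dual ℝ W) : ∑ i, ξ (b i) • cov (b.coord i) = cov ξ := by
  classical
  conv_rhs => rw [← b.sum_dual_apply_smul_coord ξ]
  simp only [map_sum, map_smul]

/-- A tensor is recovered from its scalar part and its contractions with a basis. -/
theorem tens_decomp {ι : Type*} [Fintype ι] (b : Module.Basis ι ℝ W) (t : Tens W) :
    t = algebraMap ℝ (Tens W) (eps t) + ∑ i, vec (b i) * contrCov (b.coord i) t
      + ∑ i, cov (b.coord i) * contr (b i) t := by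
  induction t using Tens.induction_left with
  | h1 => simp [contr_one, contrCov_one]
  | hadd s t hs ht =>
    conv_lhs => rw [hs, ht]
    simp only [map_add, mul_add, Finset.sum_add_distrib]
    abel
  | hsmul r t ht =>
    conv_lhs => rw [ht]
    simp only [smul_add, Finset.smul_sum, map_smul, mul_smul_comm, smul_eq_mul, map_mul]
    rw [← Algebra.smul_def]
  | hmul w t _ =>
    simp only [eps_ι_mul, contr_ι_mul, contrCov_ι_mul, mul_smul_comm, ← smul_mul_assoc,
      ← Finset.sum_mul, sum_coord_smul_vec, sum_apply_smul_cov, map_zero, zero_add]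
    rw [← add_mul, ← ι_eq_vec_add_cov]

/-- A tensor vanishes if its scalar part and all its contractions vanish. -/
theorem tens_eq_zero {ι : Type*} [Fintype ι] (b : Module.Basis ι ℝ W) {t : Tens W}
    (h0 : eps t = 0) (hv : ∀ y, contr y t = 0) (hc : ∀ ξ, contrCov ξ t = 0) : t = 0 := by
  rw [tens_decomp b t]
  simp [h0, hv, hc]

/-- Iterated contraction of a tensor with vectors and covectors, followed by the scalar part. -/
def coef : List (W ⊕ Module.Dual ℝ W) → Tens W → ℝ
  | [], t => eps t
  | .inl y :: l, t => coef l (contr y t)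
  | .inr ξ :: l, t => coef l (contrCov ξ t)

/-- The tensors of degree at most `n`. -/
def degLE (W : Type*) [AddCommGroup W] [Module ℝ W] : ℕ → Submodule ℝ (Tens W)
  | 0 => Submodule.span ℝ {1}
  | n + 1 => Submodule.span ℝ ({1} ∪ {t | ∃ w, ∃ s ∈ degLE W n, t = TensorAlgebra.ι ℝ w * s})

/-- The degree filtration makes repeated contraction terminate, which is what the induction in
`eq_zero_of_coef` runs on. -/
theorem exists_mem_degLE (t : Tens W) : ∃ n, t ∈ degLE W n := by
  have hmono : Monotone (degLE W) := by
    refine monotone_nat_of_le_succ fun n => ?_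
    induction n with
    | zero => exact Submodule.span_mono (by simp)
    | succ n ih =>
      refine Submodule.span_mono (Set.union_subset_union_right _ ?_)
      rintro t ⟨w, s, hs, rfl⟩
      exact ⟨w, s, ih hs, rfl⟩
  induction t using Tens.induction_left with
  | h1 => exact ⟨0, Submodule.subset_span rfl⟩
  | hadd s t hs ht =>
    obtain ⟨n, hn⟩ := hs
    obtain ⟨m, hm⟩ := ht
    exact ⟨max n m, add_mem (hmono (le_max_left _ _) hn) (hmono (le_max_right _ _) hm)⟩
  | hsmul r t ht =>
    obtain ⟨n, hn⟩ := ht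
    exact ⟨n, Submodule.smul_mem _ r hn⟩
  | hmul w t ht =>
    obtain ⟨n, hn⟩ := ht
    exact ⟨n + 1, Submodule.subset_span (Or.inr ⟨w, t, hn, rfl⟩)⟩

theorem contr_mem_degLE {n : ℕ} {t : Tens W} (ht : t ∈ degLE W (n + 1)) (y : W) :
    contr y t ∈ degLE W n := by
  refine Submodule.span_le (p := (degLE W n).comap (contr y)).2 ?_ ht
  rintro t (rfl | ⟨w, s, hs, rfl⟩)
  · simp [contr_one]
  · simpa [contr_ι_mul] using Submodule.smul_mem _ _ hs

theorem contrCov_mem_degLE {n : ℕ} {t : Tens W} (ht : t ∈ degLE W (n + 1))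
    (ξ : Module.Dual ℝ W) : contrCov ξ t ∈ degLE W n := by
  refine Submodule.span_le (p := (degLE W n).comap (contrCov ξ)).2 ?_ ht
  rintro t (rfl | ⟨w, s, hs, rfl⟩)
  · simp [contrCov_one]
  · simpa [contrCov_ι_mul] using Submodule.smul_mem _ _ hs

/-- Iterated contractions separate tensors. -/
theorem eq_zero_of_coef {ι : Type*} [Fintype ι] (b : Module.Basis ι ℝ W) {t : Tens W}
    (h : ∀ l, coef l t = 0) : t = 0 := by
  obtain ⟨n, hn⟩ := exists_mem_degLE t
  induction n generalizing t with
  | zero =>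
    obtain ⟨r, rfl⟩ := Submodule.mem_span_singleton.1 hn
    have := h []
    simp [coef] at this
    simp [this]
  | succ n ih =>
    exact tens_eq_zero b (h []) (fun y => ih (fun l => h (.inl y :: l)) (contr_mem_degLE hn y))
      (fun ξ => ih (fun l => h (.inr ξ :: l)) (contrCov_mem_degLE hn ξ))

/-- This turns `∧_{1,1} ◇ ◇` into a commutator. It holds for every tensor, because a leading factor
from `W` contributes zero to both sides. -/
theorem contr_contr_wedgeOp {ι : Type*} [Fintype ι] (b : Module.Basis ι ℝ W) (y z : W)
    (t : Tens W) :
    contr z (contr y (wedgeOp b t)) = contr z (contr y t) - contr y (contr z t) := by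
  induction t using Tens.induction_left with
  | h1 => simp [wedgeOp, contr_one]
  | hadd s t hs ht => simp only [map_add, hs, ht]; abel
  | hsmul r t ht => simp only [map_smul, ht, smul_sub]
  | hmul w t ih =>
    clear ih
    rw [wedgeOp_ι_mul]
    induction t using Tens.induction_left with
    | h1 => simp [wedgeLeft, contr_one, -mul_one, contr_ι_mul]
    | hadd s t hs ht => simp only [map_add, mul_add, hs, ht]; abel
    | hsmul r t ht => simp only [map_smul, mul_smul_comm, ht, smul_sub]
    | hmul v t _ =>
      rw [wedgeLeft_ι_mul, sub_mul, mul_assoc, mul_assoc]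
      simp only [map_sub, contr_cov_mul, contr_ι_mul, map_smul, smul_smul]
      rw [mul_comm (v.2 y)]

theorem wedge_one (ξ : Fin 1 → Module.Dual ℝ W) : wedge ξ = cov (ξ 0) := by
  simp [wedge]

theorem cov_mul_mem_formTensFibre (ξ : Module.Dual ℝ W) (u : Tens W) :
    cov ξ * u ∈ formTensFibre W 1 :=
  Submodule.subset_span ⟨fun _ => ξ, u, by rw [wedge_one]⟩

theorem cov_mem_formFibre (ξ : Module.Dual ℝ W) : cov ξ ∈ formFibre W 1 :=
  Submodule.subset_span ⟨fun _ => ξ, by rw [wedge_one]⟩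

theorem wedgeOp_mem_formTensFibre {ι : Type*} [Fintype ι] (b : Module.Basis ι ℝ W) (t : Tens W) :
    wedgeOp b t ∈ formTensFibre W 2 := by
  simp only [wedgeOp, wedgeLeft, LinearMap.sum_apply, LinearMap.comp_apply,
    LinearMap.mulLeft_apply]
  exact sum_mem fun a _ => sum_mem fun c _ => Submodule.subset_span ⟨_, _, rfl⟩

/-- Unlike in `tens_decomp`, neither a scalar part nor contractions with covectors are needed for
elements of `W* ⊗ 𝒯(W)`. Hence a form-valued operator is determined by its contractions with
vectors. -/
theorem formTensFibre_one_decomp {ι : Type*} [Fintype ι] (b : Module.Basis ι ℝ W) {t : Tens W}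
    (ht : t ∈ formTensFibre W 1) : t = ∑ i, cov (b.coord i) * contr (b i) t := by
  induction ht using Submodule.span_induction with
  | mem t h =>
    obtain ⟨ξ, u, rfl⟩ := h
    simp only [wedge_one, contr_cov_mul, mul_smul_comm, ← smul_mul_assoc, ← Finset.sum_mul,
      sum_apply_smul_cov]
  | zero => simp
  | add s t _ _ hs ht =>
    conv_lhs => rw [hs, ht]
    simp [mul_add, Finset.sum_add_distrib]
  | smul r t _ ht =>
    conv_lhs => rw [ht]
    simp [Finset.smul_sum]

theorem formTensFibre_one_ext {ι : Type*} [Fintype ι] (b : Module.Basis ι ℝ W) {s t : Tens W}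
    (hs : s ∈ formTensFibre W 1) (ht : t ∈ formTensFibre W 1)
    (h : ∀ y, contr y s = contr y t) : s = t := by
  rw [formTensFibre_one_decomp b hs, formTensFibre_one_decomp b ht]
  simp [h]

/-- A two-form may be read as a one-form whose values are again one-forms; both facts together
reduce the separation of two-forms to that of one-forms, applied twice. -/
theorem contr_mem_formTensFibre {t : Tens W} (ht : t ∈ formTensFibre W 2) (y : W) :
    contr y t ∈ formTensFibre W 1 ∧ t ∈ formTensFibre W 1 := by
  induction ht using Submodule.span_induction with
  | mem t h =>
    obtain ⟨ξ, u, rfl⟩ := h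
    have : ξ = ![ξ 0, ξ 1] := by ext i; fin_cases i <;> rfl
    rw [this, wedge_pair, sub_mul, mul_assoc, mul_assoc]
    refine ⟨?_, sub_mem (cov_mul_mem_formTensFibre _ _) (cov_mul_mem_formTensFibre _ _)⟩
    simp only [map_sub, contr_cov_mul]
    exact sub_mem (Submodule.smul_mem _ _ (cov_mul_mem_formTensFibre _ _))
      (Submodule.smul_mem _ _ (cov_mul_mem_formTensFibre _ _))
  | zero => simp
  | add s t _ _ hs ht => rw [map_add]; exact ⟨add_mem hs.1 ht.1, add_mem hs.2 ht.2⟩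
  | smul r t _ ht =>
    rw [map_smul]; exact ⟨Submodule.smul_mem _ _ ht.1, Submodule.smul_mem _ _ ht.2⟩

theorem eq_zero_of_mem_formTensFibre_two {ι : Type*} [Fintype ι] (b : Module.Basis ι ℝ W)
    {t : Tens W} (ht : t ∈ formTensFibre W 2) (h : ∀ y z, contr z (contr y t) = 0) : t = 0 := by
  refine formTensFibre_one_ext b (contr_mem_formTensFibre ht 0).2 (zero_mem _) fun y => ?_
  rw [map_zero]
  exact formTensFibre_one_ext b (contr_mem_formTensFibre ht y).1 (zero_mem _) (by simp [h])

end Fibre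

/-! ### Cut-offs, smooth contractions of tensor fields and frames. -/

section Sections

variable {M : Type*} [TopologicalSpace M] [T2Space M] [ChartedSpace R4 M] [IsManifold (𝓡 4) ∞ M]
variable {V : M → Type*} [TopologicalSpace (TotalSpace R4 V)]
  [∀ p, TopologicalSpace (V p)] [∀ p, AddCommGroup (V p)] [∀ p, Module ℝ (V p)]
  [FiberBundle R4 V] [VectorBundle ℝ R4 V] [ContMDiffVectorBundle ∞ R4 V (𝓡 4)]

theorem exists_bump {U : Set M} (hU : IsOpen U) {p : M} (hp : p ∈ U) :
    ∃ ρ : Fun M, (∀ᶠ q in 𝓝 p, ρ q = 1) ∧ tsupport ρ ⊆ U := by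
  obtain ⟨f, -, hf⟩ := (SmoothBumpFunction.nhds_basis_tsupport (I := 𝓡 4) p).mem_iff.1
    (hU.mem_nhds hp)
  exact ⟨⟨f, f.contMDiff⟩, f.eventuallyEq_one, hf⟩

/-- The product of a function and a section. -/
def fsmul {F : Type*} [NormedAddCommGroup F] [NormedSpace ℝ F] {X : M → Type*}
    [TopologicalSpace (TotalSpace F X)] [∀ p, TopologicalSpace (X p)] [∀ p, AddCommGroup (X p)]
    [∀ p, Module ℝ (X p)] [FiberBundle F X] [VectorBundle ℝ F X]
    (f : Fun M) (Z : ContMDiffSection (𝓡 4) F ∞ X) : ContMDiffSection (𝓡 4) F ∞ X :=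
  ⟨fun p => f p • Z p, f.contMDiff.smul_section Z.contMDiff⟩

/-- Multiplication by a bump function supported in `U` and equal to `1` near `p` extends the section
by zero without changing its germ. -/
theorem exists_section_eq {F : Type*} [NormedAddCommGroup F] [NormedSpace ℝ F] {X : M → Type*}
    [TopologicalSpace (TotalSpace F X)] [∀ p, TopologicalSpace (X p)] [∀ p, AddCommGroup (X p)]
    [∀ p, Module ℝ (X p)] [FiberBundle F X] [VectorBundle ℝ F X] {U : Set M} (hU : IsOpen U)
    {p : M} (hp : p ∈ U) {Z : ∀ p, X p}
    (hZ : ContMDiffOn (𝓡 4) ((𝓡 4).prod 𝓘(ℝ, F)) ∞ (fun p => TotalSpace.mk' F p (Z p)) U) :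
    ∃ Z' : ContMDiffSection (𝓡 4) F ∞ X, ∀ᶠ q in 𝓝 p, Z' q = Z q := by
  obtain ⟨ρ, hρ, hρU⟩ := exists_bump hU hp
  refine ⟨⟨fun p => ρ p • Z p, ContMDiffOn.smul_section_of_tsupport ρ.contMDiff.contMDiffOn hU
    hρU hZ⟩, hρ.mono fun q hq => ?_⟩
  change ρ q • Z q = Z q
  rw [hq, one_smul]

theorem exists_fun_eq {U : Set M} (hU : IsOpen U) {p : M} (hp : p ∈ U) {f : M → ℝ}
    (hf : ContMDiffOn (𝓡 4) 𝓘(ℝ, ℝ) ∞ f U) : ∃ g : Fun M, ∀ᶠ q in 𝓝 p, g q = f q := by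
  obtain ⟨ρ, hρ, hρU⟩ := exists_bump hU hp
  refine ⟨⟨fun p => ρ p * f p, ?_⟩, hρ.mono fun q hq => ?_⟩
  · refine contMDiff_of_contMDiffOn_union_of_isOpen (ρ.contMDiff.contMDiffOn.mul hf) ?_ ?_ hU
      (isOpen_compl_iff.mpr <| isClosed_tsupport ρ)
    · refine (contMDiffOn_const (c := (0 : ℝ))).congr fun y hy => ?_
      rw [image_eq_zero_of_notMem_tsupport hy, zero_mul]
    · exact Set.compl_subset_iff_union.mp <| Set.compl_subset_compl.mpr hρU
  · change ρ q * f q = f q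
    rw [hq, one_mul]

theorem contMDiffOn_pair {U : Set M} {ξ : ∀ p, V p →L[ℝ] ℝ} {Z : ∀ p, V p}
    (hξ : ContMDiffOn (𝓡 4) ((𝓡 4).prod 𝓘(ℝ, R4 →L[ℝ] ℝ)) ∞
        (fun p => TotalSpace.mk' (R4 →L[ℝ] ℝ) p (ξ p)) U)
    (hZ : ContMDiffOn (𝓡 4) ((𝓡 4).prod 𝓘(ℝ, R4)) ∞ (fun p => TotalSpace.mk' R4 p (Z p)) U) :
    ContMDiffOn (𝓡 4) 𝓘(ℝ, ℝ) ∞ (fun p => ξ p (Z p)) U := by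
  have h := ContMDiffOn.clm_bundle_apply (F₁ := R4) (F₂ := ℝ) (E₁ := V)
    (E₂ := fun _ : M => ℝ) (IB := 𝓡 4) (b := fun m => m) (ϕ := ξ) (v := Z) hξ hZ
  exact fun p hp => (contMDiffWithinAt_totalSpace.1 (h p hp)).2

/-- The function `ξ(Z)`. -/
def pair (ξ : CovSec V) (Z : VecSec V) : Fun M :=
  ⟨fun p => ξ p (Z p), contMDiffOn_univ.1 <|
    contMDiffOn_pair ξ.contMDiff.contMDiffOn Z.contMDiff.contMDiffOn⟩

theorem pair_apply (ξ : CovSec V) (Z : VecSec V) (p : M) : pair ξ Z p = ξ p (Z p) := rfl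

/-- Induction over `smoothAlg` by left multiplication with generators. -/
theorem smoothAlg_induction' {U : Set M} {P : (∀ p, Tens (V p)) → Prop} (h1 : P 1)
    (hadd : ∀ u v, P u → P v → P (u + v)) (hsmul : ∀ (r : ℝ) u, P u → P (r • u))
    (hfun : ∀ f : M → ℝ, ContMDiffOn (𝓡 4) 𝓘(ℝ, ℝ) ∞ f U → ∀ m ∈ smoothAlg V U, P m →
      P ((fun p => algebraMap ℝ (Tens (V p)) (f p)) * m))
    (hvec : ∀ Y : ∀ p, V p,
      ContMDiffOn (𝓡 4) ((𝓡 4).prod 𝓘(ℝ, R4)) ∞ (fun p => TotalSpace.mk' R4 p (Y p)) U →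
      ∀ m ∈ smoothAlg V U, P m → P ((fun p => vec (Y p)) * m))
    (hcov : ∀ ξ : ∀ p, V p →L[ℝ] ℝ,
      ContMDiffOn (𝓡 4) ((𝓡 4).prod 𝓘(ℝ, R4 →L[ℝ] ℝ)) ∞
        (fun p => TotalSpace.mk' (R4 →L[ℝ] ℝ) p (ξ p)) U →
      ∀ m ∈ smoothAlg V U, P m → P ((fun p => cov (ξ p : V p →ₗ[ℝ] ℝ)) * m))
    {u : ∀ p, Tens (V p)} (hu : u ∈ smoothAlg V U) : P u := by
  refine smoothAlg_induction (P := P) ?_ h1 hadd hsmul ?_ hu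
  · simpa using hsmul 0 1 h1
  · rintro g ((⟨f, hf, rfl⟩ | ⟨Y, hY, rfl⟩) | ⟨ξ, hξ, rfl⟩)
    exacts [hfun f hf, hvec Y hY, hcov ξ hξ]

theorem algebraMap_mem_smoothAlg {U : Set M} {f : M → ℝ}
    (hf : ContMDiffOn (𝓡 4) 𝓘(ℝ, ℝ) ∞ f U) :
    (fun p => algebraMap ℝ (Tens (V p)) (f p)) ∈ smoothAlg V U :=
  Algebra.subset_adjoin (Or.inl (Or.inl ⟨f, hf, rfl⟩))

/-- Smooth tensor fields are defined by generators, so smoothness of a fibrewise operation is proved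
by induction on products. A leading section of `V` is killed, and a leading section of `V*` becomes
a smooth coefficient. -/
theorem contr_mem_smoothAlg {U : Set M} {Y : ∀ p, V p}
    (hY : ContMDiffOn (𝓡 4) ((𝓡 4).prod 𝓘(ℝ, R4)) ∞ (fun p => TotalSpace.mk' R4 p (Y p)) U)
    {u : ∀ p, Tens (V p)} (hu : u ∈ smoothAlg V U) :
    (fun p => contr (Y p) (u p)) ∈ smoothAlg V U := by
  refine smoothAlg_induction' (P := fun u : ∀ p, Tens (V p) =>
    (fun p => contr (Y p) (u p)) ∈ smoothAlg V U) ?_ ?_ ?_ ?_ ?_ ?_ hu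
  · convert zero_mem (smoothAlg V U) using 1
    funext p; simp [contr_one]
  · intro u v hu hv
    convert add_mem hu hv using 1
    funext p; simp
  · intro r u hu
    convert Subalgebra.smul_mem _ hu r using 1
    funext p; simp
  · intro f hf m hm ih
    convert mul_mem (algebraMap_mem_smoothAlg hf) ih using 1
    funext p; simp [contr_algebraMap_mul]
  · intro Z hZ m hm ih
    convert zero_mem (smoothAlg V U) using 1
    funext p; simp [contr_vec_mul]
  · intro ξ hξ m hm ih
    convert mul_mem (algebraMap_mem_smoothAlg (contMDiffOn_pair hξ hY)) hm using 1
    funext p; simp [contr_cov_mul, Algebra.smul_def]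

theorem contrCov_mem_smoothAlg {U : Set M} {η : ∀ p, V p →L[ℝ] ℝ}
    (hη : ContMDiffOn (𝓡 4) ((𝓡 4).prod 𝓘(ℝ, R4 →L[ℝ] ℝ)) ∞
        (fun p => TotalSpace.mk' (R4 →L[ℝ] ℝ) p (η p)) U)
    {u : ∀ p, Tens (V p)} (hu : u ∈ smoothAlg V U) :
    (fun p => contrCov (η p : V p →ₗ[ℝ] ℝ) (u p)) ∈ smoothAlg V U := by
  refine smoothAlg_induction' (P := fun u : ∀ p, Tens (V p) =>
    (fun p => contrCov (η p : V p →ₗ[ℝ] ℝ) (u p)) ∈ smoothAlg V U) ?_ ?_ ?_ ?_ ?_ ?_ hu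
  · convert zero_mem (smoothAlg V U) using 1
    funext p; simp [contrCov_one]
  · intro u v hu hv
    convert add_mem hu hv using 1
    funext p; simp
  · intro r u hu
    convert Subalgebra.smul_mem _ hu r using 1
    funext p; simp
  · intro f hf m hm ih
    convert mul_mem (algebraMap_mem_smoothAlg hf) ih using 1
    funext p; simp [contrCov_algebraMap_mul]
  · intro Z hZ m hm ih
    convert mul_mem (algebraMap_mem_smoothAlg (contMDiffOn_pair hη hZ)) hm using 1
    funext p; simp [contrCov_vec_mul, Algebra.smul_def]
  · intro ξ hξ m hm ih
    convert zero_mem (smoothAlg V U) using 1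
    funext p; simp [contrCov_cov_mul]

theorem contMDiffOn_eps {U : Set M} {u : ∀ p, Tens (V p)} (hu : u ∈ smoothAlg V U) :
    ContMDiffOn (𝓡 4) 𝓘(ℝ, ℝ) ∞ (fun p => eps (u p)) U := by
  refine smoothAlg_induction' (P := fun u : ∀ p, Tens (V p) =>
    ContMDiffOn (𝓡 4) 𝓘(ℝ, ℝ) ∞ (fun p => eps (u p)) U) ?_ ?_ ?_ ?_ ?_ ?_ hu
  · simpa using contMDiffOn_const
  · intro u v hu hv
    simpa only [Pi.add_apply, map_add] using! hu.add hv
  · intro r u hu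
    simpa only [Pi.smul_apply, map_smul] using! (contMDiffOn_const (c := r)).mul hu
  · intro f hf m hm ih
    simpa only [Pi.mul_apply, map_mul, eps_algebraMap] using! hf.mul ih
  · intro Z hZ m hm ih
    simpa using contMDiffOn_const
  · intro ξ hξ m hm ih
    simpa using contMDiffOn_const

/-- Contraction of the first factor with a section of `V`. -/
def contrF (Y : VecSec V) : TF V →ₗ[ℝ] TF V where
  toFun u := ⟨fun p => contr (Y p) (u.1 p), fun p => by
    obtain ⟨U, hU, hpU, u', hu', huu'⟩ := u.2 p
    exact ⟨U, hU, hpU, _, contr_mem_smoothAlg Y.contMDiff.contMDiffOn hu',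
      fun q hq => by simp [huu' q hq]⟩⟩
  map_add' u v := by
    ext p; simp
  map_smul' r u := by
    ext p; simp

/-- Contraction of the first factor with a section of `V*`. -/
def contrCovF (ξ : CovSec V) : TF V →ₗ[ℝ] TF V where
  toFun u := ⟨fun p => contrCov (ξ p : V p →ₗ[ℝ] ℝ) (u.1 p), fun p => by
    obtain ⟨U, hU, hpU, u', hu', huu'⟩ := u.2 p
    exact ⟨U, hU, hpU, _, contrCov_mem_smoothAlg ξ.contMDiff.contMDiffOn hu',
      fun q hq => by simp [huu' q hq]⟩⟩
  map_add' u v := by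
    ext p; simp
  map_smul' r u := by
    ext p; simp

/-- The scalar part of a tensor field. -/
def epsF : TF V →ₗ[ℝ] Fun M where
  toFun u := ⟨fun p => eps (u.1 p), fun p => by
    obtain ⟨U, hU, hpU, u', hu', huu'⟩ := u.2 p
    refine ((contMDiffOn_eps hu').contMDiffAt (hU.mem_nhds hpU)).congr_of_eventuallyEq ?_
    exact Filter.eventuallyEq_of_mem (hU.mem_nhds hpU) fun q hq => by simp [huu' q hq]⟩
  map_add' u v := by
    ext p; exact map_add eps (u.1 p) (v.1 p)
  map_smul' r u := by
    ext p; exact map_smul eps r (u.1 p)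

theorem contrF_apply (Y : VecSec V) (u : TF V) (p : M) :
    (contrF Y u).1 p = contr (Y p) (u.1 p) := rfl

theorem contrCovF_apply (ξ : CovSec V) (u : TF V) (p : M) :
    (contrCovF ξ u).1 p = contrCov (ξ p : V p →ₗ[ℝ] ℝ) (u.1 p) := rfl

theorem epsF_apply (u : TF V) (p : M) : epsF u p = eps (u.1 p) := rfl

/-- A global frame of sections near a point, together with its dual frame. -/
structure FrameAt (V : M → Type*) [TopologicalSpace (TotalSpace R4 V)]
    [∀ p, TopologicalSpace (V p)] [∀ p, AddCommGroup (V p)] [∀ p, Module ℝ (V p)]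
    [FiberBundle R4 V] [VectorBundle ℝ R4 V] (p : M) where
  /-- The sections. -/
  vecs : Fin 4 → VecSec V
  /-- The dual sections. -/
  covs : Fin 4 → CovSec V
  exists_basis : ∀ᶠ q in 𝓝 p, ∃ b : Module.Basis (Fin 4) ℝ (V q),
    (∀ a, b a = vecs a q) ∧ ∀ a, b.coord a = (covs a q : V q →ₗ[ℝ] ℝ)

theorem nonempty_frameAt (p : M) : Nonempty (FrameAt V p) := by
  choose ξ hξ hξ' using exists_dualFrame V p
  have hU := (trivializationAt R4 V p).open_baseSet
  have hp := mem_baseSet_trivializationAt R4 V p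
  choose η hη using fun a => exists_section_eq hU hp (hξ a)
  choose F hF using fun a => exists_section_eq hU hp
    ((trivializationAt R4 V p).contMDiffOn_localFrame_baseSet (I := 𝓡 4) ∞
      (EuclideanSpace.basisFun (Fin 4) ℝ).toBasis a)
  refine ⟨⟨F, η, ?_⟩⟩
  filter_upwards [hU.mem_nhds hp, Filter.eventually_all.2 hη, Filter.eventually_all.2 hF]
    with q hq h1 h2
  refine ⟨(trivializationAt R4 V p).basisAt (EuclideanSpace.basisFun (Fin 4) ℝ).toBasis hq,
    fun a => ?_, fun a => ?_⟩
  · rw [h2]; simp [hq]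
  · rw [h1, hξ' a q hq]

end Sections

/-! ### Extension of a connection to a derivation of all tensor fields. -/

section Derivations

variable {M : Type*} [TopologicalSpace M] [T2Space M] [ChartedSpace R4 M] [IsManifold (𝓡 4) ∞ M]
variable {V : M → Type*} [TopologicalSpace (TotalSpace R4 V)]
  [∀ p, TopologicalSpace (V p)] [∀ p, AddCommGroup (V p)] [∀ p, Module ℝ (V p)]
  [FiberBundle R4 V] [VectorBundle ℝ R4 V] [ContMDiffVectorBundle ∞ R4 V (𝓡 4)]

theorem ofFun_apply (f : Fun M) (p : M) :
    (ofFun V f).1 p = algebraMap ℝ (Tens (V p)) (f p) := rfl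

theorem ofVec_apply (Z : VecSec V) (p : M) : (ofVec Z).1 p = vec (Z p) := rfl

theorem ofCov_apply (ξ : CovSec V) (p : M) :
    (ofCov ξ).1 p = cov (ξ p : V p →ₗ[ℝ] ℝ) := rfl

theorem TF.ext_apply {u v : TF V} (h : ∀ p, u.1 p = v.1 p) : u = v :=
  Subtype.ext (funext h)

theorem TF.mul_apply (u v : TF V) (p : M) : (u * v).1 p = u.1 p * v.1 p := rfl

theorem TF.add_apply (u v : TF V) (p : M) : (u + v).1 p = u.1 p + v.1 p := rfl

theorem TF.sub_apply (u v : TF V) (p : M) : (u - v).1 p = u.1 p - v.1 p := rfl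

theorem TF.smul_apply (r : ℝ) (u : TF V) (p : M) : (r • u).1 p = r • u.1 p := rfl

theorem TF.zero_apply (p : M) : (0 : TF V).1 p = 0 := rfl

variable (V) in
/-- The functions and the sections of `V` and `V*`. -/
def globalGen : Set (TF V) := Set.range (ofFun V) ∪ Set.range ofVec ∪ Set.range ofCov

variable (V) in
/-- Finite sums of tensor products of functions and sections of `V` and `V*`. -/
def globalAlg : Subalgebra ℝ (TF V) := Algebra.adjoin ℝ (globalGen V)

/-- Every tensor field agrees near every point with an element of `globalAlg`. -/
theorem exists_globalAlg_eq (u : TF V) (p : M) :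
    ∃ u' ∈ globalAlg V, ∀ᶠ q in 𝓝 p, u.1 q = u'.1 q := by
  obtain ⟨U, hU, hpU, v, hv, huv⟩ := u.2 p
  suffices h : ∃ u' ∈ globalAlg V, ∀ᶠ q in 𝓝 p, v q = u'.1 q by
    obtain ⟨u', hu', h⟩ := h
    exact ⟨u', hu', (h.and (hU.mem_nhds hpU)).mono fun q hq => (huv q hq.2).trans hq.1⟩
  clear huv u
  induction hv using Algebra.adjoin_induction with
  | mem x hx =>
    rcases hx with (⟨f, hf, rfl⟩ | ⟨Y, hY, rfl⟩) | ⟨ξ, hξ, rfl⟩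
    · obtain ⟨g, hg⟩ := exists_fun_eq hU hpU hf
      exact ⟨ofFun V g, Algebra.subset_adjoin (Or.inl (Or.inl ⟨g, rfl⟩)),
        hg.mono fun q hq => by simp only [ofFun_apply, hq]⟩
    · obtain ⟨g, hg⟩ := exists_section_eq hU hpU hY
      exact ⟨ofVec g, Algebra.subset_adjoin (Or.inl (Or.inr ⟨g, rfl⟩)),
        hg.mono fun q hq => by simp only [ofVec_apply, hq]⟩
    · obtain ⟨g, hg⟩ := exists_section_eq hU hpU hξ
      exact ⟨ofCov g, Algebra.subset_adjoin (Or.inr ⟨g, rfl⟩),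
        hg.mono fun q hq => by simp only [ofCov_apply, hq]⟩
  | algebraMap r => exact ⟨_, (globalAlg V).algebraMap_mem r, Filter.Eventually.of_forall
      fun q => rfl⟩
  | add x y _ _ hx hy =>
    obtain ⟨x', hx', hxx⟩ := hx
    obtain ⟨y', hy', hyy⟩ := hy
    exact ⟨_, add_mem hx' hy', (hxx.and hyy).mono fun q hq => by
      simp only [TF.add_apply, Pi.add_apply, hq.1, hq.2]⟩
  | mul x y _ _ hx hy =>
    obtain ⟨x', hx', hxx⟩ := hx
    obtain ⟨y', hy', hyy⟩ := hy
    exact ⟨_, mul_mem hx' hy', (hxx.and hyy).mono fun q hq => by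
      simp only [TF.mul_apply, Pi.mul_apply, hq.1, hq.2]⟩

theorem globalAlg_induction {P : TF V → Prop} (h1 : P 1)
    (hadd : ∀ u v, P u → P v → P (u + v)) (hsmul : ∀ (r : ℝ) u, P u → P (r • u))
    (hfun : ∀ f m, P m → P (ofFun V f * m)) (hvec : ∀ Y m, P m → P (ofVec Y * m))
    (hcov : ∀ ξ m, P m → P (ofCov ξ * m)) {u : TF V} (hu : u ∈ globalAlg V) : P u := by
  have hu' : u ∈ Submodule.span ℝ (Submonoid.closure (globalGen V) : Set (TF V)) := by
    rw [← Algebra.adjoin_eq_span]; exact hu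
  refine Submodule.span_induction (p := fun x _ => P x) ?_ (by simpa using hsmul 0 1 h1)
    (fun u v _ _ => hadd u v) (fun r u _ => hsmul r u) hu'
  intro m hm
  refine Submonoid.closure_induction_left (motive := fun x _ => P x) h1 ?_ hm
  rintro g ((⟨f, rfl⟩ | ⟨Y, rfl⟩) | ⟨ξ, rfl⟩) m _ ih
  exacts [hfun f m ih, hvec Y m ih, hcov ξ m ih]

theorem exists_vecSec_apply_eq (p : M) (v : V p) : ∃ Y : VecSec V, Y p = v := by
  obtain ⟨Fr⟩ := nonempty_frameAt (V := V) p
  obtain ⟨b, hb, -⟩ := Fr.exists_basis.self_of_nhds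
  refine ⟨∑ a, b.repr v a • Fr.vecs a, ?_⟩
  have := map_sum (ContMDiffSection.coeAddHom (𝓡 4) R4 ∞ V) (fun a => b.repr v a • Fr.vecs a)
    Finset.univ
  have h := congrFun this p
  simp only [Finset.sum_apply] at h
  refine h.trans ?_
  conv_rhs => rw [← b.sum_repr v]
  exact Finset.sum_congr rfl fun a _ => by rw [hb]; rfl

theorem exists_covSec_apply_eq (p : M) (ξ : Module.Dual ℝ (V p)) :
    ∃ η : CovSec V, (η p : V p →ₗ[ℝ] ℝ) = ξ := by
  obtain ⟨Fr⟩ := nonempty_frameAt (V := V) p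
  obtain ⟨b, hb, hb'⟩ := Fr.exists_basis.self_of_nhds
  refine ⟨∑ a, ξ (b a) • Fr.covs a, ?_⟩
  have := map_sum (ContMDiffSection.coeAddHom (𝓡 4) (R4 →L[ℝ] ℝ) ∞ (fun p => V p →L[ℝ] ℝ))
    (fun a => ξ (b a) • Fr.covs a) Finset.univ
  have h := congrFun this p
  simp only [Finset.sum_apply] at h
  refine (congrArg _ h).trans ?_
  conv_rhs => rw [← b.sum_dual_apply_smul_coord ξ]
  ext v
  simp only [hb']
  simp [ContMDiffSection.coeAddHom]

/-- Iterated contractions with sections. -/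
def coefF : List (VecSec V ⊕ CovSec V) → TF V →ₗ[ℝ] Fun M
  | [] => epsF
  | .inl Y :: l => (coefF l).comp (contrF Y)
  | .inr ξ :: l => (coefF l).comp (contrCovF ξ)

theorem coefF_apply_congr (l : List (VecSec V ⊕ CovSec V)) {u v : TF V} {p : M}
    (h : u.1 p = v.1 p) : coefF l u p = coefF l v p := by
  induction l generalizing u v with
  | nil => simp only [coefF, epsF_apply, h]
  | cons x l ih =>
    rcases x with Y | ξ
    · exact ih (by simp only [contrF_apply, h])
    · exact ih (by simp only [contrCovF_apply, h])

theorem exists_coefF_eq (p : M) (l : List (V p ⊕ Module.Dual ℝ (V p))) :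
    ∃ l' : List (VecSec V ⊕ CovSec V), ∀ u : TF V, coefF l' u p = coef l (u.1 p) := by
  induction l with
  | nil => exact ⟨[], fun u => rfl⟩
  | cons x l ih =>
    obtain ⟨l', hl'⟩ := ih
    rcases x with y | ξ
    · obtain ⟨Y, rfl⟩ := exists_vecSec_apply_eq p y
      exact ⟨.inl Y :: l', fun u => hl' _⟩
    · obtain ⟨η, rfl⟩ := exists_covSec_apply_eq p ξ
      exact ⟨.inr η :: l', fun u => hl' _⟩

/-- Every vector and covector at `p` is the value of a global section, so contractions with sections
suffice to separate tensors at `p`. -/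
theorem apply_eq_of_coefF {u v : TF V} {p : M} (h : ∀ l, coefF l u p = coefF l v p) :
    u.1 p = v.1 p := by
  refine sub_eq_zero.1 (eq_zero_of_coef (fibreBasis V p) fun l => ?_)
  obtain ⟨l', hl'⟩ := exists_coefF_eq p l
  have := hl' (u - v)
  rw [TF.sub_apply] at this
  rw [← this, map_sub]
  exact sub_eq_zero.2 (h l')

variable (V) in
/-- The action of a derivation on functions and on the sections of `V` and `V*`. -/
structure ConnData where
  /-- The action on functions. -/
  a : Derivation ℝ (Fun M) (Fun M)
  /-- The action on sections of `V`. -/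
  nV : VecSec V → VecSec V
  /-- The action on sections of `V*`. -/
  nC : CovSec V → CovSec V
  -- No additivity or Leibniz rule for `nV` and `nC` is demanded: this identity forces both, because
  -- the pairing separates sections.
  compat : ∀ ξ Z, a (pair ξ Z) = pair (nC ξ) Z + pair ξ (nV Z)

/-- With a bump function `ρ` supported where `f = g` and equal to `1` near `p`, the product `ρ (f -
g)` is zero; the Leibniz rule at `p` then leaves only `a (f - g)`. -/
theorem derivation_apply_congr (a : Derivation ℝ (Fun M) (Fun M)) {f g : Fun M} {p : M}
    (h : ∀ᶠ q in 𝓝 p, f q = g q) : a f p = a g p := by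
  obtain ⟨U, hU, hUo, hpU⟩ := eventually_nhds_iff.1 h
  obtain ⟨ρ, hρ, hρU⟩ := exists_bump hUo hpU
  have h0 : ρ * (f - g) = 0 := by
    ext q
    by_cases hq : q ∈ U
    · change ρ q * (f q - g q) = 0
      rw [hU q hq, sub_self, mul_zero]
    · change ρ q * (f q - g q) = 0
      rw [image_eq_zero_of_notMem_tsupport fun h => hq (hρU h), zero_mul]
  have h1 := congrArg (fun k : Fun M => k p) ((a.leibniz ρ (f - g)).symm.trans (by rw [h0]))
  have h2 : ρ p * (a (f - g) p) + (f p - g p) * a ρ p = (a 0) p := h1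
  rw [hρ.self_of_nhds, h.self_of_nhds, map_sub, map_zero] at h2
  have h3 : (a f - a g) p = a f p - a g p := rfl
  have h4 : (0 : Fun M) p = 0 := rfl
  rw [h3, h4] at h2
  linarith

namespace ConnData

variable (C : ConnData V)

/-- The correction term in the Leibniz rule for iterated contractions. -/
def coefD : List (VecSec V ⊕ CovSec V) → TF V →ₗ[ℝ] Fun M
  | [] => 0
  | .inl Y :: l => (coefF l).comp (contrF (C.nV Y)) + (coefD l).comp (contrF Y)
  | .inr ξ :: l => (coefF l).comp (contrCovF (C.nC ξ)) + (coefD l).comp (contrCovF ξ)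

theorem coefD_apply_congr (l : List (VecSec V ⊕ CovSec V)) {u v : TF V} {p : M}
    (h : u.1 p = v.1 p) : C.coefD l u p = C.coefD l v p := by
  induction l generalizing u v with
  | nil => rfl
  | cons x l ih =>
    rcases x with Y | ξ
    · exact congrArg₂ (· + ·) (coefF_apply_congr l (by simp only [contrF_apply, h]))
        (ih (by simp only [contrF_apply, h]))
    · exact congrArg₂ (· + ·) (coefF_apply_congr l (by simp only [contrCovF_apply, h]))
        (ih (by simp only [contrCovF_apply, h]))

/-- `t` is the derivative of `u`. -/
def IsDeriv (u t : TF V) : Prop :=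
  -- The Leibniz rule for contractions serves as the definition. `coefD` collects the terms in which
  -- one of the contracting sections is differentiated, so these equations prescribe every
  -- coefficient of `t`.
  ∀ l, C.a (coefF l u) = coefF l t + C.coefD l u

/-- The coefficients of a derivative at `p` depend on the germ of `u` through the local operator
`C.a`, and on `u p` through `coefD`. Uniqueness and locality of the derivative therefore come out
together. -/
theorem IsDeriv.apply_eq {u v s t : TF V} {p : M}
    (hu : ∀ l, C.a (coefF l u) p = coefF l s p + C.coefD l u p)
    (hv : ∀ l, C.a (coefF l v) p = coefF l t p + C.coefD l v p)
    (h : ∀ᶠ q in 𝓝 p, u.1 q = v.1 q) : s.1 p = t.1 p := by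
  refine apply_eq_of_coefF fun l => ?_
  have h1 := derivation_apply_congr C.a (h.mono fun q hq => coefF_apply_congr l hq)
  rw [hu l, hv l, C.coefD_apply_congr l h.self_of_nhds] at h1
  exact add_right_cancel h1

theorem IsDeriv.unique {u s t : TF V} (hs : C.IsDeriv u s) (ht : C.IsDeriv u t) : s = t :=
  TF.ext_apply fun p => IsDeriv.apply_eq C (fun l => by rw [hs l]; rfl) (fun l => by rw [ht l]; rfl)
    (Filter.Eventually.of_forall fun _ => rfl)

theorem IsDeriv.add {u v s t : TF V} (hs : C.IsDeriv u s) (ht : C.IsDeriv v t) :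
    C.IsDeriv (u + v) (s + t) := fun l => by
  simp only [map_add, hs l, ht l]; abel

theorem IsDeriv.smul {u s : TF V} (r : ℝ) (hs : C.IsDeriv u s) :
    C.IsDeriv (r • u) (r • s) := fun l => by
  rw [map_smul, Derivation.map_smul, hs l, map_smul, map_smul, smul_add]

end ConnData

theorem contrF_ofFun_mul (Y : VecSec V) (f : Fun M) (u : TF V) :
    contrF Y (ofFun V f * u) = ofFun V f * contrF Y u :=
  TF.ext_apply fun _ => contr_algebraMap_mul _ _ _

theorem contrCovF_ofFun_mul (ξ : CovSec V) (f : Fun M) (u : TF V) :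
    contrCovF ξ (ofFun V f * u) = ofFun V f * contrCovF ξ u :=
  TF.ext_apply fun _ => contrCov_algebraMap_mul _ _ _

theorem contrF_ofVec_mul (Y Z : VecSec V) (u : TF V) : contrF Y (ofVec Z * u) = 0 :=
  TF.ext_apply fun _ => contr_vec_mul _ _ _

theorem contrCovF_ofVec_mul (ξ : CovSec V) (Z : VecSec V) (u : TF V) :
    contrCovF ξ (ofVec Z * u) = ofFun V (pair ξ Z) * u :=
  TF.ext_apply fun _ => (contrCov_vec_mul _ _ _).trans (Algebra.smul_def _ _)

theorem contrF_ofCov_mul (Y : VecSec V) (ξ : CovSec V) (u : TF V) :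
    contrF Y (ofCov ξ * u) = ofFun V (pair ξ Y) * u :=
  TF.ext_apply fun _ => (contr_cov_mul _ _ _).trans (Algebra.smul_def _ _)

theorem contrCovF_ofCov_mul (ξ η : CovSec V) (u : TF V) : contrCovF ξ (ofCov η * u) = 0 :=
  TF.ext_apply fun _ => contrCov_cov_mul _ _ _

theorem coefF_ofFun_mul (l : List (VecSec V ⊕ CovSec V)) (f : Fun M) (u : TF V) :
    coefF l (ofFun V f * u) = f * coefF l u := by
  induction l generalizing u with
  | nil => ext p; simp [coefF, epsF_apply, TF.mul_apply, ofFun_apply]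
  | cons x l ih =>
    rcases x with Y | ξ
    · simp only [coefF, LinearMap.comp_apply, contrF_ofFun_mul, ih]
    · simp only [coefF, LinearMap.comp_apply, contrCovF_ofFun_mul, ih]

theorem epsF_ofVec_mul (Z : VecSec V) (u : TF V) : epsF (ofVec Z * u) = 0 := by
  ext p
  simp [epsF_apply, TF.mul_apply, ofVec_apply]

theorem epsF_ofCov_mul (ξ : CovSec V) (u : TF V) : epsF (ofCov ξ * u) = 0 := by
  ext p
  simp [epsF_apply, TF.mul_apply, ofCov_apply]

variable (V) in
theorem ofFun_add (f g : Fun M) : ofFun V (f + g) = ofFun V f + ofFun V g :=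
  TF.ext_apply fun p => map_add (algebraMap ℝ (Tens (V p))) (f p) (g p)

variable (V) in
theorem ofFun_one : ofFun V (1 : Fun M) = 1 :=
  TF.ext_apply fun p => map_one (algebraMap ℝ (Tens (V p)))

namespace ConnData

variable (C : ConnData V)

theorem coefD_ofFun_mul (l : List (VecSec V ⊕ CovSec V)) (f : Fun M) (u : TF V) :
    C.coefD l (ofFun V f * u) = f * C.coefD l u := by
  induction l generalizing u with
  | nil => simp [coefD]
  | cons x l ih =>
    rcases x with Y | ξ
    · simp only [coefD, LinearMap.add_apply, LinearMap.comp_apply, contrF_ofFun_mul, ih,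
        coefF_ofFun_mul, mul_add]
    · simp only [coefD, LinearMap.add_apply, LinearMap.comp_apply, contrCovF_ofFun_mul, ih,
        coefF_ofFun_mul, mul_add]

theorem IsDeriv.ofFun_mul {m t : TF V} (f : Fun M) (h : C.IsDeriv m t) :
    C.IsDeriv (ofFun V f * m) (ofFun V (C.a f) * m + ofFun V f * t) := fun l => by
  rw [coefF_ofFun_mul, Derivation.leibniz, h l, map_add, coefF_ofFun_mul, coefF_ofFun_mul,
    coefD_ofFun_mul, smul_eq_mul, smul_eq_mul]
  ring

/-- Only a first contraction with a covector section `ξ` sees `Z`. It turns `Z` into the function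
`pair ξ Z`, whose derivative is given by `compat`. -/
theorem IsDeriv.ofVec_mul {m t : TF V} (Z : VecSec V) (h : C.IsDeriv m t) :
    C.IsDeriv (ofVec Z * m) (ofVec (C.nV Z) * m + ofVec Z * t) := by
  rintro (_ | ⟨Y | ξ, l⟩)
  · simp [coefF, coefD, epsF_ofVec_mul]
  · simp [coefF, coefD, contrF_ofVec_mul]
  · simp only [coefF, coefD, LinearMap.comp_apply, map_add, LinearMap.add_apply,
      contrCovF_ofVec_mul, coefF_ofFun_mul, coefD_ofFun_mul, Derivation.leibniz, h l, C.compat,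
      smul_eq_mul]
    ring

theorem IsDeriv.ofCov_mul {m t : TF V} (ξ : CovSec V) (h : C.IsDeriv m t) :
    C.IsDeriv (ofCov ξ * m) (ofCov (C.nC ξ) * m + ofCov ξ * t) := by
  rintro (_ | ⟨Y | ξ, l⟩)
  · simp [coefF, coefD, epsF_ofCov_mul]
  · simp only [coefF, coefD, LinearMap.comp_apply, map_add, LinearMap.add_apply,
      contrF_ofCov_mul, coefF_ofFun_mul, coefD_ofFun_mul, Derivation.leibniz, h l, C.compat,
      smul_eq_mul]
    ring
  · simp [coefF, coefD, contrCovF_ofCov_mul]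

theorem coefD_one (l : List (VecSec V ⊕ CovSec V)) : C.coefD l 1 = 0 := by
  rcases l with _ | ⟨Y | ξ, l⟩
  · rfl
  · have h (Y : VecSec V) : contrF Y (1 : TF V) = 0 := TF.ext_apply fun _ => contr_one _
    simp [coefD, h]
  · have h (Y : CovSec V) : contrCovF Y (1 : TF V) = 0 := TF.ext_apply fun _ => contrCov_one _
    simp [coefD, h]

theorem coefF_one (l : List (VecSec V ⊕ CovSec V)) : C.a (coefF l 1) = 0 := by
  rcases l with _ | ⟨Y | ξ, l⟩
  · have : coefF [] (1 : TF V) = 1 := by ext p; exact map_one eps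
    rw [this, Derivation.map_one_eq_zero]
  · have h (Y : VecSec V) : contrF Y (1 : TF V) = 0 := TF.ext_apply fun _ => contr_one _
    simp [coefF, h]
  · have h (Y : CovSec V) : contrCovF Y (1 : TF V) = 0 := TF.ext_apply fun _ => contrCov_one _
    simp [coefF, h]

theorem isDeriv_one : C.IsDeriv 1 0 := fun l => by
  rw [coefF_one, coefD_one, map_zero, add_zero]

/-- The product rule against an arbitrary differentiable right factor `v` is carried along in the
induction, since generators are added on the left only. It is also what makes `nabla_mul` available
for general tensor fields. -/
theorem exists_isDeriv_globalAlg {u : TF V} (hu : u ∈ globalAlg V) :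
    ∃ t, C.IsDeriv u t ∧ ∀ v s, C.IsDeriv v s → C.IsDeriv (u * v) (t * v + u * s) := by
  refine globalAlg_induction (P := fun u => ∃ t, C.IsDeriv u t ∧ ∀ v s, C.IsDeriv v s →
    C.IsDeriv (u * v) (t * v + u * s)) ?_ ?_ ?_ ?_ ?_ ?_ hu
  · exact ⟨0, C.isDeriv_one, fun v s h => by simpa using h⟩
  · rintro u v ⟨s, hs, hs'⟩ ⟨t, ht, ht'⟩
    refine ⟨s + t, hs.add C ht, fun w r hw => ?_⟩
    convert (hs' w r hw).add C (ht' w r hw) using 1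
    · rw [add_mul]
    · rw [add_mul, add_mul]; abel
  · rintro r u ⟨s, hs, hs'⟩
    refine ⟨r • s, hs.smul C r, fun w t hw => ?_⟩
    convert (hs' w t hw).smul C r using 1
    · rw [smul_mul_assoc]
    · rw [smul_add, smul_mul_assoc, smul_mul_assoc]
  · rintro f m ⟨s, hs, hs'⟩
    refine ⟨_, hs.ofFun_mul C f, fun w t hw => ?_⟩
    convert (hs' w t hw).ofFun_mul C f using 1
    · rw [mul_assoc]
    · noncomm_ring
  · rintro f m ⟨s, hs, hs'⟩
    refine ⟨_, hs.ofVec_mul C f, fun w t hw => ?_⟩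
    convert (hs' w t hw).ofVec_mul C f using 1
    · rw [mul_assoc]
    · noncomm_ring
  · rintro f m ⟨s, hs, hs'⟩
    refine ⟨_, hs.ofCov_mul C f, fun w t hw => ?_⟩
    convert (hs' w t hw).ofCov_mul C f using 1
    · rw [mul_assoc]
    · noncomm_ring

/-- Every tensor field has a derivative. -/
theorem exists_isDeriv (u : TF V) : ∃ t, C.IsDeriv u t := by
  choose v hv huv using fun p => exists_globalAlg_eq u p
  choose t ht _ using fun p => C.exists_isDeriv_globalAlg (hv p)
  -- Near `q`, the fields `v q` and `v p` both agree with `u`, and derivatives are local. Hence the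
  -- diagonal field `p ↦ (t p) p` coincides near each point with a single smooth field.
  have key (p : M) : ∀ᶠ q in 𝓝 p, (t q).1 q = (t p).1 q := by
    filter_upwards [eventually_eventually_nhds.2 (huv p)] with q hq
    refine IsDeriv.apply_eq C (fun l => by rw [ht q l]; rfl) (fun l => by rw [ht p l]; rfl) ?_
    filter_upwards [hq, huv q] with r h1 h2
    exact h2.symm.trans h1
  refine ⟨⟨fun p => (t p).1 p, fun p => ?_⟩, fun l => ?_⟩
  · obtain ⟨U, hU, hpU, u', hu', h⟩ := (t p).2 p
    obtain ⟨U₂, hU₂, hU₂o, hpU₂⟩ := eventually_nhds_iff.1 (key p)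
    exact ⟨U ∩ U₂, hU.inter hU₂o, ⟨hpU, hpU₂⟩, u', smoothAlg_mono V Set.inter_subset_left hu',
      fun q hq => (hU₂ q hq.2).trans (h q hq.1)⟩
  · ext p
    have h1 := derivation_apply_congr C.a ((huv p).mono fun q hq => coefF_apply_congr l hq)
    rw [h1, ht p l]
    change coefF l (t p) p + C.coefD l (v p) p = coefF l _ p + C.coefD l u p
    rw [C.coefD_apply_congr l (huv p).self_of_nhds]
    exact congrArg (· + _) (coefF_apply_congr l rfl)

/-- The derivation of the algebra of tensor fields defined by its action on sections. -/
def nabla : TF V →ₗ[ℝ] TF V where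
  toFun u := (C.exists_isDeriv u).choose
  map_add' u v := IsDeriv.unique C (C.exists_isDeriv (u + v)).choose_spec
    ((C.exists_isDeriv u).choose_spec.add C (C.exists_isDeriv v).choose_spec)
  map_smul' r u := IsDeriv.unique C (C.exists_isDeriv (r • u)).choose_spec
    ((C.exists_isDeriv u).choose_spec.smul C r)

theorem isDeriv_nabla (u : TF V) : C.IsDeriv u (C.nabla u) := (C.exists_isDeriv u).choose_spec

theorem nabla_eq {u t : TF V} (h : C.IsDeriv u t) : C.nabla u = t :=
  IsDeriv.unique C (C.isDeriv_nabla u) h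

theorem nabla_apply_congr {u v : TF V} {p : M} (h : ∀ᶠ q in 𝓝 p, u.1 q = v.1 q) :
    (C.nabla u).1 p = (C.nabla v).1 p :=
  IsDeriv.apply_eq C (fun l => by rw [C.isDeriv_nabla u l]; rfl)
    (fun l => by rw [C.isDeriv_nabla v l]; rfl) h

/-- Only the left factor has to be replaced by an element of `globalAlg` near `p`; the right factor
may stay arbitrary. -/
theorem nabla_mul (u v : TF V) : C.nabla (u * v) = C.nabla u * v + u * C.nabla v := by
  refine TF.ext_apply fun p => ?_
  obtain ⟨u', hu', huu'⟩ := exists_globalAlg_eq u p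
  obtain ⟨t, ht, ht'⟩ := C.exists_isDeriv_globalAlg hu'
  rw [C.nabla_apply_congr (v := u' * v) (huu'.mono fun q hq => by
    simp only [TF.mul_apply, hq]), C.nabla_eq (ht' v _ (C.isDeriv_nabla v))]
  simp only [TF.add_apply, TF.mul_apply, C.nabla_apply_congr huu', huu'.self_of_nhds,
    C.nabla_eq ht]

theorem nabla_ofFun (f : Fun M) : C.nabla (ofFun V f) = ofFun V (C.a f) := by
  simpa using C.nabla_eq (C.isDeriv_one.ofFun_mul C f)

theorem nabla_ofVec (Z : VecSec V) : C.nabla (ofVec Z) = ofVec (C.nV Z) := by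
  simpa using C.nabla_eq (C.isDeriv_one.ofVec_mul C Z)

theorem nabla_ofCov (ξ : CovSec V) : C.nabla (ofCov ξ) = ofCov (C.nC ξ) := by
  simpa using C.nabla_eq (C.isDeriv_one.ofCov_mul C ξ)

/-- The equations that define the derivative of `contrF Y u` are those for `u`, restricted to lists
that begin with `Y`. -/
theorem nabla_contrF (Y : VecSec V) (u : TF V) :
    C.nabla (contrF Y u) = contrF Y (C.nabla u) + contrF (C.nV Y) u :=
  C.nabla_eq fun l => by
    have := C.isDeriv_nabla u (.inl Y :: l)
    simp only [coefF, coefD, LinearMap.comp_apply, LinearMap.add_apply] at this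
    rw [this, map_add]; abel

theorem nabla_contrCovF (ξ : CovSec V) (u : TF V) :
    C.nabla (contrCovF ξ u) = contrCovF ξ (C.nabla u) + contrCovF (C.nC ξ) u :=
  C.nabla_eq fun l => by
    have := C.isDeriv_nabla u (.inr ξ :: l)
    simp only [coefF, coefD, LinearMap.comp_apply, LinearMap.add_apply] at this
    rw [this, map_add]; abel

theorem epsF_nabla (u : TF V) : epsF (C.nabla u) = C.a (epsF u) := by
  have := C.isDeriv_nabla u []
  simpa [coefF, coefD] using this.symm

end ConnData

/-- A derivation of the algebra of tensor fields is a local operator. -/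
theorem derivation_local {N : TF V →ₗ[ℝ] TF V}
    (hN : ∀ u v, N (u * v) = N u * v + u * N v) {u v : TF V} {p : M}
    (h : ∀ᶠ q in 𝓝 p, u.1 q = v.1 q) : (N u).1 p = (N v).1 p := by
  obtain ⟨U, hU, hUo, hpU⟩ := eventually_nhds_iff.1 h
  obtain ⟨ρ, hρ, hρU⟩ := exists_bump hUo hpU
  have h0 : ofFun V ρ * (u - v) = 0 := by
    refine TF.ext_apply fun q => ?_
    rw [TF.mul_apply, TF.sub_apply, TF.zero_apply, ofFun_apply]
    by_cases hq : q ∈ U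
    · rw [hU q hq, sub_self, mul_zero]
    · rw [image_eq_zero_of_notMem_tsupport fun h => hq (hρU h), map_zero, zero_mul]
  have h1 := congrArg (fun k : TF V => k.1 p) ((hN (ofFun V ρ) (u - v)).symm.trans (by rw [h0]))
  simp only [TF.add_apply, TF.mul_apply, TF.sub_apply, map_sub, map_zero, TF.zero_apply,
    ofFun_apply, hρ.self_of_nhds, h.self_of_nhds, sub_self, mul_zero, zero_add, map_one,
    one_mul] at h1
  exact sub_eq_zero.1 h1

/-- A derivation of the algebra of tensor fields is determined by its action on functions and
on the sections of `V` and `V*`. -/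
theorem derivation_ext {N N' : TF V →ₗ[ℝ] TF V}
    (hN : ∀ u v, N (u * v) = N u * v + u * N v) (hN' : ∀ u v, N' (u * v) = N' u * v + u * N' v)
    (hf : ∀ f, N (ofFun V f) = N' (ofFun V f)) (hv : ∀ Z, N (ofVec Z) = N' (ofVec Z))
    (hc : ∀ ξ, N (ofCov ξ) = N' (ofCov ξ)) : N = N' := by
  refine LinearMap.ext fun u => TF.ext_apply fun p => ?_
  obtain ⟨u', hu', huu'⟩ := exists_globalAlg_eq u p
  rw [derivation_local hN huu', derivation_local hN' huu']
  have : N u' = N' u' := by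
    refine globalAlg_induction (P := fun u => N u = N' u) ?_ ?_ ?_ ?_ ?_ ?_ hu'
    · simpa [ofFun_one] using hf 1
    · intro u v hu hv
      rw [map_add, map_add, hu, hv]
    · intro r u hu
      rw [map_smul, map_smul, hu]
    · intro f m hm
      rw [hN, hN', hf, hm]
    · intro f m hm
      rw [hN, hN', hv, hm]
    · intro f m hm
      rw [hN, hN', hc, hm]
  rw [this]

end Derivations

/-! ### The Levi-Civita connection on `M` by the Koszul formula. -/

section LeviCivita

open VectorField

variable {M : Type*} [TopologicalSpace M] [ChartedSpace R4 M] [IsManifold (𝓡 4) ∞ M]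

/-- A vector field. -/
abbrev VField (M : Type*) [TopologicalSpace M] [ChartedSpace R4 M] : Type _ :=
  ∀ p : M, TangentSpace (𝓡 4) p

/-- A vector field is differentiable at a point. -/
abbrev VDiffAt (X : VField M) (p : M) : Prop :=
  MDifferentiableAt (𝓡 4) ((𝓡 4).prod 𝓘(ℝ, R4))
    (fun q => (TotalSpace.mk' R4 q (X q) : TotalSpace R4 (TangentSpace (𝓡 4) : M → Type))) p

/-- A symmetric nondegenerate metric for which differentiable vector fields have
differentiable products. -/
structure DiffMetric (M : Type*) [TopologicalSpace M] [ChartedSpace R4 M]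
    [IsManifold (𝓡 4) ∞ M] where
  /-- The bilinear form at a point. -/
  form : ∀ p : M, TangentSpace (𝓡 4) p →ₗ[ℝ] TangentSpace (𝓡 4) p →ₗ[ℝ] ℝ
  symm : ∀ p x y, form p x y = form p y x
  nondeg : ∀ p x, (∀ y, form p x y = 0) → x = 0
  diff : ∀ (p : M) (X Y : VField M), VDiffAt X p → VDiffAt Y p →
    MDifferentiableAt (𝓡 4) 𝓘(ℝ, ℝ) (fun q => form q (X q) (Y q)) p

namespace DiffMetric

variable (G : DiffMetric M)

/-- The right hand side of the Koszul formula for `2 g(∇_X A, W)`. -/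
def koszul (A X W : VField M) (p : M) : ℝ :=
  mvfderiv (𝓡 4) (fun q => G.form q (A q) (W q)) p (X p)
    + mvfderiv (𝓡 4) (fun q => G.form q (X q) (W q)) p (A p)
    - mvfderiv (𝓡 4) (fun q => G.form q (X q) (A q)) p (W p)
    + G.form p (mlieBracket (𝓡 4) X A p) (W p)
    - G.form p (mlieBracket (𝓡 4) X W p) (A p)
    - G.form p (mlieBracket (𝓡 4) A W p) (X p)

variable {G} {p : M}

theorem mvfderiv_mul_form {f : M → ℝ} {X Y : VField M}
    (hf : MDifferentiableAt (𝓡 4) 𝓘(ℝ, ℝ) f p) (hX : VDiffAt X p) (hY : VDiffAt Y p)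
    (v : TangentSpace (𝓡 4) p) :
    mvfderiv (𝓡 4) (fun q => f q * G.form q (X q) (Y q)) p v =
      f p * mvfderiv (𝓡 4) (fun q => G.form q (X q) (Y q)) p v
        + mvfderiv (𝓡 4) f p v * G.form p (X p) (Y p) := by
  have := mvfderiv_mul hf (G.diff p X Y hX hY)
  have h2 : (fun q => f q * G.form q (X q) (Y q)) = f * fun q => G.form q (X q) (Y q) := rfl
  rw [h2, this]
  simp only [_root_.add_apply, _root_.smul_apply, smul_eq_mul]
  ring

theorem mvfderiv_add_form {X Y X' Y' : VField M}
    (hX : VDiffAt X p) (hY : VDiffAt Y p) (hX' : VDiffAt X' p) (hY' : VDiffAt Y' p)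
    (v : TangentSpace (𝓡 4) p) :
    mvfderiv (𝓡 4) (fun q => G.form q (X q) (Y q) + G.form q (X' q) (Y' q)) p v =
      mvfderiv (𝓡 4) (fun q => G.form q (X q) (Y q)) p v
        + mvfderiv (𝓡 4) (fun q => G.form q (X' q) (Y' q)) p v := by
  have := mvfderiv_add (G.diff p X Y hX hY) (G.diff p X' Y' hX' hY')
  exact congrArg (fun L => L v) this

/-- Replacing `X` by `f X` produces `df(A) g(X, W)` and `-df(W) g(X, A)` from the derivative terms,
and the brackets with `X` return both with the opposite sign. -/
theorem koszul_tensorial₁ {A W : VField M} (hA : VDiffAt A p) (hW : VDiffAt W p) :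
    TensorialAt (𝓡 4) R4 (fun X : VField M => G.koszul A X W p) p where
  smul {f X} hf hX := by
    simp only [koszul, Pi.smul_apply', map_smul, LinearMap.smul_apply, smul_eq_mul,
      mlieBracket_smul_left hf hX, map_add, LinearMap.add_apply]
    rw [mvfderiv_mul_form hf hX hW, mvfderiv_mul_form hf hX hA]
    rw [G.symm p (X p) (A p)]
    ring
  add {X X'} hX hX' := by
    simp only [koszul, Pi.add_apply, map_add, LinearMap.add_apply,
      mlieBracket_add_left hX hX']
    rw [mvfderiv_add_form hX hW hX' hW, mvfderiv_add_form hX hA hX' hA]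
    ring

/-- Here the terms to cancel are `df(X) g(A, W)` and `df(A) g(X, W)`; the brackets `[X, f W]` and
`[A, f W]` remove them. -/
theorem koszul_tensorial₂ {A X : VField M} (hA : VDiffAt A p) (hX : VDiffAt X p) :
    TensorialAt (𝓡 4) R4 (fun W : VField M => G.koszul A X W p) p where
  smul {f W} hf hW := by
    simp only [koszul, Pi.smul_apply', map_smul, LinearMap.smul_apply, smul_eq_mul,
      mlieBracket_smul_right hf hW, map_add, LinearMap.add_apply]
    rw [mvfderiv_mul_form hf hX hW, mvfderiv_mul_form hf hA hW,
      G.symm p (W p) (X p), G.symm p (W p) (A p)]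
    ring
  add {W W'} hW hW' := by
    simp only [koszul, Pi.add_apply, map_add, LinearMap.add_apply,
      mlieBracket_add_right hW hW']
    rw [mvfderiv_add_form hX hW hX hW', mvfderiv_add_form hA hW hA hW']
    ring

theorem koszul_add {A A' X W : VField M} (hA : VDiffAt A p) (hA' : VDiffAt A' p)
    (hX : VDiffAt X p) (hW : VDiffAt W p) :
    G.koszul (A + A') X W p = G.koszul A X W p + G.koszul A' X W p := by
  simp only [koszul, Pi.add_apply, map_add, LinearMap.add_apply,
    mlieBracket_add_right hA hA', mlieBracket_add_left hA hA']
  rw [mvfderiv_add_form hA hW hA' hW, mvfderiv_add_form hX hA hX hA']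
  ring

/-- The term `df(X) g(A, W)` appears twice, once from the derivative of `g(f A, W)` and once from
`[X, f A]`; the terms in `df(W)` cancel. This is the Leibniz rule of the connection, doubled. -/
theorem koszul_smul {f : M → ℝ} {A X W : VField M} (hf : MDifferentiableAt (𝓡 4) 𝓘(ℝ, ℝ) f p)
    (hA : VDiffAt A p) (hX : VDiffAt X p) (hW : VDiffAt W p) :
    G.koszul (f • A) X W p = f p * G.koszul A X W p
      + 2 * (mvfderiv (𝓡 4) f p (X p) * G.form p (A p) (W p)) := by
  simp only [koszul, Pi.smul_apply', map_smul, LinearMap.smul_apply, smul_eq_mul,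
    mlieBracket_smul_right hf hA, mlieBracket_smul_left hf hA, map_add, LinearMap.add_apply]
  rw [mvfderiv_mul_form hf hA hW, mvfderiv_mul_form hf hX hA]
  rw [G.symm p (X p) (A p)]
  ring

/-- This is torsion-freeness tested against `W`: the derivative terms are symmetric in `A` and `X`,
so only the bracket survives. -/
theorem koszul_sub {A X W : VField M} :
    G.koszul A X W p - G.koszul X A W p = 2 * G.form p (mlieBracket (𝓡 4) X A p) (W p) := by
  have h : (fun q => G.form q (X q) (A q)) = fun q => G.form q (A q) (X q) :=
    funext fun q => G.symm q _ _
  rw [koszul, koszul, h, mlieBracket_swap_apply (V := A) (W := X)]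
  simp only [map_neg, LinearMap.neg_apply]
  ring

/-- This is metric compatibility: everything except the first derivative term is skew under
exchanging `A` and `B`. -/
theorem koszul_metric {A X B : VField M} :
    G.koszul A X B p + G.koszul B X A p =
      2 * mvfderiv (𝓡 4) (fun q => G.form q (A q) (B q)) p (X p) := by
  have h : (fun q => G.form q (A q) (B q)) = fun q => G.form q (B q) (A q) :=
    funext fun q => G.symm q _ _
  rw [koszul, koszul, h, mlieBracket_swap_apply (V := A) (W := B)]
  simp only [map_neg, LinearMap.neg_apply]
  ring

variable (G) in
theorem form_injective (p : M) : Function.Injective (G.form p) := by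
  rw [injective_iff_map_eq_zero]
  exact fun x hx => G.nondeg p x fun y => by rw [hx]; rfl

local instance (p : M) : FiniteDimensional ℝ (TangentSpace (𝓡 4) p) :=
  inferInstanceAs (FiniteDimensional ℝ R4)

local instance (p : M) : T2Space (TangentSpace (𝓡 4) p) :=
  inferInstanceAs (T2Space R4)

variable (G) in
/-- The isomorphism between tangent and cotangent space. -/
def flat (p : M) : TangentSpace (𝓡 4) p ≃ₗ[ℝ] Module.Dual ℝ (TangentSpace (𝓡 4) p) :=
  LinearEquiv.ofInjectiveOfFinrankEq (G.form p) (G.form_injective p)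
    Subspace.dual_finrank_eq.symm

open Classical in
variable (G) in
/-- The Levi-Civita connection as a function on vector fields. -/
def lcFun (A : VField M) (p : M) : TangentSpace (𝓡 4) p →L[ℝ] TangentSpace (𝓡 4) p :=
  if hA : VDiffAt A p then
    -- By tensoriality the Koszul expression is a bilinear form in the vectors `X p` and `W p`. Half
    -- of the resulting functional of `W p` is turned into a vector by the inverse of `flat`.
    LinearMap.toContinuousLinearMap ((1 / 2 : ℝ) • (G.flat p).symm.toLinearMap ∘ₗ
      (LinearMap.toContinuousLinearMap (𝕜 := ℝ) (E := TangentSpace (𝓡 4) p)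
        (F' := ℝ)).symm.toLinearMap ∘ₗ
      (TensorialAt.mkHom₂ (I := 𝓡 4) (F := R4) (F' := R4) (fun X W : VField M => G.koszul A X W p)
        p (fun _ h => koszul_tensorial₁ hA h) (fun _ h => koszul_tensorial₂ hA h)).toLinearMap)
  -- The axioms of a covariant derivative concern only fields that are differentiable at the point,
  -- so any default value is admissible.
  else 0

theorem form_lcFun {A X W : VField M} (hA : VDiffAt A p) (hX : VDiffAt X p)
    (hW : VDiffAt W p) : 2 * G.form p (G.lcFun A p (X p)) (W p) = G.koszul A X W p := by
  have h := TensorialAt.mkHom₂_apply (I := 𝓡 4) (F := R4) (F' := R4)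
    (Φ := fun X W : VField M => G.koszul A X W p)
    (fun _ h => koszul_tensorial₁ hA h) (fun _ h => koszul_tensorial₂ hA h) hX hW
  rw [← h, lcFun, dif_pos hA]
  have h2 (ξ : Module.Dual ℝ (TangentSpace (𝓡 4) p)) : G.form p ((G.flat p).symm ξ) = ξ :=
    (G.flat p).apply_symm_apply ξ
  generalize TensorialAt.mkHom₂ (I := 𝓡 4) (F := R4) (F' := R4)
    (fun X W : VField M => G.koszul A X W p) p _ _ = K
  change 2 * G.form p ((1 / 2 : ℝ) • (G.flat p).symm (K (X p)).toLinearMap) (W p) = K (X p) (W p)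
  rw [map_smul, h2, LinearMap.smul_apply, smul_eq_mul, ← mul_assoc]
  norm_num

theorem exists_vfield (v : TangentSpace (𝓡 4) p) : ∃ X : VField M, VDiffAt X p ∧ X p = v :=
  ⟨FiberBundle.extend R4 v, FiberBundle.mdifferentiableAt_extend .., by simp⟩

/-- The factor `2` lets `form_lcFun` rewrite both sides without dividing. -/
theorem eq_of_form {x y : TangentSpace (𝓡 4) p}
    (h : ∀ W : VField M, VDiffAt W p → 2 * G.form p x (W p) = 2 * G.form p y (W p)) : x = y := by
  refine sub_eq_zero.1 (G.nondeg p _ fun w => ?_)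
  obtain ⟨W, hW, rfl⟩ := exists_vfield w
  have := h W hW
  rw [map_sub, LinearMap.sub_apply]
  linarith

variable (G) in
/-- The Levi-Civita connection. -/
def lc : CovariantDerivative (𝓡 4) R4 (TangentSpace (𝓡 4) : M → Type) where
  toFun := G.lcFun
  isCovariantDerivativeOnUniv :=
    { add := fun {A A' p} hA hA' _ => by
        ext1 x
        obtain ⟨X, hX, rfl⟩ := exists_vfield x
        refine eq_of_form (G := G) fun W hW => ?_
        rw [form_lcFun (mdifferentiableAt_add_section hA hA') hX hW, koszul_add hA hA' hX hW,
          _root_.add_apply, map_add, LinearMap.add_apply, mul_add,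
          form_lcFun hA hX hW, form_lcFun hA' hX hW]
      leibniz := fun {A f p} hA hf _ => by
        ext1 x
        obtain ⟨X, hX, rfl⟩ := exists_vfield x
        refine eq_of_form (G := G) fun W hW => ?_
        rw [form_lcFun (hf.smul_section hA) hX hW, koszul_smul hf hA hX hW,
          _root_.add_apply, map_add, LinearMap.add_apply, mul_add,
          _root_.smul_apply, map_smul, LinearMap.smul_apply, smul_eq_mul,
          mul_left_comm 2 (f p), form_lcFun hA hX hW, ContinuousLinearMap.smulRight_apply,
          map_smul, LinearMap.smul_apply, smul_eq_mul] }

theorem form_lc {A X W : VField M} (hA : VDiffAt A p) (hX : VDiffAt X p)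
    (hW : VDiffAt W p) : 2 * G.form p (G.lc A p (X p)) (W p) = G.koszul A X W p :=
  form_lcFun hA hX hW

-- Nondegeneracy reduces both properties to pairings with test fields, where they become
-- `koszul_sub` and `koszul_metric`.
variable (G) in
theorem isLeviCivita_lc : IsLeviCivita (fun p x y => G.form p x y) G.lc where
  torsion_free := by
    rw [CovariantDerivative.torsion_eq_zero_iff]
    intro X Y p hX hY
    refine eq_of_form (G := G) fun W hW => ?_
    rw [map_sub, LinearMap.sub_apply, mul_sub, form_lc hY hX hW, form_lc hX hY hW, koszul_sub]
  metric p x A B hA hB := by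
    obtain ⟨X, hX, rfl⟩ := exists_vfield x
    have h1 := form_lc (G := G) hA hX hB
    have h2 := form_lc (G := G) hB hX hA
    have h3 := koszul_metric (G := G) (p := p) (A := A) (X := X) (B := B)
    rw [G.symm p (A p)]
    linarith

end DiffMetric

end LeviCivita

/-! ### Algebra of metric tensors. -/

section Lorentz

variable {W : Type*} [AddCommGroup W] [Module ℝ W]

theorem contr_add (y z : W) (t : Tens W) : contr (y + z) t = contr y t + contr z t := by
  induction t using Tens.induction_left with
  | h1 => simp [contr_one]
  | hadd s t hs ht => simp only [map_add, hs, ht]; abel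
  | hsmul r t ht => simp only [map_smul, ht, smul_add]
  | hmul w t _ => simp only [contr_ι_mul, map_add, add_smul]

theorem contr_smul (r : ℝ) (y : W) (t : Tens W) : contr (r • y) t = r • contr y t := by
  induction t using Tens.induction_left with
  | h1 => simp [contr_one]
  | hadd s t hs ht => simp only [map_add, hs, ht, smul_add]
  | hsmul c t ht => rw [map_smul, map_smul, ht, smul_comm]
  | hmul w t _ => simp only [contr_ι_mul, map_smul, smul_assoc]

/-- The bilinear form of a tensor. -/
def pairingForm (t : Tens W) : W →ₗ[ℝ] W →ₗ[ℝ] ℝ :=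
  LinearMap.mk₂ ℝ (pairing t) (fun y z w => by simp [pairing, contr_add])
    (fun c y w => by simp [pairing, contr_smul]) (fun y z w => by simp [pairing, contr_add])
    (fun c y w => by simp [pairing, contr_smul])

theorem pairingForm_apply (t : Tens W) (y z : W) : pairingForm t y z = pairing t y z := rfl

theorem pairing_smul_left (c : ℝ) (t : Tens W) (y z : W) :
    pairing (c • t) y z = c * pairing t y z := by
  simp [pairing]

/-- The sign `-1` of the first and `1` of the other basis vectors. -/
def lorentzSign (i : Fin 4) : ℝ := if i = 0 then -1 else 1

theorem lorentzSign_ne_zero (i : Fin 4) : lorentzSign i ≠ 0 := by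
  unfold lorentzSign; split_ifs <;> norm_num

/-- The properties of a metric tensor that do not depend on its signature. -/
structure IsMetricTens (t : Tens W) : Prop where
  eps_eq : eps t = 0
  contrCov_eq : ∀ ξ, contrCov ξ t = 0
  exists_cov : ∀ y, ∃ ξ, contr y t = cov ξ
  symm : ∀ y z, pairing t y z = pairing t z y
  nondeg : ∀ y, (∀ z, pairing t y z = 0) → y = 0
  trace : ∀ A : Module.End ℝ W, (∀ y z, pairing t (A y) z + pairing t y (A z) = 0) →
    LinearMap.trace ℝ W A = 0

theorem isLorentz_iff {t : Tens W} : IsLorentz t ↔ ∃ b : Module.Basis (Fin 4) ℝ W,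
    t = ∑ i, lorentzSign i • (cov (b.coord i) * cov (b.coord i)) := by
  refine exists_congr fun b => ?_
  rw [Fin.sum_univ_four]
  simp [lorentzSign]

/-- Only diagonality in some basis with nonzero coefficients matters, not the signs. The factor `c`
covers the passage between elements of one ray. -/
theorem IsLorentz.isMetricTens_smul {t : Tens W} (ht : IsLorentz t) {c : ℝ} (hc : c ≠ 0) :
    IsMetricTens (c • t) := by
  obtain ⟨b, rfl⟩ := isLorentz_iff.1 ht
  have hpair (y z : W) : pairing (c • ∑ i, lorentzSign i • (cov (b.coord i) * cov (b.coord i))) y z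
      = ∑ i, c * lorentzSign i * (b.coord i y * b.coord i z) := by
    rw [pairing_smul_left]
    simp [pairing, contr_cov_mul, mul_assoc, Finset.mul_sum]
  have hbasis (y : W) (i : Fin 4) :
      pairing (c • ∑ i, lorentzSign i • (cov (b.coord i) * cov (b.coord i))) y (b i) =
        c * lorentzSign i * b.coord i y := by
    rw [hpair, Finset.sum_eq_single i (fun j _ hj => by simp [hj.symm])
      (by simp)]
    simp
  have hsymm (y z : W) : pairing (c • ∑ i, lorentzSign i • (cov (b.coord i) * cov (b.coord i))) y z
      = pairing (c • ∑ i, lorentzSign i • (cov (b.coord i) * cov (b.coord i))) z y := by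
    rw [hpair, hpair]
    exact Finset.sum_congr rfl fun i _ => by ring
  have hne (i : Fin 4) : c * lorentzSign i ≠ 0 := mul_ne_zero hc (lorentzSign_ne_zero i)
  refine ⟨by simp, by simp [contrCov_cov_mul], fun y => ?_, hsymm, fun y hy => ?_, fun A hA => ?_⟩
  · exact ⟨c • ∑ i, lorentzSign i • b.coord i y • b.coord i, by simp [contr_cov_mul]⟩
  · refine b.ext_elem fun i => ?_
    have := hy (b i)
    rw [hbasis] at this
    simpa using (mul_eq_zero.1 this).resolve_left (hne i)
  -- The basis is orthogonal and its vectors are not null, so skewness evaluated at `(b i, b i)`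
  -- kills the `i`-th diagonal entry of `A`.
  · rw [LinearMap.trace_eq_matrix_trace ℝ b, Matrix.trace]
    refine Finset.sum_eq_zero fun i _ => ?_
    have := hA (b i) (b i)
    rw [hsymm (b i), hbasis] at this
    rw [Matrix.diag_apply, LinearMap.toMatrix_apply]
    have h2 : c * lorentzSign i * b.coord i (A (b i)) = 0 := by linarith
    exact (mul_eq_zero.1 h2).resolve_left (hne i)

theorem IsMetricTens.contr_contr {t : Tens W} (ht : IsMetricTens t) (y z : W) :
    contr z (contr y t) = algebraMap ℝ (Tens W) (pairing t y z) := by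
  obtain ⟨ξ, hξ⟩ := ht.exists_cov y
  simp [pairing, hξ]

theorem IsMetricTens.contrCov_contr {t : Tens W} (ht : IsMetricTens t) (y : W)
    (η : Module.Dual ℝ W) : contrCov η (contr y t) = 0 := by
  obtain ⟨ξ, hξ⟩ := ht.exists_cov y
  simp [hξ]

theorem IsMetricTens.eps_contr {t : Tens W} (ht : IsMetricTens t) (y : W) :
    eps (contr y t) = 0 := by
  obtain ⟨ξ, hξ⟩ := ht.exists_cov y
  simp [hξ]

/-- By polarization, a symmetric form with only null vectors would vanish, which nondegeneracy
excludes as soon as the space is nonzero. -/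
theorem IsMetricTens.exists_pairing_self_ne_zero {t : Tens W} (ht : IsMetricTens t) {y : W}
    (hy : y ≠ 0) : ∃ z, pairing t z z ≠ 0 := by
  by_contra! h
  refine hy (ht.nondeg y fun z => ?_)
  have h1 := h (y + z)
  simp only [← pairingForm_apply, map_add, LinearMap.add_apply] at h1
  simp only [pairingForm_apply, h y, h z, ht.symm z y] at h1
  linarith

end Lorentz

/-! ### Representatives of the conformal structure. -/

section Conformal
variable {M : Type*} [TopologicalSpace M] [T2Space M] [ChartedSpace R4 M] [IsManifold (𝓡 4) ∞ M]
variable {V : M → Type*} [TopologicalSpace (TotalSpace R4 V)]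
  [∀ p, TopologicalSpace (V p)] [∀ p, AddCommGroup (V p)] [∀ p, Module ℝ (V p)]
  [FiberBundle R4 V] [VectorBundle ℝ R4 V] [ContMDiffVectorBundle ∞ R4 V (𝓡 4)]

theorem ConformalStructure.isMetricTens {H : ConformalStructure V} {h : TF V} (hh : H.IsRep h)
    (p : M) : IsMetricTens (h.1 p) := by
  obtain ⟨U, -, hp, t, -, ht⟩ := H.smooth p
  obtain ⟨hL, hne, hr⟩ := ht p hp
  obtain ⟨hne', hr'⟩ := hh p
  have := (ray_eq_iff hne hne').1 (hr.trans hr'.symm)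
  obtain ⟨r, hr, h2⟩ := (this.exists_pos_left hne hne')
  rw [← h2]
  exact hL.isMetricTens_smul hr.ne'

theorem ConformalStructure.IsRep.exists_smul {H : ConformalStructure V} {h h' : TF V}
    (hh : H.IsRep h) (hh' : H.IsRep h') (p : M) : ∃ c : ℝ, c ≠ 0 ∧ h.1 p = c • h'.1 p := by
  obtain ⟨hne, hr⟩ := hh p
  obtain ⟨hne', hr'⟩ := hh' p
  obtain ⟨r, hr, h2⟩ := ((ray_eq_iff hne' hne).1 (hr'.trans hr.symm)).exists_pos_left hne' hne
  exact ⟨r, hr.ne', h2.symm⟩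

/-- The function `h(Y, Z)`. -/
def metricFun (h : TF V) (Y Z : VecSec V) : Fun M := epsF (contrF Z (contrF Y h))

theorem metricFun_apply (h : TF V) (Y Z : VecSec V) (p : M) :
    metricFun h Y Z p = pairing (h.1 p) (Y p) (Z p) := rfl

/-- Two representatives of a conformal structure differ by a nonvanishing function. -/
theorem ConformalStructure.IsRep.exists_fun {H : ConformalStructure V} {h h' : TF V}
    (hh : H.IsRep h) (hh' : H.IsRep h') :
    ∃ F : Fun M, (∀ p, F p ≠ 0) ∧ h = ofFun V F * h' := by
  choose c hc hcc using hh.exists_smul hh'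
  refine ⟨⟨c, fun p => ?_⟩, hc, TF.ext_apply fun p => ?_⟩
  -- Choose a section `Z` that is not null for `h'` at `p`. Near `p` the conformal factor is the
  -- quotient `h(Z, Z) / h'(Z, Z)` of smooth functions.
  · have hne : fibreBasis V p 0 ≠ 0 := (fibreBasis V p).ne_zero 0
    obtain ⟨z, hz⟩ := (H.isMetricTens hh' p).exists_pairing_self_ne_zero hne
    obtain ⟨Z, rfl⟩ := exists_vecSec_apply_eq p z
    have hz' : metricFun h' Z Z p ≠ 0 := hz
    have h1 : ContMDiffAt (𝓡 4) 𝓘(ℝ, ℝ) ∞ (fun q => metricFun h Z Z q / metricFun h' Z Z q) p :=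
      (metricFun h Z Z).contMDiff.contMDiffAt.div₀ (metricFun h' Z Z).contMDiff.contMDiffAt hz'
    refine h1.congr_of_eventuallyEq ?_
    filter_upwards [(metricFun h' Z Z).contMDiff.continuous.continuousAt.eventually_ne hz']
      with q hq
    rw [metricFun_apply h, hcc, pairing_smul_left, ← metricFun_apply h', mul_div_cancel_right₀ _ hq]
  · exact (hcc p).trans (Algebra.smul_def (c p) (h'.1 p))

end Conformal

/-! ### The anchor and the Lie bracket of vector fields. -/

section Anchor

open VectorField

variable {M : Type*} [TopologicalSpace M] [T2Space M] [ChartedSpace R4 M] [IsManifold (𝓡 4) ∞ M]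
variable {V : M → Type*} [TopologicalSpace (TotalSpace R4 V)]
  [∀ p, TopologicalSpace (V p)] [∀ p, AddCommGroup (V p)] [∀ p, Module ℝ (V p)]
  [FiberBundle R4 V] [VectorBundle ℝ R4 V] [ContMDiffVectorBundle ∞ R4 V (𝓡 4)]

theorem contMDiff_mvfderiv_apply {f : M → ℝ} (hf : ContMDiff (𝓡 4) 𝓘(ℝ, ℝ) ∞ f) {X : VField M}
    (hX : ContMDiff (𝓡 4) ((𝓡 4).prod 𝓘(ℝ, R4)) ∞
      (fun q => (TotalSpace.mk' R4 q (X q) : TotalSpace R4 (TangentSpace (𝓡 4) : M → Type)))) :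
    ContMDiff (𝓡 4) 𝓘(ℝ, ℝ) ∞ (fun q => mvfderiv (𝓡 4) f q (X q)) := by
  have h1 : ContMDiff (𝓡 4).tangent 𝓘(ℝ, ℝ).tangent ∞ (tangentMap (𝓡 4) 𝓘(ℝ, ℝ) f) :=
    hf.contMDiff_tangentMap le_rfl
  have h2 := (contMDiff_snd_tangentBundle_modelSpace ℝ 𝓘(ℝ, ℝ) (n := ∞)).comp (h1.comp hX)
  exact h2

namespace BundleIso

variable (E : BundleIso V)

theorem contMDiff_apply (Y : VecSec V) : ContMDiff (𝓡 4) ((𝓡 4).prod 𝓘(ℝ, R4)) ∞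
    (fun q => (TotalSpace.mk' R4 q (E.toEquiv q (Y q)) :
      TotalSpace R4 (TangentSpace (𝓡 4) : M → Type))) :=
  ContMDiff.clm_bundle_apply (F₁ := R4) (F₂ := R4) (E₁ := V)
    (E₂ := (TangentSpace (𝓡 4) : M → Type)) (IB := 𝓡 4) (b := fun m => m)
    (ϕ := fun p => (E.toEquiv p : V p →L[ℝ] TangentSpace (𝓡 4) p)) (v := Y) E.smooth Y.contMDiff

/-- In trivializations the inverse bundle map is the operator inverse of the original one, and
inversion of operators is smooth at invertible operators. -/
theorem contMDiffAt_symm_apply {A : VField M} {p : M}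
    (hA : ContMDiffAt (𝓡 4) ((𝓡 4).prod 𝓘(ℝ, R4)) ∞
      (fun q => (TotalSpace.mk' R4 q (A q) : TotalSpace R4 (TangentSpace (𝓡 4) : M → Type))) p) :
    ContMDiffAt (𝓡 4) ((𝓡 4).prod 𝓘(ℝ, R4)) ∞
      (fun q => TotalSpace.mk' R4 q ((E.toEquiv q).symm (A q))) p := by
  have h1 := ((contMDiffAt_hom_bundle _).1 (E.smooth p)).2
  have h2 : ContMDiffAt (𝓡 4) 𝓘(ℝ, R4 →L[ℝ] R4) ∞
      (ContinuousLinearMap.inverse ∘ fun q => ContinuousLinearMap.inCoordinates R4 V R4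
        (TangentSpace (𝓡 4) : M → Type) p q p q
        (E.toEquiv q : V q →L[ℝ] TangentSpace (𝓡 4) q)) p := by
    refine ContMDiffAt.comp p (ContDiffAt.contMDiffAt ?_) h1
    apply ContinuousLinearMap.IsInvertible.contDiffAt_map_inverse
    rw [ContinuousLinearMap.inCoordinates_eq (FiberBundle.mem_baseSet_trivializationAt' p)
      (FiberBundle.mem_baseSet_trivializationAt' p)]
    exact ContinuousLinearMap.isInvertible_equiv.comp
      (ContinuousLinearMap.isInvertible_equiv.comp ContinuousLinearMap.isInvertible_equiv)
  refine ContMDiffAt.clm_apply_of_inCoordinates (F₁ := R4) (F₂ := R4)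
    (E₁ := (TangentSpace (𝓡 4) : M → Type)) (E₂ := V) (b₁ := fun m => m) (b₂ := fun m => m)
    (ϕ := fun q => ((E.toEquiv q).symm : TangentSpace (𝓡 4) q →L[ℝ] V q)) (v := A)
    (h2.congr_of_eventuallyEq ?_) hA contMDiffAt_id
  filter_upwards [(trivializationAt R4 V p).open_baseSet.mem_nhds
      (FiberBundle.mem_baseSet_trivializationAt' p),
    (trivializationAt R4 (TangentSpace (𝓡 4) : M → Type) p).open_baseSet.mem_nhds
      (FiberBundle.mem_baseSet_trivializationAt' p)] with q hq hq'
  rw [Function.comp_apply, ContinuousLinearMap.inCoordinates_eq hq hq',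
    ContinuousLinearMap.inCoordinates_eq hq' hq]
  simp only [ContinuousLinearMap.inverse_equiv_comp, ContinuousLinearMap.inverse_comp_equiv,
    ContinuousLinearEquiv.symm_symm, ContinuousLinearMap.inverse_equiv]
  rfl

/-- The derivative of functions along a section of `V`. -/
def anchor (Y : VecSec V) : Derivation ℝ (Fun M) (Fun M) :=
  Derivation.mk'
    { toFun := fun f => ⟨fun p => mvfderiv (𝓡 4) f p (E.toEquiv p (Y p)),
        contMDiff_mvfderiv_apply f.contMDiff (E.contMDiff_apply Y)⟩
      map_add' := fun f g => by
        ext p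
        have := mvfderiv_add (f.contMDiff.mdifferentiable (by simp) p)
          (g.contMDiff.mdifferentiable (by simp) p)
        exact congrArg (fun L => L (E.toEquiv p (Y p))) this
      map_smul' := fun r f => by
        ext p
        have := mvfderiv_smul (mdifferentiableAt_const (c := r) (I := 𝓡 4) (x := p))
          (f.contMDiff.mdifferentiable (by simp) p)
        refine (congrArg (fun L => L (E.toEquiv p (Y p))) this).trans ?_
        simp [mvfderiv_const]
        rfl }
    fun f g => by
      ext p
      have := mvfderiv_mul (f.contMDiff.mdifferentiable (by simp) p)
        (g.contMDiff.mdifferentiable (by simp) p)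
      refine (congrArg (fun L => L (E.toEquiv p (Y p))) this).trans ?_
      rfl

theorem anchor_apply (Y : VecSec V) (f : Fun M) (p : M) :
    E.anchor Y f p = mvfderiv (𝓡 4) f p (E.toEquiv p (Y p)) := rfl

end BundleIso

theorem isManifold_minSmoothness_two : IsManifold (𝓡 4) (minSmoothness ℝ 2) M := by
  rw [minSmoothness_of_isRCLikeNormedField]
  exact IsManifold.of_le (n := ∞) (WithTop.coe_le_coe.2 le_top)

theorem isManifold_minSmoothness_three : IsManifold (𝓡 4) (minSmoothness ℝ 3) M := by
  rw [minSmoothness_of_isRCLikeNormedField]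
  exact IsManifold.of_le (n := ∞) (WithTop.coe_le_coe.2 le_top)

theorem contMDiff_mlieBracket {X Y : VField M}
    (hX : ContMDiff (𝓡 4) ((𝓡 4).prod 𝓘(ℝ, R4)) ∞
      (fun q => (TotalSpace.mk' R4 q (X q) : TotalSpace R4 (TangentSpace (𝓡 4) : M → Type))))
    (hY : ContMDiff (𝓡 4) ((𝓡 4).prod 𝓘(ℝ, R4)) ∞
      (fun q => (TotalSpace.mk' R4 q (Y q) : TotalSpace R4 (TangentSpace (𝓡 4) : M → Type)))) :
    ContMDiff (𝓡 4) ((𝓡 4).prod 𝓘(ℝ, R4)) ∞ (fun q =>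
      (TotalSpace.mk' R4 q (mlieBracket (𝓡 4) X Y q) :
        TotalSpace R4 (TangentSpace (𝓡 4) : M → Type))) := by
  have := isManifold_minSmoothness_two (M := M)
  have := isManifold_minSmoothness_three (M := M)
  have : IsManifold (𝓡 4) (((⊤ : ℕ∞) : ℕ∞ω) + 1) M := by
    -- The bracket costs one derivative, which is harmless in the smooth category.
    rw [show (((⊤ : ℕ∞) : ℕ∞ω) + 1) = ∞ from rfl]
    infer_instance
  exact ContDiff.mlieBracket_vectorField (m := ⊤) (n := ⊤) hX hY (by simp)

/-- The Lie bracket acts on functions as the commutator. -/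
theorem mvfderiv_mlieBracket {f : M → ℝ} (hf : ContMDiff (𝓡 4) 𝓘(ℝ, ℝ) ∞ f) {X Y : VField M}
    (hX : ContMDiff (𝓡 4) ((𝓡 4).prod 𝓘(ℝ, R4)) ∞
      (fun q => (TotalSpace.mk' R4 q (X q) : TotalSpace R4 (TangentSpace (𝓡 4) : M → Type))))
    (hY : ContMDiff (𝓡 4) ((𝓡 4).prod 𝓘(ℝ, R4)) ∞
      (fun q => (TotalSpace.mk' R4 q (Y q) : TotalSpace R4 (TangentSpace (𝓡 4) : M → Type))))
    {W : VField M} (hW : ContMDiff (𝓡 4) ((𝓡 4).prod 𝓘(ℝ, R4)) ∞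
      (fun q => (TotalSpace.mk' R4 q (W q) : TotalSpace R4 (TangentSpace (𝓡 4) : M → Type))))
    {p : M} (hp : W p ≠ 0) :
    mvfderiv (𝓡 4) f p (mlieBracket (𝓡 4) X Y p) =
      mvfderiv (𝓡 4) (fun q => mvfderiv (𝓡 4) f q (Y q)) p (X p)
        - mvfderiv (𝓡 4) (fun q => mvfderiv (𝓡 4) f q (X q)) p (Y p) := by
  have := isManifold_minSmoothness_three (M := M)
  have hfd := hf.mdifferentiable (by simp)
  have hYf := (contMDiff_mvfderiv_apply hf hY).mdifferentiable (by simp)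
  have hXf := (contMDiff_mvfderiv_apply hf hX).mdifferentiable (by simp)
  have hWd : ∀ q, VDiffAt W q := hW.mdifferentiable (by simp)
  have hbr {A B : VField M}
      (hA : ContMDiff (𝓡 4) ((𝓡 4).prod 𝓘(ℝ, R4)) ∞
        (fun q => (TotalSpace.mk' R4 q (A q) : TotalSpace R4 (TangentSpace (𝓡 4) : M → Type))))
      (hB : ContMDiff (𝓡 4) ((𝓡 4).prod 𝓘(ℝ, R4)) ∞
        (fun q => (TotalSpace.mk' R4 q (B q) : TotalSpace R4 (TangentSpace (𝓡 4) : M → Type)))) :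
      ∀ q, VDiffAt (mlieBracket (𝓡 4) A B) q :=
    (contMDiff_mlieBracket hA hB).mdifferentiable (by simp)
  have h2le : minSmoothness ℝ 2 ≤ ∞ := by
    rw [minSmoothness_of_isRCLikeNormedField]
    exact WithTop.coe_le_coe.2 le_top
  have hfW := hf.smul_section hW
  -- Subtract `f` times the Jacobi identity for `X, Y, W` from the one for `X, Y, f W`. The
  -- first-order terms in `f` cancel, and what remains is a multiple of `W p` whose coefficient is
  -- the claimed identity; `W p ≠ 0` allows it to be read off.
  have key := leibniz_identity_mlieBracket_apply (I := 𝓡 4) (U := X) (V := Y) (W := f • W) (x := p)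
    ((hX p).of_le h2le) ((hY p).of_le h2le) ((hfW p).of_le h2le)
  have key2 := leibniz_identity_mlieBracket_apply (I := 𝓡 4) (U := X) (V := Y) (W := W) (x := p)
    ((hX p).of_le h2le) ((hY p).of_le h2le) ((hW p).of_le h2le)
  have e1 (A : VField M) : mlieBracket (𝓡 4) A (f • W) =
      (fun q => mvfderiv (𝓡 4) f q (A q)) • W + f • mlieBracket (𝓡 4) A W :=
    funext fun q => mlieBracket_smul_right (hfd q) (hWd q)
  have e2 {A B : VField M} (hA : MDifferentiable (𝓡 4) 𝓘(ℝ, ℝ) fun q => mvfderiv (𝓡 4) f q (A q))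
      (hAW : ∀ q, VDiffAt (mlieBracket (𝓡 4) A W) q) :
      mlieBracket (𝓡 4) B (mlieBracket (𝓡 4) A (f • W)) p =
      mvfderiv (𝓡 4) (fun q => mvfderiv (𝓡 4) f q (A q)) p (B p) • W p
      + mvfderiv (𝓡 4) f p (A p) • mlieBracket (𝓡 4) B W p
      + (mvfderiv (𝓡 4) f p (B p) • mlieBracket (𝓡 4) A W p
      + f p • mlieBracket (𝓡 4) B (mlieBracket (𝓡 4) A W) p) := by
    rw [e1, mlieBracket_add_right ((hA p).smul_section (hWd p)) ((hfd p).smul_section (hAW p)),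
      mlieBracket_smul_right (hA p) (hWd p), mlieBracket_smul_right (hfd p) (hAW p)]
  rw [e2 hYf (hbr hY hW), e2 hXf (hbr hX hW), e1, key2] at key
  simp only [Pi.add_apply, Pi.smul_apply'] at key
  refine smul_left_injective ℝ hp ?_
  simp only [sub_smul]
  rw [← sub_eq_zero] at key ⊢
  rw [← neg_eq_zero, ← key]
  module

end Anchor

/-! ### Function-linear maps on sections. -/

section Tensoriality

variable {M : Type*} [TopologicalSpace M] [T2Space M] [ChartedSpace R4 M] [IsManifold (𝓡 4) ∞ M]
variable {V : M → Type*} [TopologicalSpace (TotalSpace R4 V)]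
  [∀ p, TopologicalSpace (V p)] [∀ p, AddCommGroup (V p)] [∀ p, Module ℝ (V p)]
  [FiberBundle R4 V] [VectorBundle ℝ R4 V] [ContMDiffVectorBundle ∞ R4 V (𝓡 4)]

theorem contMDiffSection_sum_apply {ι : Type*} {F : Type*} [NormedAddCommGroup F]
    [NormedSpace ℝ F] {X : M → Type*}
    [TopologicalSpace (TotalSpace F X)] [∀ p, TopologicalSpace (X p)] [∀ p, AddCommGroup (X p)]
    [∀ p, Module ℝ (X p)] [FiberBundle F X] [VectorBundle ℝ F X]
    (s : Finset ι) (Z : ι → ContMDiffSection (𝓡 4) F ∞ X) (p : M) :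
    (∑ i ∈ s, Z i) p = ∑ i ∈ s, Z i p := by
  have := congrFun (map_sum (ContMDiffSection.coeAddHom (𝓡 4) F ∞ X) Z s) p
  rwa [Finset.sum_apply] at this

theorem pair_fsmul (ξ : CovSec V) (f : Fun M) (Z : VecSec V) :
    pair ξ (fsmul f Z) = f * pair ξ Z := by
  ext p
  exact map_smul (ξ p) (f p) (Z p)

theorem pair_add (ξ : CovSec V) (Y Z : VecSec V) : pair ξ (Y + Z) = pair ξ Y + pair ξ Z := by
  ext p
  exact map_add (ξ p) (Y p) (Z p)

/-- A sum of a frame multiplied by the values of the dual frame. -/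
theorem FrameAt.eventually_sum {p : M} (Fr : FrameAt V p) :
    ∀ᶠ q in 𝓝 p, ∀ v : V q, v = ∑ a, Fr.covs a q v • Fr.vecs a q := by
  filter_upwards [Fr.exists_basis] with q ⟨b, hb, hb'⟩ v
  conv_lhs => rw [← b.sum_repr v]
  refine Finset.sum_congr rfl fun a _ => ?_
  rw [hb]
  exact congrArg (· • _) (LinearMap.congr_fun (hb' a) v)

/-- An additive map on sections which is linear over functions at a point is given by its values
on a frame. -/
theorem FrameAt.tensorial {A : Type*} [AddCommGroup A] [Module ℝ A] {p : M} (Fr : FrameAt V p)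
    {ψ : VecSec V → A} (hadd : ∀ Y Z, ψ (Y + Z) = ψ Y + ψ Z)
    (hsmul : ∀ f Y, ψ (fsmul f Y) = f p • ψ Y) (Y : VecSec V) :
    ψ Y = ∑ a, Fr.covs a p (Y p) • ψ (Fr.vecs a) := by
  obtain ⟨U, hU, hUo, hpU⟩ := eventually_nhds_iff.1 Fr.eventually_sum
  obtain ⟨ρ, hρ, hρU⟩ := exists_bump hUo hpU
  -- The frame expansion of `Y` is valid only near `p`; multiplied by `ρ` it becomes a global
  -- identity, and nothing is lost because `ρ p = 1`.
  have h1 : fsmul ρ Y = ∑ a, fsmul (ρ * pair (Fr.covs a) Y) (Fr.vecs a) := by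
    ext q
    rw [contMDiffSection_sum_apply]
    change ρ q • Y q = ∑ a, (ρ q * Fr.covs a q (Y q)) • Fr.vecs a q
    simp only [mul_smul, ← Finset.smul_sum]
    by_cases hq : q ∈ U
    · rw [← hU q hq (Y q)]
    · rw [image_eq_zero_of_notMem_tsupport fun h => hq (hρU h), zero_smul, zero_smul]
  have h2 : ψ (fsmul ρ Y) = ψ Y := by rw [hsmul, hρ.self_of_nhds, one_smul]
  rw [← h2, h1]
  have h3 : ψ (∑ a, fsmul (ρ * pair (Fr.covs a) Y) (Fr.vecs a)) =
      ∑ a, ψ (fsmul (ρ * pair (Fr.covs a) Y) (Fr.vecs a)) := map_sum (AddMonoidHom.mk' ψ hadd) _ _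
  rw [h3]
  refine Finset.sum_congr rfl fun a _ => ?_
  rw [hsmul]
  change (ρ p * Fr.covs a p (Y p)) • _ = _
  rw [hρ.self_of_nhds, one_mul]

theorem tensorial_congr {A : Type*} [AddCommGroup A] [Module ℝ A] {p : M}
    {ψ : VecSec V → A} (hadd : ∀ Y Z, ψ (Y + Z) = ψ Y + ψ Z)
    (hsmul : ∀ f Y, ψ (fsmul f Y) = f p • ψ Y) {Y Z : VecSec V} (h : Y p = Z p) : ψ Y = ψ Z := by
  obtain ⟨Fr⟩ := nonempty_frameAt (V := V) p
  rw [Fr.tensorial hadd hsmul Y, Fr.tensorial hadd hsmul Z, h]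

/-- A function-linear map from the sections of `V` to the functions is a section of `V*`. -/
theorem exists_covSec_pair {L : VecSec V → Fun M} (hadd : ∀ Y Z, L (Y + Z) = L Y + L Z)
    (hsmul : ∀ f Y, L (fsmul f Y) = f * L Y) : ∃ ξ : CovSec V, ∀ Z, pair ξ Z = L Z := by
  have hadd' (p : M) (Y Z) : L (Y + Z) p = L Y p + L Z p := by rw [hadd]; rfl
  have hsmul' (p : M) (f Y) : L (fsmul f Y) p = f p • L Y p := by rw [hsmul]; rfl
  let Fr (p : M) : FrameAt V p := (nonempty_frameAt p).some
  let ξ (p : M) : V p →L[ℝ] ℝ := ∑ a, L ((Fr p).vecs a) p • (Fr p).covs a p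
  have hξ (p : M) (Z : VecSec V) : ξ p (Z p) = L Z p := by
    rw [(Fr p).tensorial (ψ := fun Z => L Z p) (hadd' p) (hsmul' p) Z]
    simp [ξ, mul_comm]
  refine ⟨⟨ξ, fun p => ?_⟩, fun Z => by ext p; exact hξ p Z⟩
  have h1 : ContMDiffAt (𝓡 4) ((𝓡 4).prod 𝓘(ℝ, R4 →L[ℝ] ℝ)) ∞ (fun q => TotalSpace.mk'
      (R4 →L[ℝ] ℝ) q (∑ a, L ((Fr p).vecs a) q • (Fr p).covs a q)) p :=
    ContMDiffAt.sum_section fun a _ =>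
      (L ((Fr p).vecs a)).contMDiff.contMDiffAt.smul_section ((Fr p).covs a).contMDiff.contMDiffAt
  refine h1.congr_of_eventuallyEq ?_
  filter_upwards [(Fr p).eventually_sum] with q hq
  refine congrArg (TotalSpace.mk' (R4 →L[ℝ] ℝ) q) ?_
  ext v
  conv_lhs => rw [hq v]
  simp only [map_sum, map_smul, hξ]
  simp [mul_comm]

theorem contMDiffAt_of_coeff {p : M} (Fr : FrameAt V p) {Z : ∀ q, V q}
    (h : ∀ a, ContMDiffAt (𝓡 4) 𝓘(ℝ, ℝ) ∞ (fun q => Fr.covs a q (Z q)) p) :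
    ContMDiffAt (𝓡 4) ((𝓡 4).prod 𝓘(ℝ, R4)) ∞ (fun q => TotalSpace.mk' R4 q (Z q)) p := by
  have h1 : ContMDiffAt (𝓡 4) ((𝓡 4).prod 𝓘(ℝ, R4)) ∞ (fun q => TotalSpace.mk'
      R4 q (∑ a, Fr.covs a q (Z q) • Fr.vecs a q)) p :=
    ContMDiffAt.sum_section fun a _ => (h a).smul_section (Fr.vecs a).contMDiff.contMDiffAt
  refine h1.congr_of_eventuallyEq ?_
  filter_upwards [Fr.eventually_sum] with q hq
  exact congrArg (TotalSpace.mk' R4 q) (hq _)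

/-- A section of `V` is smooth if its products with smooth sections are smooth. -/
theorem contMDiff_of_pairing {h : TF V} (hm : ∀ p, IsMetricTens (h.1 p)) {Z : ∀ q, V q}
    (hZ : ∀ W : VecSec V, ContMDiff (𝓡 4) 𝓘(ℝ, ℝ) ∞ (fun q => pairing (h.1 q) (Z q) (W q))) :
    ContMDiff (𝓡 4) ((𝓡 4).prod 𝓘(ℝ, R4)) ∞ (fun q => TotalSpace.mk' R4 q (Z q)) := by
  intro p
  obtain ⟨Fr⟩ := nonempty_frameAt (V := V) p
  -- The `B a b` are matrix units, so `G` is the Gram matrix of the metric in the frame. It is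
  -- invertible near `p`, and its smooth inverse recovers the coordinates of `Z` from the smooth
  -- products with the frame.
  let B (a b : Fin 4) : (Fin 4 → ℝ) →L[ℝ] (Fin 4 → ℝ) :=
    (ContinuousLinearMap.proj (R := ℝ) (φ := fun _ : Fin 4 => ℝ) a).smulRight (Pi.single b 1)
  let G (q : M) : (Fin 4 → ℝ) →L[ℝ] (Fin 4 → ℝ) :=
    ∑ a, ∑ b, metricFun h (Fr.vecs a) (Fr.vecs b) q • B a b
  have hG : ContMDiff (𝓡 4) 𝓘(ℝ, (Fin 4 → ℝ) →L[ℝ] (Fin 4 → ℝ)) ∞ G :=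
    contMDiff_finsetSum fun a _ => contMDiff_finsetSum fun b _ =>
      (metricFun h (Fr.vecs a) (Fr.vecs b)).contMDiff.smul contMDiff_const
  have hGa (q : M) (c : Fin 4 → ℝ) (b : Fin 4) :
      G q c b = pairing (h.1 q) (∑ a, c a • Fr.vecs a q) (Fr.vecs b q) := by
    rw [← pairingForm_apply, map_sum, LinearMap.sum_apply]
    simp [G, B, metricFun_apply, Pi.single_apply, pairingForm_apply, mul_comm]
  have hinv : ∀ᶠ q in 𝓝 p, ∃ e : (Fin 4 → ℝ) ≃L[ℝ] (Fin 4 → ℝ),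
      (e : (Fin 4 → ℝ) →L[ℝ] (Fin 4 → ℝ)) = G q := by
    filter_upwards [Fr.exists_basis] with q ⟨b, hb, hb'⟩
    have hinj : Function.Injective (G q).toLinearMap := by
      rw [injective_iff_map_eq_zero]
      intro c hc
      have h0 : ∑ a, c a • Fr.vecs a q = 0 := by
        refine (hm q).nondeg _ fun z => ?_
        rw [← b.sum_repr z, ← pairingForm_apply, map_sum]
        refine Finset.sum_eq_zero fun i _ => ?_
        rw [map_smul, pairingForm_apply, hb, ← hGa]
        exact (congrArg _ (congrFun hc i)).trans (smul_zero _)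
      simp only [← hb] at h0
      exact funext fun a => (Fintype.linearIndependent_iff.1 b.linearIndependent c h0 a)
    exact ⟨(LinearEquiv.ofInjectiveEndo _ hinj).toContinuousLinearEquiv, by ext1 x; rfl⟩
  have hs : ContMDiffAt (𝓡 4) 𝓘(ℝ, Fin 4 → ℝ) ∞
      (fun q b => pairing (h.1 q) (Z q) (Fr.vecs b q)) p :=
    contMDiffAt_pi_space.2 fun b => hZ (Fr.vecs b) p
  have hGi : ContMDiffAt (𝓡 4) 𝓘(ℝ, (Fin 4 → ℝ) →L[ℝ] (Fin 4 → ℝ)) ∞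
      (ContinuousLinearMap.inverse ∘ G) p := by
    refine ContMDiffAt.comp p (ContDiffAt.contMDiffAt ?_) (hG p)
    obtain ⟨e, he⟩ := hinv.self_of_nhds
    exact ContinuousLinearMap.IsInvertible.contDiffAt_map_inverse ⟨e, he⟩
  have hc := contMDiffAt_pi_space.1 (hGi.clm_apply hs)
  refine contMDiffAt_of_coeff Fr fun a => (hc a).congr_of_eventuallyEq ?_
  filter_upwards [hinv, Fr.eventually_sum] with q ⟨e, he⟩ hq
  have h1 : (fun b => pairing (h.1 q) (Z q) (Fr.vecs b q)) = e fun a => Fr.covs a q (Z q) := by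
    funext b
    have : e (fun a => Fr.covs a q (Z q)) = G q fun a => Fr.covs a q (Z q) := by rw [← he]; rfl
    rw [this, hGa, ← hq]
  rw [h1, Function.comp_apply, ← he, ContinuousLinearMap.inverse_equiv]
  simp

end Tensoriality

/-! ### The Levi-Civita connection transported to `V`. -/

section LeviCivitaData

open VectorField

variable {M : Type*} [TopologicalSpace M] [T2Space M] [ChartedSpace R4 M] [IsManifold (𝓡 4) ∞ M]
variable {V : M → Type*} [TopologicalSpace (TotalSpace R4 V)]
  [∀ p, TopologicalSpace (V p)] [∀ p, AddCommGroup (V p)] [∀ p, Module ℝ (V p)]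
  [FiberBundle R4 V] [VectorBundle ℝ R4 V] [ContMDiffVectorBundle ∞ R4 V (𝓡 4)]

theorem vdiffAt_of_contMDiff {X : VField M} (hX : ContMDiff (𝓡 4) ((𝓡 4).prod 𝓘(ℝ, R4)) ∞
    (fun q => (TotalSpace.mk' R4 q (X q) : TotalSpace R4 (TangentSpace (𝓡 4) : M → Type)))) (p : M) :
    VDiffAt X p :=
  hX.mdifferentiable (by simp) p

/-- `IsLeviCivita` tests fields that are merely differentiable at one point, so smoothness of
`metricFun` on sections of `V` is not enough. The fields are expanded in a local frame of `TM`, and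
the metric coefficients of that frame are smooth. -/
theorem mdifferentiableAt_pushMetric (E : BundleIso V) (h : TF V) {p : M} {X Y : VField M}
    (hX : VDiffAt X p) (hY : VDiffAt Y p) :
    MDifferentiableAt (𝓡 4) 𝓘(ℝ, ℝ) (fun q => E.pushMetric h q (X q) (Y q)) p := by
  let e := trivializationAt R4 (TangentSpace (𝓡 4) : M → Type) p
  let b := (EuclideanSpace.basisFun (Fin 4) ℝ).toBasis
  have hp : p ∈ e.baseSet := mem_baseSet_trivializationAt R4 _ p
  have hsec (a : Fin 4) : ∃ A : VecSec V, ∀ᶠ q in 𝓝 p,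
      A q = (E.toEquiv q).symm (e.localFrame b a q) :=
    exists_section_eq e.open_baseSet hp fun q hq => (E.contMDiffAt_symm_apply
      ((e.contMDiffOn_localFrame_baseSet (I := 𝓡 4) ∞ b a).contMDiffAt
        (e.open_baseSet.mem_nhds hq))).contMDiffWithinAt
  choose A hA using hsec
  have hcoef {X : VField M} (hX : VDiffAt X p) (a : Fin 4) :
      MDifferentiableAt (𝓡 4) 𝓘(ℝ, ℝ) (fun q => e.localFrameCoeff (𝓡 4) b a q (X q)) p :=
    mdifferentiableAt_localFrameCoeff (e := e) b hp hX a
  have key : MDifferentiableAt (𝓡 4) 𝓘(ℝ, ℝ) (fun q => ∑ a, ∑ c,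
      e.localFrameCoeff (𝓡 4) b a q (X q) * e.localFrameCoeff (𝓡 4) b c q (Y q) *
        metricFun h (A a) (A c) q) p := by
    have hsum {f : Fin 4 → M → ℝ} (hf : ∀ a, MDifferentiableAt (𝓡 4) 𝓘(ℝ, ℝ) (f a) p) :
        MDifferentiableAt (𝓡 4) 𝓘(ℝ, ℝ) (fun q => ∑ a, f a q) p := by
      have := MDifferentiableAt.sum (t := Finset.univ) (f := f) fun a _ => hf a
      rwa [Finset.sum_fn] at this
    exact hsum fun a => hsum fun c => ((hcoef hX a).mul (hcoef hY c)).mul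
      ((metricFun h (A a) (A c)).contMDiff.mdifferentiable (by simp) p)
  refine key.congr_of_eventuallyEq ?_
  filter_upwards [Filter.eventually_all.2 hA, e.open_baseSet.mem_nhds hp] with q hq hqe
  have hX' := Trivialization.eq_sum_localFrameCoeff_smul (I := 𝓡 4) (b := b) (s := X) hqe
  have hY' := Trivialization.eq_sum_localFrameCoeff_smul (I := 𝓡 4) (b := b) (s := Y) hqe
  conv_lhs => rw [hX', hY']
  simp only [BundleIso.pushMetric, map_sum, map_smul, ← hq, ← pairingForm_apply,
    LinearMap.sum_apply, LinearMap.smul_apply, smul_eq_mul, metricFun_apply]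
  rw [Finset.sum_comm]
  simp only [mul_assoc, Finset.mul_sum]
  exact Finset.sum_congr rfl fun c _ => Finset.sum_congr rfl fun a _ => mul_left_comm _ _ _

namespace BundleIso

variable (E : BundleIso V) {h : TF V} (hm : ∀ p, IsMetricTens (h.1 p))

/-- The metric on the manifold given by a metric on `V`. -/
def diffMetric : DiffMetric M where
  form p := (pairingForm (h.1 p)).compl₁₂ (E.toEquiv p).symm.toLinearEquiv.toLinearMap
    (E.toEquiv p).symm.toLinearEquiv.toLinearMap
  symm p x y := (hm p).symm _ _
  nondeg p x hx := by
    have := (hm p).nondeg ((E.toEquiv p).symm x) fun z => by simpa using! hx (E.toEquiv p z)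
    simpa using this
  diff p X Y hX hY := mdifferentiableAt_pushMetric E h hX hY

theorem diffMetric_form (p : M) (x y : TangentSpace (𝓡 4) p) :
    (E.diffMetric hm).form p x y = E.pushMetric h p x y := rfl

/-- The vector field given by a section of `V`. -/
def push (Y : VecSec V) : VField M := fun q => E.toEquiv q (Y q)

theorem vdiffAt_push (Y : VecSec V) (p : M) : VDiffAt (E.push Y) p :=
  vdiffAt_of_contMDiff (E.contMDiff_apply Y) p

theorem form_push (Y Z : VecSec V) :
    (fun q => (E.diffMetric hm).form q (E.push Y q) (E.push Z q)) = metricFun h Y Z := by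
  funext q
  simp [diffMetric_form, pushMetric, push, metricFun_apply]

/-- The Lie bracket transported to `V`. -/
def lie (Y Z : VecSec V) : VecSec V :=
  ⟨fun q => (E.toEquiv q).symm (mlieBracket (𝓡 4) (E.push Y) (E.push Z) q), fun q =>
    E.contMDiffAt_symm_apply (contMDiff_mlieBracket (E.contMDiff_apply Y) (E.contMDiff_apply Z) q)⟩

theorem push_lie (Y Z : VecSec V) : E.push (E.lie Y Z) = mlieBracket (𝓡 4) (E.push Y) (E.push Z) :=
  funext fun q => (E.toEquiv q).apply_symm_apply _

theorem anchor_lie (Y Z : VecSec V) (f : Fun M) :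
    E.anchor (E.lie Y Z) f = E.anchor Y (E.anchor Z f) - E.anchor Z (E.anchor Y f) := by
  ext p
  -- Any field that does not vanish at `p` serves as the test field in `mvfderiv_mlieBracket`.
  obtain ⟨W, hW⟩ := exists_vecSec_apply_eq p (fibreBasis V p 0)
  have hne : E.push W p ≠ 0 := by
    simpa [push, hW] using (fibreBasis V p).ne_zero 0
  have := mvfderiv_mlieBracket f.contMDiff (E.contMDiff_apply Y) (E.contMDiff_apply Z)
    (E.contMDiff_apply W) hne
  have h2 : E.anchor (E.lie Y Z) f p = mvfderiv (𝓡 4) f p (E.push (E.lie Y Z) p) := rfl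
  rw [h2, push_lie]
  exact this

/-- The Koszul expression on sections of `V`. -/
def koszulFun (h : TF V) (Z Y W : VecSec V) : Fun M :=
  E.anchor Y (metricFun h Z W) + E.anchor Z (metricFun h Y W) - E.anchor W (metricFun h Y Z)
    + metricFun h (E.lie Y Z) W - metricFun h (E.lie Y W) Z - metricFun h (E.lie Z W) Y

theorem koszul_push (Z Y W : VecSec V) (p : M) :
    (E.diffMetric hm).koszul (E.push Z) (E.push Y) (E.push W) p = E.koszulFun h Z Y W p := by
  have hf (A B : VecSec V) : (E.diffMetric hm).form p (E.push A p) (E.push B p) =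
      metricFun h A B p := congrFun (E.form_push hm A B) p
  rw [DiffMetric.koszul, form_push, form_push, form_push, ← push_lie, ← push_lie, ← push_lie,
    hf, hf, hf]
  rfl

/-- The Levi-Civita connection transported to `V`. -/
def lcV (Y Z : VecSec V) : VecSec V :=
  ⟨fun p => (E.toEquiv p).symm ((E.diffMetric hm).lc (E.push Z) p (E.push Y p)),
    -- `lc` is built pointwise, so smoothness comes from the Koszul formula: the product with a
    -- section `W` is half of the smooth function `koszulFun`.
    contMDiff_of_pairing hm fun W => by
      have h1 : (fun q => pairing (h.1 q) ((E.toEquiv q).symm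
          ((E.diffMetric hm).lc (E.push Z) q (E.push Y q))) (W q)) =
          ((1 / 2 : ℝ) • E.koszulFun h Z Y W : Fun M) := by
        funext q
        have := DiffMetric.form_lc (G := E.diffMetric hm) (E.vdiffAt_push Z q)
          (E.vdiffAt_push Y q) (E.vdiffAt_push W q)
        rw [koszul_push, diffMetric_form, pushMetric] at this
        simp only [push, ContinuousLinearEquiv.symm_apply_apply] at this
        change _ = (1 / 2 : ℝ) * E.koszulFun h Z Y W q
        rw [← this]
        simp only [push]
        ring
      rw [h1]
      exact ContMDiffMap.contMDiff _⟩

theorem push_lcV (Y Z : VecSec V) (p : M) :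
    E.push (E.lcV hm Y Z) p = (E.diffMetric hm).lc (E.push Z) p (E.push Y p) :=
  (E.toEquiv p).apply_symm_apply _

theorem lcV_sub (Y Z : VecSec V) : E.lcV hm Y Z - E.lcV hm Z Y = E.lie Y Z := by
  ext p
  have h1 := (E.diffMetric hm).isLeviCivita_lc.torsion_free
  rw [CovariantDerivative.torsion_eq_zero_iff] at h1
  have h2 := h1 (E.vdiffAt_push Y p) (E.vdiffAt_push Z p)
  apply (E.toEquiv p).injective
  rw [← push_lcV, ← push_lcV, ← push_lie] at h2
  refine Eq.trans ?_ h2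
  exact map_sub (E.toEquiv p) _ _

theorem anchor_metricFun (X Y Z : VecSec V) : E.anchor X (metricFun h Y Z) =
    metricFun h (E.lcV hm X Y) Z + metricFun h Y (E.lcV hm X Z) := by
  ext p
  have h1 := (E.diffMetric hm).isLeviCivita_lc.metric p (E.push X p) (E.push Y) (E.push Z)
    (E.vdiffAt_push Y p) (E.vdiffAt_push Z p)
  rw [form_push, ← push_lcV, ← push_lcV] at h1
  have hf (A B : VecSec V) : (E.diffMetric hm).form p (E.push A p) (E.push B p) =
      metricFun h A B p := congrFun (E.form_push hm A B) p
  rw [hf, hf] at h1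
  exact h1

theorem lcV_add_left (X Y Z : VecSec V) : E.lcV hm (X + Y) Z = E.lcV hm X Z + E.lcV hm Y Z := by
  ext p
  apply (E.toEquiv p).injective
  have h1 : E.push (X + Y) p = E.push X p + E.push Y p := map_add (E.toEquiv p) _ _
  have h2 : E.push (E.lcV hm X Z + E.lcV hm Y Z) p =
    E.push (E.lcV hm X Z) p + E.push (E.lcV hm Y Z) p := map_add (E.toEquiv p) _ _
  change E.push _ p = E.push _ p
  rw [h2, push_lcV, push_lcV, push_lcV, h1, map_add]

theorem lcV_fsmul_left (f : Fun M) (Y Z : VecSec V) :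
    E.lcV hm (fsmul f Y) Z = fsmul f (E.lcV hm Y Z) := by
  ext p
  apply (E.toEquiv p).injective
  have h1 : E.push (fsmul f Y) p = f p • E.push Y p := map_smul (E.toEquiv p) _ _
  have h2 : E.push (fsmul f (E.lcV hm Y Z)) p = f p • E.push (E.lcV hm Y Z) p :=
    map_smul (E.toEquiv p) _ _
  change E.push _ p = E.push _ p
  rw [h2, push_lcV, push_lcV, h1, map_smul]

theorem lcV_add_right (Y Z W : VecSec V) :
    E.lcV hm Y (Z + W) = E.lcV hm Y Z + E.lcV hm Y W := by
  ext p
  apply (E.toEquiv p).injective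
  have h1 : E.push (Z + W) = E.push Z + E.push W := funext fun q => map_add (E.toEquiv q) _ _
  have h2 : E.push (E.lcV hm Y Z + E.lcV hm Y W) p =
    E.push (E.lcV hm Y Z) p + E.push (E.lcV hm Y W) p := map_add (E.toEquiv p) _ _
  change E.push _ p = E.push _ p
  rw [h2, push_lcV, push_lcV, push_lcV, h1,
    ((E.diffMetric hm).lc.isCovariantDerivativeOnUniv).add (E.vdiffAt_push Z p) (E.vdiffAt_push W p)]
  rfl

theorem lcV_fsmul_right (f : Fun M) (Y Z : VecSec V) :
    E.lcV hm Y (fsmul f Z) = fsmul f (E.lcV hm Y Z) + fsmul (E.anchor Y f) Z := by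
  ext p
  apply (E.toEquiv p).injective
  have h1 : E.push (fsmul f Z) = (f : M → ℝ) • E.push Z :=
    funext fun q => map_smul (E.toEquiv q) _ _
  have h2 : E.push (fsmul f (E.lcV hm Y Z) + fsmul (E.anchor Y f) Z) p =
    f p • E.push (E.lcV hm Y Z) p + E.anchor Y f p • E.push Z p :=
    (map_add (E.toEquiv p) _ _).trans
      (congrArg₂ (· + ·) (map_smul (E.toEquiv p) _ _) (map_smul (E.toEquiv p) _ _))
  change E.push _ p = E.push _ p
  rw [h2, push_lcV, push_lcV, h1, ((E.diffMetric hm).lc.isCovariantDerivativeOnUniv).leibniz (E.vdiffAt_push Z p)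
    (f.contMDiff.mdifferentiable (by simp) p)]
  rfl

/-- The dual connection is dictated by the Leibniz rule for the pairing. Its right hand side is
function-linear in `Z` because the two terms containing a derivative of `f` cancel. -/
theorem exists_lcC (Y : VecSec V) (ξ : CovSec V) :
    ∃ η : CovSec V, ∀ Z, pair η Z = E.anchor Y (pair ξ Z) - pair ξ (E.lcV hm Y Z) :=
  exists_covSec_pair (fun Z W => by
      rw [pair_add, map_add, lcV_add_right, pair_add]; ring)
    (fun f Z => by
      rw [pair_fsmul, Derivation.leibniz, lcV_fsmul_right, pair_add, pair_fsmul, pair_fsmul]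
      simp only [smul_eq_mul]
      ring)

/-- The Levi-Civita connection in the direction of a section of `V`. -/
def lcData (Y : VecSec V) : ConnData V where
  a := E.anchor Y
  nV := E.lcV hm Y
  nC ξ := (E.exists_lcC hm Y ξ).choose
  compat ξ Z := by rw [(E.exists_lcC hm Y ξ).choose_spec]; ring

end BundleIso

end LeviCivitaData

/-! ### Connections as operators on tensor fields, and their curvature. -/

section Connections

variable {M : Type*} [TopologicalSpace M] [T2Space M] [ChartedSpace R4 M] [IsManifold (𝓡 4) ∞ M]
variable {V : M → Type*} [TopologicalSpace (TotalSpace R4 V)]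
  [∀ p, TopologicalSpace (V p)] [∀ p, AddCommGroup (V p)] [∀ p, Module ℝ (V p)]
  [FiberBundle R4 V] [VectorBundle ℝ R4 V] [ContMDiffVectorBundle ∞ R4 V (𝓡 4)]

theorem covSec_ext_pair {ξ η : CovSec V} (h : ∀ Z, pair ξ Z = pair η Z) : ξ = η := by
  ext p v
  obtain ⟨Z, rfl⟩ := exists_vecSec_apply_eq p v
  exact congrArg (fun f : Fun M => f p) (h Z)

variable (V) in
theorem ofFun_mul (f g : Fun M) : ofFun V (f * g) = ofFun V f * ofFun V g :=
  TF.ext_apply fun p => map_mul (algebraMap ℝ (Tens (V p))) (f p) (g p)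

variable (V) in
theorem ofFun_sub (f g : Fun M) : ofFun V (f - g) = ofFun V f - ofFun V g :=
  TF.ext_apply fun p => map_sub (algebraMap ℝ (Tens (V p))) (f p) (g p)

variable (V) in
theorem ofFun_zero : ofFun V (0 : Fun M) = 0 :=
  TF.ext_apply fun p => map_zero (algebraMap ℝ (Tens (V p)))

theorem ofFun_mul_comm (f : Fun M) (u : TF V) : ofFun V f * u = u * ofFun V f :=
  TF.ext_apply fun p => Algebra.commutes (f p) (u.1 p)

theorem ofVec_add (Y Z : VecSec V) : ofVec (Y + Z) = ofVec Y + ofVec Z :=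
  TF.ext_apply fun p => map_add vec (Y p) (Z p)

theorem ofVec_sub (Y Z : VecSec V) : ofVec (Y - Z) = ofVec Y - ofVec Z :=
  TF.ext_apply fun p => map_sub vec (Y p) (Z p)

theorem ofVec_fsmul (f : Fun M) (Z : VecSec V) : ofVec (fsmul f Z) = ofFun V f * ofVec Z :=
  TF.ext_apply fun p => (map_smul vec (f p) (Z p)).trans (Algebra.smul_def _ _)

theorem ofCov_add (Y Z : CovSec V) : ofCov (Y + Z) = ofCov Y + ofCov Z :=
  TF.ext_apply fun p => map_add cov (Y p : V p →ₗ[ℝ] ℝ) (Z p)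

theorem ofCov_sub (Y Z : CovSec V) : ofCov (Y - Z) = ofCov Y - ofCov Z :=
  TF.ext_apply fun p => map_sub cov (Y p : V p →ₗ[ℝ] ℝ) (Z p)

theorem ofCov_fsmul (f : Fun M) (Z : CovSec V) : ofCov (fsmul f Z) = ofFun V f * ofCov Z :=
  TF.ext_apply fun p => (map_smul cov (f p) (Z p : V p →ₗ[ℝ] ℝ)).trans (Algebra.smul_def _ _)

variable (V) in
theorem ofFun_injective : Function.Injective (ofFun V) := fun f g h => by
  ext p
  have := congrArg (fun u : TF V => eps (u.1 p)) h
  simpa [ofFun_apply] using this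

theorem contrF_add (Y Z : VecSec V) (u : TF V) : contrF (Y + Z) u = contrF Y u + contrF Z u :=
  TF.ext_apply fun p => contr_add (Y p) (Z p) (u.1 p)

theorem contrF_sub (Y Z : VecSec V) (u : TF V) : contrF (Y - Z) u = contrF Y u - contrF Z u := by
  rw [eq_sub_iff_add_eq, ← contrF_add, sub_add_cancel]

/-- A tensor field vanishes if its scalar part and its first contractions vanish. -/
theorem TF.eq_zero {t : TF V} (h0 : epsF t = 0) (hv : ∀ Y, contrF Y t = 0)
    (hc : ∀ ξ, contrCovF ξ t = 0) : t = 0 := by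
  refine TF.ext_apply fun p => tens_eq_zero (fibreBasis V p) ?_ (fun y => ?_) fun ξ => ?_
  · exact congrArg (fun f : Fun M => f p) h0
  · obtain ⟨Y, rfl⟩ := exists_vecSec_apply_eq p y
    exact congrArg (fun u : TF V => u.1 p) (hv Y)
  · obtain ⟨η, rfl⟩ := exists_covSec_apply_eq p ξ
    exact congrArg (fun u : TF V => u.1 p) (hc η)

theorem TF.ext_of_form {s t : TF V} (hs : ∀ p, s.1 p ∈ formTensFibre (V p) 1)
    (ht : ∀ p, t.1 p ∈ formTensFibre (V p) 1) (h : ∀ Y, contrF Y s = contrF Y t) : s = t := by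
  refine TF.ext_apply fun p => formTensFibre_one_ext (fibreBasis V p) (hs p) (ht p) fun y => ?_
  obtain ⟨Y, rfl⟩ := exists_vecSec_apply_eq p y
  exact congrArg (fun u : TF V => u.1 p) (h Y)

theorem TF.eq_zero_of_form_two {t : TF V} (ht : ∀ p, t.1 p ∈ formTensFibre (V p) 2)
    (h : ∀ Y Z, contrF Z (contrF Y t) = 0) : t = 0 := by
  refine TF.ext_apply fun p => eq_zero_of_mem_formTensFibre_two (fibreBasis V p) (ht p)
    fun y z => ?_
  obtain ⟨Y, rfl⟩ := exists_vecSec_apply_eq p y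
  obtain ⟨Z, rfl⟩ := exists_vecSec_apply_eq p z
  exact congrArg (fun u : TF V => u.1 p) (h Y Z)

theorem contrF_contrF_wedgeField (Y Z : VecSec V) (u : TF V) :
    contrF Z (contrF Y (wedgeField u)) = contrF Z (contrF Y u) - contrF Y (contrF Z u) :=
  TF.ext_apply fun p => contr_contr_wedgeOp (fibreBasis V p) (Y p) (Z p) (u.1 p)

theorem wedgeField_mem (u : TF V) (p : M) : (wedgeField u).1 p ∈ formTensFibre (V p) 2 :=
  wedgeOp_mem_formTensFibre _ _

theorem half_bracket (D : TF V →ₗ[ℝ] TF V) (u : TF V) :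
    ((1 / 2 : ℝ) • bracket D D) u = wedgeField (D (D u)) := by
  simp only [bracket, LinearMap.smul_apply, LinearMap.sub_apply, LinearMap.comp_apply]
  rw [show ((-1 : ℝ) ^ (1 * 1)) = -1 by norm_num, neg_smul, one_smul, sub_neg_eq_add, ← two_smul ℝ,
    smul_smul]
  norm_num

theorem along_one (D : TF V →ₗ[ℝ] TF V) (Y : Fin 1 → VecSec V) (u : TF V) (p : M) :
    along D Y u p = (contrF (Y 0) (D u)).1 p := rfl

theorem along_two (D : TF V →ₗ[ℝ] TF V) (Y : Fin 2 → VecSec V) (u : TF V) (p : M) :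
    along D Y u p = (contrF (Y 1) (contrF (Y 0) (D u))).1 p := rfl

theorem contrF_idField (Y : VecSec V) : contrF Y (idField V) = ofVec Y := by
  refine TF.ext_apply fun p => ?_
  change contr (Y p) (idTens (fibreBasis V p)) = vec (Y p)
  simp only [idTens, map_sum, contr_cov_mul, ← map_smul]
  rw [← map_sum]
  exact congrArg vec ((fibreBasis V p).sum_repr (Y p))

theorem contrCovF_idField (ξ : CovSec V) : contrCovF ξ (idField V) = 0 := by
  refine TF.ext_apply fun p => ?_
  change contrCov _ (idTens (fibreBasis V p)) = 0
  simp [idTens, contrCov_cov_mul]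

theorem epsF_idField : epsF (idField V) = 0 := by
  ext p
  change eps (idTens (fibreBasis V p)) = 0
  simp [idTens]

namespace ConnData

/-- The action on `V*` is already determined by the other two through `compat`. -/
theorem nabla_congr {C C' : ConnData V} (ha : C.a = C'.a) (hV : C.nV = C'.nV) :
    C.nabla = C'.nabla := by
  refine derivation_ext C.nabla_mul C'.nabla_mul (fun f => ?_) (fun Z => ?_) fun ξ => ?_
  · rw [nabla_ofFun, nabla_ofFun, ha]
  · rw [nabla_ofVec, nabla_ofVec, hV]
  · rw [nabla_ofCov, nabla_ofCov]
    refine congrArg ofCov (covSec_ext_pair fun Z => ?_)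
    have h1 := C.compat ξ Z
    rw [ha, hV, C'.compat] at h1
    exact (add_right_cancel h1).symm

variable (C : ConnData V)

/-- Contracting `I` with `Y` returns `Y`, so the Leibniz rule for that contraction reads `∇Y = i_Y
∇I + ∇Y`. The scalar part and the contractions with covectors vanish for `I`, hence also for `∇I`.
-/
theorem nabla_idField : C.nabla (idField V) = 0 := by
  refine TF.eq_zero ?_ (fun Y => ?_) fun ξ => ?_
  · rw [epsF_nabla, epsF_idField, map_zero]
  · have := C.nabla_contrF Y (idField V)
    rw [contrF_idField, nabla_ofVec, contrF_idField] at this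
    exact (left_eq_add.1 (this.trans (add_comm _ _)))
  · have := C.nabla_contrCovF ξ (idField V)
    rwa [contrCovF_idField, map_zero, contrCovF_idField, add_zero, eq_comm] at this

end ConnData

theorem contrF_contrF_metric {h : TF V} (hm : ∀ p, IsMetricTens (h.1 p)) (Y Z : VecSec V) :
    contrF Z (contrF Y h) = ofFun V (metricFun h Y Z) :=
  TF.ext_apply fun p => (hm p).contr_contr (Y p) (Z p)

theorem contrCovF_contrF_metric {h : TF V} (hm : ∀ p, IsMetricTens (h.1 p)) (Y : VecSec V)
    (ξ : CovSec V) : contrCovF ξ (contrF Y h) = 0 :=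
  TF.ext_apply fun p => (hm p).contrCov_contr (Y p) _

/-- A metric is parallel if and only if the connection is compatible with it. -/
theorem ConnData.nabla_metric_eq_zero_iff (C : ConnData V) {h : TF V}
    (hm : ∀ p, IsMetricTens (h.1 p)) : C.nabla h = 0 ↔
      ∀ Y Z, C.a (metricFun h Y Z) = metricFun h (C.nV Y) Z + metricFun h Y (C.nV Z) := by
  -- The contraction of `∇h` with `Y` and `Z` is the defect of the product rule for `h(Y, Z)`. In
  -- the converse direction all other contractions of `∇h` vanish because those of `h` do.
  have key (Y Z : VecSec V) : ofFun V (C.a (metricFun h Y Z)) =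
      contrF Z (contrF Y (C.nabla h)) +
        ofFun V (metricFun h (C.nV Y) Z + metricFun h Y (C.nV Z)) := by
    rw [ofFun_add, ← contrF_contrF_metric hm, ← contrF_contrF_metric hm, ← nabla_ofFun,
      ← contrF_contrF_metric hm, C.nabla_contrF, C.nabla_contrF, map_add]
    abel
  constructor
  · intro h0 Y Z
    have := key Y Z
    rw [h0, map_zero, map_zero, zero_add] at this
    exact ofFun_injective V this
  · intro h0
    refine TF.eq_zero ?_ (fun Y => TF.eq_zero ?_ (fun Z => ?_) fun ξ => ?_) fun ξ => ?_
    · rw [epsF_nabla]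
      have : epsF h = 0 := by ext p; exact (hm p).eps_eq
      rw [this, map_zero]
    · have h1 := C.nabla_contrF Y h
      have h2 (Y : VecSec V) : epsF (contrF Y h) = 0 := by ext p; exact (hm p).eps_contr (Y p)
      have h3 := congrArg epsF h1
      rwa [epsF_nabla, h2, map_zero, map_add, h2, add_zero, eq_comm] at h3
    · have := key Y Z
      rw [h0] at this
      exact left_eq_add.1 (this.trans (add_comm _ _))
    · have h1 := C.nabla_contrCovF ξ (contrF Y h)
      rw [C.nabla_contrF, map_add, contrCovF_contrF_metric hm, map_zero,
        contrCovF_contrF_metric hm, contrCovF_contrF_metric hm] at h1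
      simpa using h1.symm
    · have h2 (ξ : CovSec V) : contrCovF ξ h = 0 :=
        TF.ext_apply fun p => (hm p).contrCov_eq _
      have h1 := C.nabla_contrCovF ξ h
      rwa [h2, h2, map_zero, add_zero, eq_comm] at h1

/-- `D` is the operator on tensor fields given by a connection. -/
structure IsConn (D : TF V →ₗ[ℝ] TF V) (C : VecSec V → ConnData V) : Prop where
  form_valued : ∀ u p, (D u).1 p ∈ formTensFibre (V p) 1
  contrF_eq : ∀ Y u, contrF Y (D u) = (C Y).nabla u

/-- Near `p` the operator must be `u ↦ ∑ λᵃ ⊗ ∇_{Fₐ} u` for a frame `F` with dual frame `λ`.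
Linearity over functions in `Y` gives this expression the right contractions with every section. -/
theorem exists_isConn {C : VecSec V → ConnData V}
    (hadd : ∀ Y Z u, (C (Y + Z)).nabla u = (C Y).nabla u + (C Z).nabla u)
    (hsmul : ∀ f Y u, (C (fsmul f Y)).nabla u = ofFun V f * (C Y).nabla u) :
    ∃ D, IsConn D C := by
  let Fr (p : M) : FrameAt V p := (nonempty_frameAt p).some
  let K (p : M) (u : TF V) (q : M) : Tens (V q) :=
    ∑ a, cov ((Fr p).covs a q : V q →ₗ[ℝ] ℝ) * ((C ((Fr p).vecs a)).nabla u).1 q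
  have hK (p : M) (u : TF V) (Y : VecSec V) : ∀ᶠ q in 𝓝 p,
      contr (Y q) (K p u q) = ((C Y).nabla u).1 q := by
    filter_upwards [(Fr p).eventually_sum] with q hq
    have h1 := hq (Y q)
    have h2 : ((C Y).nabla u).1 q =
        ((C (∑ a, fsmul (pair ((Fr p).covs a) Y) ((Fr p).vecs a))).nabla u).1 q := by
      refine tensorial_congr (p := q) (ψ := fun Y => ((C Y).nabla u).1 q) (fun Y Z => ?_) (fun f Y => ?_) ?_
      · rw [hadd]; rfl
      · rw [hsmul]; exact (Algebra.smul_def (f q) (((C Y).nabla u).1 q)).symm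
      · rw [contMDiffSection_sum_apply]
        exact h1
    rw [h2]
    have h3 := map_sum (AddMonoidHom.mk' (fun Y => (C Y).nabla u) fun Y Z => hadd Y Z u)
      (fun a => fsmul (pair ((Fr p).covs a) Y) ((Fr p).vecs a)) Finset.univ
    simp only [AddMonoidHom.mk'_apply] at h3
    rw [h3]
    simp only [K, map_sum, contr_cov_mul, hsmul]
    have h4 := map_sum (Pi.evalAddMonoidHom (fun q => Tens (V q)) q)
      (fun a => (ofFun V (pair ((Fr p).covs a) Y) * (C ((Fr p).vecs a)).nabla u).1) Finset.univ
    rw [AddSubmonoidClass.coe_finsetSum]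
    refine Eq.trans ?_ h4.symm
    exact Finset.sum_congr rfl fun a _ => Algebra.smul_def _ _
  have hKm (p : M) (u : TF V) (q : M) : K p u q ∈ formTensFibre (V q) 1 :=
    sum_mem fun a _ => cov_mul_mem_formTensFibre _ _
  -- One-forms are determined by their contractions, so the local expressions centred at `q` and at
  -- `p` have the same value at `q`; the diagonal field is therefore smooth.
  have hKK (p : M) (u : TF V) : ∀ᶠ q in 𝓝 p, K q u q = K p u q := by
    have h1 : ∀ᶠ q in 𝓝 p, ∀ a, contr ((Fr p).vecs a q) (K p u q) =
        ((C ((Fr p).vecs a)).nabla u).1 q := Filter.eventually_all.2 fun a => hK p u _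
    filter_upwards [h1, (Fr p).exists_basis] with q hq ⟨b, hb, _⟩
    rw [formTensFibre_one_decomp b (hKm q u q), formTensFibre_one_decomp b (hKm p u q)]
    refine Finset.sum_congr rfl fun a _ => congrArg _ ?_
    rw [hb, hq, (hK q u _).self_of_nhds]
  refine ⟨{
    toFun := fun u => ⟨fun p => K p u p, fun p => ?_⟩
    map_add' := fun u v => TF.ext_apply fun p => ?_
    map_smul' := fun r u => TF.ext_apply fun p => ?_ }, fun u p => hKm p u p, fun Y u =>
      TF.ext_apply fun p => (hK p u Y).self_of_nhds⟩
  · have h1 := (∑ a, ofCov ((Fr p).covs a) * (C ((Fr p).vecs a)).nabla u).2 p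
    obtain ⟨U, hU, hpU, u', hu', h⟩ := h1
    obtain ⟨U₂, hU₂, hU₂o, hpU₂⟩ := eventually_nhds_iff.1 (hKK p u)
    refine ⟨U ∩ U₂, hU.inter hU₂o, ⟨hpU, hpU₂⟩, u', smoothAlg_mono V Set.inter_subset_left hu',
      fun q hq => (hU₂ q hq.2).trans (Eq.trans ?_ (h q hq.1))⟩
    rw [AddSubmonoidClass.coe_finsetSum, Finset.sum_apply]
    rfl
  · change K p (u + v) p = K p u p + K p v p
    simp only [K, map_add, TF.add_apply, mul_add, Finset.sum_add_distrib]
  · change K p (r • u) p = r • K p u p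
    simp only [K, map_smul, TF.smul_apply, mul_smul_comm, Finset.smul_sum]

theorem IsConn.unique {D D' : TF V →ₗ[ℝ] TF V} {C : VecSec V → ConnData V} (h : IsConn D C)
    (h' : IsConn D' C) : D = D' :=
  LinearMap.ext fun u => TF.ext_of_form (h.form_valued u) (h'.form_valued u) fun Y => by
    rw [h.contrF_eq, h'.contrF_eq]

/-- The curvature operator of a connection. -/
def curv (C : VecSec V → ConnData V) (Y Z : VecSec V) (u : TF V) : TF V :=
  (C Y).nabla ((C Z).nabla u) - (C Z).nabla ((C Y).nabla u)
    - (C ((C Y).nV Z - (C Z).nV Y)).nabla u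

theorem curv_mul (C : VecSec V → ConnData V) (Y Z : VecSec V) (u v : TF V) :
    curv C Y Z (u * v) = curv C Y Z u * v + u * curv C Y Z v := by
  simp only [curv, ConnData.nabla_mul, map_add, sub_mul, mul_sub]
  abel

namespace IsConn

variable {D : TF V →ₗ[ℝ] TF V} {C : VecSec V → ConnData V}

/-- Moving `∇_Y` past the contraction with `Z` produces a contraction with `∇_Y Z`. This is why the
correction term involves `∇_Y Z - ∇_Z Y` rather than a Lie bracket, whether or not the torsion
vanishes. -/
theorem contrF_contrF (hD : IsConn D C) (Y Z : VecSec V) (u : TF V) :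
    contrF Z (contrF Y (wedgeField (D (D u)))) = curv C Y Z u := by
  rw [contrF_contrF_wedgeField, hD.contrF_eq, hD.contrF_eq]
  have h1 := (C Y).nabla_contrF Z (D u)
  have h2 := (C Z).nabla_contrF Y (D u)
  rw [hD.contrF_eq] at h1 h2
  rw [curv, ← hD.contrF_eq ((C Y).nV Z - (C Z).nV Y), contrF_sub, h1, h2]
  abel

theorem along_curv (hD : IsConn D C) (Y : Fin 2 → VecSec V) (u : TF V) (p : M) :
    along ((1 / 2 : ℝ) • bracket D D) Y u p = (curv C (Y 0) (Y 1) u).1 p := by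
  rw [along_two, half_bracket, hD.contrF_contrF]

theorem along_nabla (hD : IsConn D C) (Y : Fin 1 → VecSec V) (u : TF V) (p : M) :
    along D Y u p = ((C (Y 0)).nabla u).1 p := by
  rw [along_one, hD.contrF_eq]

theorem eq_zero (hD : IsConn D C) {u : TF V} (h : ∀ Y, (C Y).nabla u = 0) : D u = 0 :=
  TF.ext_of_form (hD.form_valued u) (fun _ => zero_mem _) fun Y => by
    rw [hD.contrF_eq, h, map_zero]

end IsConn

end Connections

/-! ### The Levi-Civita diamond satisfies all conditions. -/

section Existence

variable {M : Type*} [TopologicalSpace M] [T2Space M] [ChartedSpace R4 M] [IsManifold (𝓡 4) ∞ M]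
variable {V : M → Type*} [TopologicalSpace (TotalSpace R4 V)]
  [∀ p, TopologicalSpace (V p)] [∀ p, AddCommGroup (V p)] [∀ p, Module ℝ (V p)]
  [FiberBundle R4 V] [VectorBundle ℝ R4 V] [ContMDiffVectorBundle ∞ R4 V (𝓡 4)]

theorem metricFun_sub_left (h : TF V) (Y Y' Z : VecSec V) :
    metricFun h (Y - Y') Z = metricFun h Y Z - metricFun h Y' Z := by
  simp only [metricFun, contrF_sub, map_sub]

theorem metricFun_sub_right (h : TF V) (Y Z Z' : VecSec V) :
    metricFun h Y (Z - Z') = metricFun h Y Z - metricFun h Y Z' := by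
  simp only [metricFun, contrF_sub, map_sub]

variable {D : TF V →ₗ[ℝ] TF V} {C : VecSec V → ConnData V} {h : TF V}

/-- The curvature on sections of `V`. -/
def curvV (C : VecSec V → ConnData V) (X Y Z : VecSec V) : VecSec V :=
  (C X).nV ((C Y).nV Z) - (C Y).nV ((C X).nV Z) - (C ((C X).nV Y - (C Y).nV X)).nV Z

theorem curv_ofVec (X Y Z : VecSec V) : curv C X Y (ofVec Z) = ofVec (curvV C X Y Z) := by
  simp only [curv, curvV, ConnData.nabla_ofVec, ofVec_sub]

theorem curv_ofCov (X Y : VecSec V) (ξ : CovSec V) : ∃ η : CovSec V,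
    curv C X Y (ofCov ξ) = ofCov η := by
  refine ⟨(C X).nC ((C Y).nC ξ) - (C Y).nC ((C X).nC ξ) - (C ((C X).nV Y - (C Y).nV X)).nC ξ, ?_⟩
  simp only [curv, ConnData.nabla_ofCov, ofCov_sub]

/-- The torsion of the connection vanishes. -/
def TorsionFree (C : VecSec V → ConnData V) : Prop :=
  ∀ X Y f, (C X).a ((C Y).a f) - (C Y).a ((C X).a f) = (C ((C X).nV Y - (C Y).nV X)).a f

/-- The function on the right is minus the derivative of `f` along the torsion, which links
verticality of the half bracket to `TorsionFree`. -/
theorem curv_ofFun (X Y : VecSec V) (f : Fun M) : curv C X Y (ofFun V f) =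
    ofFun V ((C X).a ((C Y).a f) - (C Y).a ((C X).a f) - (C ((C X).nV Y - (C Y).nV X)).a f) := by
  simp only [curv, ConnData.nabla_ofFun, ofFun_sub]

theorem TorsionFree.curv_ofFun (hC : TorsionFree C) (X Y : VecSec V) (f : Fun M) :
    curv C X Y (ofFun V f) = 0 := by
  rw [Diamond.curv_ofFun, hC, sub_self, ofFun_zero]

/-- The metric is parallel. -/
def IsParallel (C : VecSec V → ConnData V) (h : TF V) : Prop :=
  ∀ X, (C X).nabla h = 0

theorem IsParallel.curv_eq_zero (hp : IsParallel C h) (X Y : VecSec V) : curv C X Y h = 0 := by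
  rw [curv, hp X, hp Y, hp, map_zero, map_zero, sub_zero, sub_zero]

/-- The curvature is skew. -/
theorem IsParallel.metricFun_curvV (hp : IsParallel C h) (hm : ∀ p, IsMetricTens (h.1 p))
    (hC : TorsionFree C) (X Y Z W : VecSec V) :
    metricFun h (curvV C X Y Z) W + metricFun h Z (curvV C X Y W) = 0 := by
  have hc (X Z W : VecSec V) := ((C X).nabla_metric_eq_zero_iff hm).1 (hp X) Z W
  have h1 := hC X Y (metricFun h Z W)
  simp only [hc, map_add] at h1
  simp only [curvV, metricFun_sub_left, metricFun_sub_right]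
  linear_combination h1

/-- A left inverse of `vec`. -/
def vecInv {W : Type*} [AddCommGroup W] [Module ℝ W] : Tens W →ₗ[ℝ] W :=
  (LinearMap.fst ℝ W (Module.Dual ℝ W)).comp TensorAlgebra.ιInv

theorem vecInv_vec {W : Type*} [AddCommGroup W] [Module ℝ W] (w : W) : vecInv (vec w) = w := by
  simp [vecInv, vec, TensorAlgebra.ι_leftInverse (R := ℝ) (M := W × Module.Dual ℝ W) (w, 0)]

/-- Contraction of the first two factors of a two-form with values in `𝒯(W)`, as an alternating
map. -/
def contrAlt {W U : Type*} [AddCommGroup W] [Module ℝ W] [AddCommGroup U] [Module ℝ U]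
    (K : U →ₗ[ℝ] Tens W) (hK : ∀ z, K z ∈ formTensFibre W 2) :
    W [⋀^Fin 2]→ₗ[ℝ] (U →ₗ[ℝ] W) where
  toFun y := vecInv ∘ₗ contr (y 1) ∘ₗ contr (y 0) ∘ₗ K
  map_update_add' y i x z := by
    ext u
    fin_cases i <;> simp [Function.update, contr_add]
  map_update_smul' y i c z := by
    ext u
    fin_cases i <;> simp [Function.update, contr_smul]
  map_eq_zero_of_eq' y i j hij hne := by
    have hy : y 0 = y 1 := by fin_cases i <;> fin_cases j <;> simp_all
    ext u
    have h1 (t : Tens W) (ht : t ∈ formTensFibre W 2) : contr (y 1) (contr (y 1) t) = 0 := by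
      induction ht using Submodule.span_induction with
      | mem t h =>
        obtain ⟨ξ, u, rfl⟩ := h
        have : ξ = ![ξ 0, ξ 1] := by ext i; fin_cases i <;> rfl
        rw [this, wedge_pair]
        simp only [sub_mul, mul_assoc, map_sub, contr_cov_mul, map_smul, smul_smul, mul_comm,
          sub_self]
      | zero => simp
      | add s t _ _ hs ht => simp [hs, ht]
      | smul r t _ ht => simp [ht]
    simp [hy, h1 _ (hK u)]

theorem contrAlt_apply {W U : Type*} [AddCommGroup W] [Module ℝ W] [AddCommGroup U] [Module ℝ U]
    (K : U →ₗ[ℝ] Tens W) (hK : ∀ z, K z ∈ formTensFibre W 2) (y : Fin 2 → W) (u : U) :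
    contrAlt K hK y u = vecInv (contr (y 1) (contr (y 0) (K u))) := rfl

namespace IsConn

/-- The curvature is a two-form with values in the endomorphisms of `V`. -/
theorem exists_isBeta (hD : IsConn D C) (hC : TorsionFree C) :
    ∃ Υ : ∀ p, (V p) [⋀^Fin 2]→ₗ[ℝ] Module.End ℝ (V p), ∀ (Y : Fin 2 → VecSec V) (Z : VecSec V)
      (p : M), Υ p (fun i => Y i p) (Z p) = curvV C (Y 0) (Y 1) Z p := by
  let Fr (p : M) : FrameAt V p := (nonempty_frameAt p).some
  let T (Z : VecSec V) : TF V := wedgeField (D (D (ofVec Z)))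
  let K (p : M) : V p →ₗ[ℝ] Tens (V p) :=
    ∑ a, ((Fr p).covs a p : V p →ₗ[ℝ] ℝ).smulRight ((T ((Fr p).vecs a)).1 p)
  have hTadd (Y Z) : T (Y + Z) = T Y + T Z := by simp only [T, ofVec_add, map_add]
  -- The curvature is a derivation that kills functions, hence function-linear in `Z`. So `T`
  -- descends to the fibre map `K p`, from which the endomorphism-valued two-form is read off.
  have hTsmul (f Z) : T (fsmul f Z) = ofFun V f * T Z := by
    refine sub_eq_zero.1 (TF.eq_zero_of_form_two (fun p => ?_) fun X Y => ?_)
    · refine sub_mem (wedgeField_mem _ _) ?_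
      rw [TF.mul_apply, ofFun_apply, ← Algebra.smul_def]
      exact Submodule.smul_mem _ _ (wedgeField_mem _ _)
    · rw [map_sub, map_sub, contrF_ofFun_mul, contrF_ofFun_mul, hD.contrF_contrF,
        hD.contrF_contrF, ofVec_fsmul, curv_mul, hC.curv_ofFun, zero_mul, zero_add, sub_self]
  have hK (p : M) (Z : VecSec V) : K p (Z p) = (T Z).1 p := by
    have := (Fr p).tensorial (ψ := fun Z => (T Z).1 p) (fun Y Z => by rw [hTadd]; rfl)
      (fun f Z => by rw [hTsmul]; exact (Algebra.smul_def (f p) ((T Z).1 p)).symm) Z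
    rw [this]
    simp [K]
  have hKm (p : M) (z : V p) : K p z ∈ formTensFibre (V p) 2 := by
    obtain ⟨Z, rfl⟩ := exists_vecSec_apply_eq p z
    rw [hK]
    exact wedgeField_mem _ _
  refine ⟨fun p => contrAlt (K p) (hKm p), fun Y Z p => ?_⟩
  have h1 := congrArg (fun u : TF V => u.1 p) (hD.contrF_contrF (Y 0) (Y 1) (ofVec Z))
  simp only [curv_ofVec] at h1
  rw [contrAlt_apply, hK]
  exact (congrArg vecInv h1).trans (vecInv_vec _)

variable {H : ConformalStructure V}

theorem isDiamond_one (hD : IsConn D C) (hp : IsParallel C h) (hh : H.IsRep h) :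
    IsDiamond H 1 D where
  form_valued := hD.form_valued
  map_fun Y f := ⟨(C (Y 0)).a f, fun p => by rw [hD.along_nabla, ConnData.nabla_ofFun]⟩
  map_vec Y Z := ⟨(C (Y 0)).nV Z, fun p => by rw [hD.along_nabla, ConnData.nabla_ofVec]⟩
  map_cov Y ξ := ⟨(C (Y 0)).nC ξ, fun p => by rw [hD.along_nabla, ConnData.nabla_ofCov]⟩
  leibniz Y u v p := by
    rw [hD.along_nabla, hD.along_nabla, hD.along_nabla, ConnData.nabla_mul]
    rfl
  map_id := hD.eq_zero fun Y => ConnData.nabla_idField _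
  conformal g hg := by
    obtain ⟨F, hF, rfl⟩ := hg.exists_fun hh
    let F' : Fun M := ⟨fun p => (F p)⁻¹, fun p => F.contMDiff.contMDiffAt.inv₀ (hF p)⟩
    -- `D F` is a plain covector at each point, because its contractions with a frame are scalars.
    have hcov (p : M) : ∃ η : Module.Dual ℝ (V p), (D (ofFun V F)).1 p = cov η := by
      let Fr : FrameAt V p := (nonempty_frameAt p).some
      obtain ⟨b, hb, -⟩ := Fr.exists_basis.self_of_nhds
      refine ⟨∑ a, ((C (Fr.vecs a)).a F p) • b.coord a, ?_⟩
      rw [formTensFibre_one_decomp b (hD.form_valued _ p), map_sum]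
      refine Finset.sum_congr rfl fun a _ => ?_
      have := congrArg (fun u : TF V => u.1 p) (hD.contrF_eq (Fr.vecs a) (ofFun V F))
      simp only [contrF_apply, ConnData.nabla_ofFun, ofFun_apply] at this
      rw [hb, this, map_smul, ← Algebra.commutes, ← Algebra.smul_def]
    -- Since `h` is parallel, `D (F h) = D F ⊗ h`; rewriting `h` as `F⁻¹ (F h)` gives the factor
    -- `F⁻¹ D F`.
    refine ⟨ofFun V F' * D (ofFun V F), fun p => ?_, ?_⟩
    · obtain ⟨η, hη⟩ := hcov p
      rw [TF.mul_apply, hη, ofFun_apply, ← Algebra.smul_def]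
      exact Submodule.smul_mem _ _ (cov_mem_formFibre η)
    · have hFF : ofFun V F' * D (ofFun V F) * (ofFun V F * h) = D (ofFun V F) * h := by
        have h1 : ofFun V F' * ofFun V F = 1 := by
          rw [← ofFun_mul, ← ofFun_one]
          refine congrArg _ ?_
          ext p
          exact inv_mul_cancel₀ (hF p)
        rw [ofFun_mul_comm F', mul_assoc, ← mul_assoc (ofFun V F'), h1, one_mul]
      rw [hFF]
      refine TF.ext_of_form (hD.form_valued _) (fun p => ?_) fun Y => ?_
      · obtain ⟨η, hη⟩ := hcov p
        rw [TF.mul_apply, hη]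
        exact cov_mul_mem_formTensFibre _ _
      · rw [hD.contrF_eq, ConnData.nabla_mul, hp Y, mul_zero, add_zero, ← hD.contrF_eq]
        refine TF.ext_apply fun p => ?_
        obtain ⟨η, hη⟩ := hcov p
        simp only [contrF_apply, TF.mul_apply, hη, contr_cov_mul, contr_cov, Algebra.smul_def]

theorem isVertical_bracket (hD : IsConn D C) (hp : IsParallel C h) (hh : H.IsRep h)
    (hC : TorsionFree C) : IsVertical H 2 ((1 / 2 : ℝ) • bracket D D) := by
  have hmem (u : TF V) (p : M) :
      (((1 / 2 : ℝ) • bracket D D) u).1 p ∈ formTensFibre (V p) 2 := by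
    rw [half_bracket]
    exact wedgeField_mem _ _
  have hzero (u : TF V) (h0 : ∀ X Y, curv C X Y u = 0) :
      ((1 / 2 : ℝ) • bracket D D) u = 0 :=
    TF.eq_zero_of_form_two (hmem u) fun X Y => by rw [half_bracket, hD.contrF_contrF, h0]
  exact
  { form_valued := hmem
    map_fun := fun Y f => ⟨0, fun p => by rw [hD.along_curv, hC.curv_ofFun, ofFun_zero]⟩
    map_vec := fun Y Z => ⟨curvV C (Y 0) (Y 1) Z, fun p => by rw [hD.along_curv, curv_ofVec]⟩
    map_cov := fun Y ξ => by
      obtain ⟨η, hη⟩ := curv_ofCov (C := C) (Y 0) (Y 1) ξ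
      exact ⟨η, fun p => by rw [hD.along_curv, hη]⟩
    leibniz := fun Y u v p => by
      rw [hD.along_curv, hD.along_curv, hD.along_curv, curv_mul]
      rfl
    map_id := hzero _ fun X Y => by simp only [curv, ConnData.nabla_idField, map_zero, sub_zero]
    conformal := fun g hg => by
      obtain ⟨F, hF, rfl⟩ := hg.exists_fun hh
      -- The factor is zero for every representative: the curvature is a derivation that kills both
      -- `F` and `h`.
      refine ⟨0, fun p => zero_mem _, ?_⟩
      rw [zero_mul]
      refine hzero _ fun X Y => ?_
      rw [curv_mul, hC.curv_ofFun, hp.curv_eq_zero, zero_mul, mul_zero, add_zero]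
    vertical := fun f => hzero _ fun X Y => hC.curv_ofFun X Y f }

/-- The curvature endomorphisms are skew for `h`, hence traceless. Skewness is unaffected by
rescaling `h`, so they lie in the Lie algebra with multiplier `0` for every representative. -/
theorem isGeometric (hD : IsConn D C) (hp : IsParallel C h) (hh : H.IsRep h)
    (hC : TorsionFree C) {E : BundleIso V} (hE : IsAnchor D E) : IsGeometric H D where
  diamond := hD.isDiamond_one hp hh
  nondegenerate := ⟨E, hE⟩
  vertical := hD.isVertical_bracket hp hh hC
  trace_free := by
    have hm := H.isMetricTens hh
    obtain ⟨Υ, hΥ⟩ := hD.exists_isBeta hC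
    have hskew (p : M) (y : Fin 2 → V p) (z w : V p) :
        pairing (h.1 p) (Υ p y z) w + pairing (h.1 p) z (Υ p y w) = 0 := by
      choose Y hY using fun i => exists_vecSec_apply_eq p (y i)
      obtain ⟨Z, rfl⟩ := exists_vecSec_apply_eq p z
      obtain ⟨W, rfl⟩ := exists_vecSec_apply_eq p w
      obtain rfl : (fun i => Y i p) = y := funext hY
      rw [hΥ, hΥ]
      exact congrArg (fun f : Fun M => f p) (hp.metricFun_curvV hm hC (Y 0) (Y 1) Z W)
    refine ⟨Υ, ⟨fun Y Z => ?_, fun p y => ⟨0, fun g hg z w => ?_⟩⟩, fun Y Z p => ?_,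
      fun Y₁ Y₂ p => (hm p).trace _ (hskew p _)⟩
    · simp only [hΥ]
      exact (curvV C (Y 0) (Y 1) Z).contMDiff
    · obtain ⟨c, -, hc⟩ := hg.exists_smul hh p
      rw [hc, pairing_smul_left, pairing_smul_left, pairing_smul_left, ← mul_add, hskew]
      ring
    · rw [hD.along_curv, curv_ofVec, hΥ]
      rfl

end IsConn

namespace BundleIso

variable (E : BundleIso V) (hm : ∀ p, IsMetricTens (h.1 p))

theorem torsionFree_lcData : TorsionFree (E.lcData hm) := fun X Y f => by
  change _ = E.anchor (E.lcV hm X Y - E.lcV hm Y X) f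
  rw [lcV_sub, anchor_lie]
  rfl

theorem isParallel_lcData : IsParallel (E.lcData hm) h := fun X =>
  ((E.lcData hm X).nabla_metric_eq_zero_iff hm).2 fun Y Z => E.anchor_metricFun hm X Y Z

theorem pair_lcData_nC (Y Z : VecSec V) (ξ : CovSec V) : pair ((E.lcData hm Y).nC ξ) Z =
    E.anchor Y (pair ξ Z) - pair ξ (E.lcV hm Y Z) :=
  (E.exists_lcC hm Y ξ).choose_spec Z

theorem anchor_add (Y Z : VecSec V) (f : Fun M) :
    E.anchor (Y + Z) f = E.anchor Y f + E.anchor Z f := by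
  ext p
  have h1 : E.toEquiv p ((Y + Z) p) = E.toEquiv p (Y p) + E.toEquiv p (Z p) :=
    map_add (E.toEquiv p) _ _
  rw [anchor_apply, h1, map_add]
  rfl

theorem anchor_fsmul (f : Fun M) (Y : VecSec V) (g : Fun M) :
    E.anchor (fsmul f Y) g = f * E.anchor Y g := by
  ext p
  have h1 : E.toEquiv p (fsmul f Y p) = f p • E.toEquiv p (Y p) := map_smul (E.toEquiv p) _ _
  rw [anchor_apply, h1, map_smul]
  rfl

/-- For fixed `Y`, both sides of additivity and of function-linearity are derivations in `u`; the
product of `f` with a derivation is again one because functions are central. So they need only be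
compared on functions and on sections of `V` and `V*`. -/
theorem exists_isConn_lcData : ∃ D, IsConn D (E.lcData hm) := by
  refine exists_isConn (fun Y Z u => ?_) fun f Y u => ?_
  · refine LinearMap.congr_fun (f := (E.lcData hm (Y + Z)).nabla)
      (g := (E.lcData hm Y).nabla + (E.lcData hm Z).nabla)
      (derivation_ext (ConnData.nabla_mul _) (fun u v => ?_) (fun f => ?_) (fun W => ?_)
        fun ξ => ?_) u
    · simp only [LinearMap.add_apply, ConnData.nabla_mul, add_mul, mul_add]
      abel
    · simp only [LinearMap.add_apply, ConnData.nabla_ofFun, ← ofFun_add]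
      exact congrArg _ (E.anchor_add Y Z f)
    · simp only [LinearMap.add_apply, ConnData.nabla_ofVec, ← ofVec_add]
      exact congrArg _ (E.lcV_add_left hm Y Z W)
    · simp only [LinearMap.add_apply, ConnData.nabla_ofCov, ← ofCov_add]
      refine congrArg _ (covSec_ext_pair fun W => ?_)
      have h1 (η η' : CovSec V) : pair (η + η') W = pair η W + pair η' W := rfl
      rw [h1, pair_lcData_nC, pair_lcData_nC, pair_lcData_nC, lcV_add_left, anchor_add, pair_add]
      ring
  · refine LinearMap.congr_fun (f := (E.lcData hm (fsmul f Y)).nabla)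
      (g := LinearMap.mulLeft ℝ (ofFun V f) ∘ₗ (E.lcData hm Y).nabla)
      (derivation_ext (ConnData.nabla_mul _) (fun u v => ?_) (fun g => ?_) (fun W => ?_)
        fun ξ => ?_) u
    · simp only [LinearMap.comp_apply, LinearMap.mulLeft_apply, ConnData.nabla_mul, mul_add]
      rw [← mul_assoc, ← mul_assoc, ofFun_mul_comm f u, mul_assoc u]
    · simp only [LinearMap.comp_apply, LinearMap.mulLeft_apply, ConnData.nabla_ofFun, ← ofFun_mul]
      exact congrArg _ (E.anchor_fsmul f Y g)
    · simp only [LinearMap.comp_apply, LinearMap.mulLeft_apply, ConnData.nabla_ofVec,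
        ← ofVec_fsmul]
      exact congrArg _ (E.lcV_fsmul_left hm f Y W)
    · simp only [LinearMap.comp_apply, LinearMap.mulLeft_apply, ConnData.nabla_ofCov,
        ← ofCov_fsmul]
      refine congrArg _ (covSec_ext_pair fun W => ?_)
      have h1 (η : CovSec V) : pair (fsmul f η) W = f * pair η W := rfl
      rw [h1, pair_lcData_nC, pair_lcData_nC, lcV_fsmul_left, anchor_fsmul, pair_fsmul]
      ring

theorem isAnchor_of_isConn (hD : IsConn D (E.lcData hm)) : IsAnchor D E := fun Y f p => by
  rw [hD.along_nabla, ConnData.nabla_ofFun]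
  rfl

theorem isPullback_of_isConn (hD : IsConn D (E.lcData hm)) :
    IsPullback E (E.diffMetric hm).lc D := by
  refine ⟨E.isAnchor_of_isConn hm hD, fun Y Z p => ?_⟩
  rw [hD.along_nabla, ConnData.nabla_ofVec]
  rfl

theorem hasFactor_of_isConn (hD : IsConn D (E.lcData hm)) : HasFactor 1 D h 0 :=
  ⟨fun p => zero_mem _, by rw [zero_mul]; exact hD.eq_zero (E.isParallel_lcData hm)⟩

end BundleIso

end Existence

/-! ### Every admissible diamond is the Levi-Civita diamond. -/

section Uniqueness

variable {M : Type*} [TopologicalSpace M] [T2Space M] [ChartedSpace R4 M] [IsManifold (𝓡 4) ∞ M]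
variable {V : M → Type*} [TopologicalSpace (TotalSpace R4 V)]
  [∀ p, TopologicalSpace (V p)] [∀ p, AddCommGroup (V p)] [∀ p, Module ℝ (V p)]
  [FiberBundle R4 V] [VectorBundle ℝ R4 V] [ContMDiffVectorBundle ∞ R4 V (𝓡 4)]

/-- Functions separate tangent vectors. -/
theorem eq_zero_of_mvfderiv {p : M} {v : TangentSpace (𝓡 4) p}
    (hv : ∀ f : Fun M, mvfderiv (𝓡 4) f p v = 0) : v = 0 := by
  suffices h : ∀ i, (show R4 from v) i = 0 from PiLp.ext h
  intro i
  -- The test functions are the coordinates of a chart, cut off to global functions; their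
  -- differentials at `p` are the coordinates of `v`.
  have hs : ContMDiffOn (𝓡 4) 𝓘(ℝ, ℝ) ∞ (fun q => (EuclideanSpace.proj i : R4 →L[ℝ] ℝ)
      (extChartAt (𝓡 4) p q)) (chartAt R4 p).source :=
    (EuclideanSpace.proj i : R4 →L[ℝ] ℝ).contMDiff.comp_contMDiffOn
      contMDiffOn_extChartAt
  obtain ⟨g, hg⟩ := exists_fun_eq (chartAt R4 p).open_source (mem_chart_source R4 p) hs
  have h1 := hv g
  have h2 : mfderiv (𝓡 4) 𝓘(ℝ, ℝ) g p = mfderiv (𝓡 4) 𝓘(ℝ, ℝ)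
      ((EuclideanSpace.proj i : R4 →L[ℝ] ℝ) ∘ extChartAt (𝓡 4) p) p :=
    Filter.EventuallyEq.mfderiv_eq hg
  have h3 := ((EuclideanSpace.proj i : R4 →L[ℝ] ℝ).hasMFDerivAt.comp p
    (mdifferentiableAt_extChartAt (I := 𝓡 4) (mem_chart_source R4 p)).hasMFDerivAt).mfderiv
  rw [mvfderiv, h2] at h1
  rw [mfderiv_extChartAt_self] at h3
  exact (congrArg (fun L => L v) h3).symm.trans h1

theorem BundleIso.anchor_injective (E : BundleIso V) {Y Z : VecSec V}
    (h : ∀ f, E.anchor Y f = E.anchor Z f) : Y = Z := by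
  ext p
  refine (E.toEquiv p).injective (sub_eq_zero.1 (eq_zero_of_mvfderiv fun f => ?_))
  rw [map_sub]
  exact sub_eq_zero.2 (congrArg (fun g : Fun M => g p) (h f))

theorem TF.sum_apply {ι : Type*} (s : Finset ι) (u : ι → TF V) (p : M) :
    (∑ i ∈ s, u i).1 p = ∑ i ∈ s, (u i).1 p := by
  rw [AddSubmonoidClass.coe_finsetSum, Finset.sum_apply]

theorem contMDiffMap_sum_apply {ι : Type*} (s : Finset ι) (f : ι → Fun M) (p : M) :
    (∑ i ∈ s, f i) p = ∑ i ∈ s, f i p := by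
  have := congrFun (map_sum ContMDiffMap.coeFnAddMonoidHom f s) p
  rwa [Finset.sum_apply] at this

/-- A derivation of the algebra of tensor fields that kills the identity is compatible with the
pairing of `V` and `V*`. -/
theorem compat_of_derivation {N : TF V →ₗ[ℝ] TF V}
    (hN : ∀ u v, N (u * v) = N u * v + u * N v) (hI : N (idField V) = 0)
    {a : Derivation ℝ (Fun M) (Fun M)} (ha : ∀ f, N (ofFun V f) = ofFun V (a f))
    {nV : VecSec V → VecSec V} (hV : ∀ Z, N (ofVec Z) = ofVec (nV Z))
    {nC : CovSec V → CovSec V} (hC : ∀ ξ, N (ofCov ξ) = ofCov (nC ξ)) (ξ : CovSec V)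
    (Z : VecSec V) : a (pair ξ Z) = pair (nC ξ) Z + pair ξ (nV Z) := by
  ext p
  obtain ⟨Fr⟩ := nonempty_frameAt (V := V) p
  let F := Fr.vecs
  let l := Fr.covs
  have hZ : (ofVec (nV Z)).1 p = (∑ a', (ofFun V (a (pair (l a') Z)) * ofVec (F a') +
      ofFun V (pair (l a') Z) * ofVec (nV (F a')))).1 p := by
    rw [← hV, derivation_local hN (v := ∑ a', ofFun V (pair (l a') Z) * ofVec (F a')), map_sum]
    · simp only [hN, ha, hV]
    · filter_upwards [Fr.eventually_sum] with q hq
      rw [TF.sum_apply, ofVec_apply, hq (Z q), map_sum]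
      exact Finset.sum_congr rfl fun a' _ => (map_smul vec _ _).trans (Algebra.smul_def _ _)
  have hξ : (ofCov (nC ξ)).1 p = (∑ a', (ofFun V (a (pair ξ (F a'))) * ofCov (l a') +
      ofFun V (pair ξ (F a')) * ofCov (nC (l a')))).1 p := by
    rw [← hC, derivation_local hN (v := ∑ a', ofFun V (pair ξ (F a')) * ofCov (l a')), map_sum]
    · simp only [hN, ha, hC]
    · filter_upwards [Fr.exists_basis] with q ⟨b, hb, hb'⟩
      rw [TF.sum_apply, ofCov_apply,
        ← b.sum_dual_apply_smul_coord (ξ q : V q →ₗ[ℝ] ℝ), map_sum]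
      refine Finset.sum_congr rfl fun a' _ => (map_smul cov _ _).trans ?_
      rw [hb, hb']
      exact Algebra.smul_def _ _
  -- Locally the identity is `∑ λᵃ ⊗ Fₐ`, so `N I = 0` says that `N` acts on the dual frame by minus
  -- the transpose of its action on the frame.
  have hId : (∑ a', (ofCov (nC (l a')) * ofVec (F a') + ofCov (l a') * ofVec (nV (F a')))).1 p
      = 0 := by
    have h1 : (N (idField V)).1 p = 0 := by rw [hI]; rfl
    rw [derivation_local hN (v := ∑ a', ofCov (l a') * ofVec (F a')), map_sum] at h1
    · simpa only [hN, hV, hC] using h1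
    · filter_upwards [Fr.exists_basis] with q ⟨b, hb, hb'⟩
      rw [TF.sum_apply]
      refine (idTens_eq (fibreBasis V q) b).trans ?_
      refine Finset.sum_congr rfl fun a' _ => ?_
      rw [hb, hb']
      rfl
  have hleib : a (pair ξ Z) p =
      ∑ a', (ξ p (F a' p) * a (pair (l a') Z) p + l a' p (Z p) * a (pair ξ (F a')) p) := by
    rw [derivation_apply_congr a (g := ∑ a', pair ξ (F a') * pair (l a') Z), map_sum]
    · simp only [Derivation.leibniz]
      exact contMDiffMap_sum_apply _ _ _
    · filter_upwards [Fr.eventually_sum] with q hq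
      rw [contMDiffMap_sum_apply, pair_apply, hq (Z q), map_sum]
      exact Finset.sum_congr rfl fun a' _ => (map_smul (ξ q) _ _).trans (mul_comm _ _)
  simp only [TF.sum_apply, TF.add_apply, TF.mul_apply, ofVec_apply, ofCov_apply, ofFun_apply]
    at hZ hξ hId
  have h1 := congrArg (fun t => eps (contrCov (ξ p : V p →ₗ[ℝ] ℝ) t)) hZ
  have h2 := congrArg (fun t => eps (contr (Z p) t)) hξ
  have h3 := congrArg (fun t => eps (contrCov (ξ p : V p →ₗ[ℝ] ℝ) (contr (Z p) t))) hId
  simp only [map_sum, map_add, contrCov_algebraMap_mul, contr_algebraMap_mul, contr_cov_mul,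
    contr_cov, contrCov_vec, map_smul, map_mul, eps_algebraMap, smul_eq_mul, map_zero,
    ContinuousLinearMap.coe_coe, pair_apply] at h1 h2 h3
  change a (pair ξ Z) p = nC ξ p (Z p) + ξ p (nV Z p)
  -- Expanding `nC ξ` and `nV Z` in the frame yields the derivatives of the coefficients, which are
  -- those of `pair ξ Z`, and terms differentiating the frame and its dual. The latter add up to
  -- `h3`.
  rw [hleib, h1, h2, ← sub_eq_zero, ← neg_eq_zero, ← h3, ← Finset.sum_add_distrib,
    ← Finset.sum_sub_distrib, ← Finset.sum_neg_distrib]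
  refine Finset.sum_congr rfl fun a' _ => ?_
  ring

/-- Torsion-free connections that are compatible with the same metric agree. -/
theorem nV_eq_of_torsion {h : TF V} (hm : ∀ p, IsMetricTens (h.1 p))
    {n n' : VecSec V → VecSec V → VecSec V} (htor : ∀ X Y, n X Y - n Y X = n' X Y - n' Y X)
    (hmet : ∀ X Y Z, metricFun h (n X Y) Z + metricFun h Y (n X Z) =
      metricFun h (n' X Y) Z + metricFun h Y (n' X Z)) : n = n' := by
  have hsymm (Y Z) : metricFun h Y Z = metricFun h Z Y := by
    ext p; exact (hm p).symm _ _
  let t (X Y Z : VecSec V) : Fun M := metricFun h (n X Y - n' X Y) Z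
  have h1 (X Y Z) : t X Y Z = t Y X Z := by
    have : n X Y - n' X Y = n Y X - n' Y X := by
      have := htor X Y
      rw [sub_eq_sub_iff_add_eq_add] at this ⊢
      rw [this, add_comm]
    simp only [t, this]
  have h2 (X Y Z) : t X Y Z = - t X Z Y := by
    simp only [t, metricFun_sub_left, hsymm (n X Z), hsymm (n' X Z)]
    linear_combination hmet X Y Z
  have h3 (X Y Z) : t X Y Z = 0 := by
    -- Applying skewness in the last two slots and symmetry in the first two alternately, three
    -- times each, returns to the start with the opposite sign.
    have h4 : t X Y Z = - t X Y Z := by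
      linear_combination h2 X Y Z - h1 X Z Y - h2 Z X Y + h1 Z Y X + h2 Y Z X - h1 Y X Z
    ext p
    have h5 : t X Y Z p = - t X Y Z p := congrArg (fun f : Fun M => f p) h4
    change t X Y Z p = 0
    linarith
  funext X Y
  refine sub_eq_zero.1 ?_
  ext p
  refine (hm p).nondeg _ fun z => ?_
  obtain ⟨Z, rfl⟩ := exists_vecSec_apply_eq p z
  exact congrArg (fun f : Fun M => f p) (h3 X Y Z)

/-- A geometric diamond that preserves a representative is given by its Levi-Civita connection. -/
theorem IsGeometric.isConn {H : ConformalStructure V} {h : TF V}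
    (hm : ∀ p, IsMetricTens (h.1 p)) {D : TF V →ₗ[ℝ] TF V} (hD : IsGeometric H D)
    {E : BundleIso V} (hE : IsAnchor D E) (hf : HasFactor 1 D h 0) : IsConn D (E.lcData hm) := by
  have hd := hD.diamond
  let N (Y : VecSec V) : TF V →ₗ[ℝ] TF V := contrF Y ∘ₗ D
  have hN (Y u v) : N Y (u * v) = N Y u * v + u * N Y v :=
    TF.ext_apply fun p => hd.leibniz ![Y] u v p
  have hI (Y) : N Y (idField V) = 0 := by
    simp only [N, LinearMap.comp_apply, hd.map_id, map_zero]
  have ha (Y f) : N Y (ofFun V f) = ofFun V (E.anchor Y f) := TF.ext_apply fun p => hE Y f p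
  choose nV hV using fun Y : VecSec V => hd.map_vec ![Y]
  choose nC hC using fun Y : VecSec V => hd.map_cov ![Y]
  have hV' (Y Z) : N Y (ofVec Z) = ofVec (nV Y Z) := TF.ext_apply fun p => hV Y Z p
  have hC' (Y ξ) : N Y (ofCov ξ) = ofCov (nC Y ξ) := TF.ext_apply fun p => hC Y ξ p
  let C (Y : VecSec V) : ConnData V :=
    { a := E.anchor Y
      nV := nV Y
      nC := nC Y
      compat := compat_of_derivation (hN Y) (hI Y) (ha Y) (hV' Y) (hC' Y) }
  have hDC : IsConn D C :=
    { form_valued := hd.form_valued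
      contrF_eq := fun Y u => LinearMap.congr_fun (derivation_ext (hN Y) (ConnData.nabla_mul _)
        (fun f => by rw [ha, ConnData.nabla_ofFun]) (fun Z => by rw [hV', ConnData.nabla_ofVec])
        fun ξ => by rw [hC', ConnData.nabla_ofCov]) u }
  have hpar : IsParallel C h := fun X => by
    rw [← hDC.contrF_eq, hf.2, zero_mul, map_zero]
  have htor (X Y : VecSec V) : nV X Y - nV Y X = E.lie X Y := by
    refine E.anchor_injective fun f => ?_
    -- Verticality of the half bracket enters here; since the anchor is injective, it identifies `nV
    -- X Y - nV Y X` with the transported Lie bracket.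
    have h1 : curv C X Y (ofFun V f) = 0 := by
      rw [← hDC.contrF_contrF, ← half_bracket, hD.vertical.vertical, map_zero, map_zero]
    rw [curv_ofFun, ← ofFun_zero] at h1
    rw [E.anchor_lie]
    exact (sub_eq_zero.1 (ofFun_injective V h1)).symm
  have hnV : nV = E.lcV hm := by
    refine nV_eq_of_torsion hm (fun X Y => ?_) fun X Y Z => ?_
    · rw [htor, E.lcV_sub hm]
    · rw [← E.anchor_metricFun hm]
      exact (((C X).nabla_metric_eq_zero_iff hm).1 (hpar X) Y Z).symm
  refine ⟨hd.form_valued, fun Y u => ?_⟩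
  rw [hDC.contrF_eq]
  exact LinearMap.congr_fun (ConnData.nabla_congr (C := C Y) (C' := E.lcData hm Y) rfl
    (congrFun hnV Y)) u

end Uniqueness

end Diamond

end

/-! ### Conclusion. -/

theorem mainTheorem6 {M : Type*} [TopologicalSpace M] [T2Space M] [SigmaCompactSpace M]
    [SimplyConnectedSpace M] [ChartedSpace Diamond.R4 M] [IsManifold (𝓡 4) ∞ M]
    (V : M → Type*) [TopologicalSpace (TotalSpace Diamond.R4 V)]
    [∀ p, TopologicalSpace (V p)] [∀ p, AddCommGroup (V p)] [∀ p, Module ℝ (V p)]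
    [FiberBundle Diamond.R4 V] [VectorBundle ℝ Diamond.R4 V]
    [ContMDiffVectorBundle ∞ Diamond.R4 V (𝓡 4)]
    (H : Diamond.ConformalStructure V) (E' : Diamond.BundleIso V)
    (h' : Diamond.TF V) (hh' : H.IsRep h') :
    (∃! D : Diamond.TF V →ₗ[ℝ] Diamond.TF V,
      Diamond.IsGeometric H D ∧ Diamond.IsAnchor D E' ∧ Diamond.HasFactor 1 D h' 0) ∧
    ∀ D : Diamond.TF V →ₗ[ℝ] Diamond.TF V,
      Diamond.IsGeometric H D → Diamond.IsAnchor D E' → Diamond.HasFactor 1 D h' 0 →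
      ∃ cd : CovariantDerivative (𝓡 4) Diamond.R4 (TangentSpace (𝓡 4) : M → Type),
        Diamond.IsLeviCivita (E'.pushMetric h') cd ∧ Diamond.IsPullback E' cd D := by
  have hm := H.isMetricTens hh'
  obtain ⟨D₀, h₀⟩ := E'.exists_isConn_lcData hm
  have hA := E'.isAnchor_of_isConn hm h₀
  refine ⟨⟨D₀, ⟨h₀.isGeometric (E'.isParallel_lcData hm) hh' (E'.torsionFree_lcData hm) hA, hA,
    E'.hasFactor_of_isConn hm h₀⟩, ?_⟩, ?_⟩
  -- Every competitor is an operator of the same connection data as `D₀`, and a form-valued operator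
  -- is determined by its contractions.
  · rintro D ⟨hD, hDA, hDF⟩
    exact (hD.isConn hm hDA hDF).unique h₀
  · intro D hD hDA hDF
    exact ⟨(E'.diffMetric hm).lc, (E'.diffMetric hm).isLeviCivita_lc,
      E'.isPullback_of_isConn hm (hD.isConn hm hDA hDF)⟩
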